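/- **Setting.** Let $m>0$, $\kappa>0$, $\lambda\in\mathbb R$. On $\mathbb R^3$ use the Lorentz product $x\cdot y=x_0y_0-x_1y_1-x_2y_2$ and the invariant measure $d\mu(p)=\delta(p^2-m^2)\theta(p_0)\,d^3p$ on the mass shell. Let $R:\{\operatorname{Im} z\ge 0\}\to\mathbb C$ be a deformation function: continuous, bounded, analytic on $\{\operatorname{Im}z>0\}$, with $R(-a)=\overline{R(a)}=R(a)^{-1}$ for $a\in\mathbb R$. *Covering group.* $\tilde{\mathcal L}$, the universal covering of the proper orthochronous Lorentz group, is the set of pairs $\tilde L=(\gamma,\omega)$, $\gamma\in\mathbb C$, $|\gamma|<1$, $\omega\in\mathbb R$, with product $(\gamma_1,\omega_1)(\gamma_2,\omega_2)=(\gamma_3,\omega_3)$, $$\gamma_3=\frac{\gamma_2+\gamma_1e^{-i\omega_2}}{1+\gamma_1\bar\gamma_2e^{-i\omega_2}},\qquad \omega_3=\omega_1+\omega_2+2\arg(1+\gamma_1\bar\gamma_2e^{-i\omega_2}).$$ It acts on $\mathbb R^3$ through $\Lambda=\Lambda(\tilde L)$, where with $z=x_1+ix_2$: $x_0'=\frac{(1+|\gamma|^2)x_0+2\operatorname{Re}(\bar\gamma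 z)}{1-|\gamma|^2}$, $z'=e^{i\omega}\frac{2\gamma x_0+z+\gamma^2\bar z}{1-|\gamma|^2}$. Put $\tilde r(\omega)=(0,\omega)$. With $\gamma(p)=\frac{p_1+ip_2}{p_0+m}$ the Wigner rotation angle is $$\Omega(\tilde L,p)=\omega+2\arg\bigl(1-\gamma(p)\bar\gamma e^{-i\omega}\bigr)+2\arg\Bigl(1+\tfrac{\gamma-\gamma(p)e^{-i\omega}}{1-\gamma(p)\bar\gamma e^{-i\omega}}\,\overline{\gamma(\Lambda^{-1}p)}\Bigr).$$ *Paths of wedges.* Wedges are the images $W=\Lambda W_0$ of $W_0=\{x: x_1>|x_0|\}$ under proper orthochronous Lorentz transformations; the causal complement $A'$ of $A$ is the interior of the set of points spacelike to all of $A$. A path of wedges $\tilde W=(W,\tilde e)$ is a wedge $W$ with a homotopy class $\tilde e$ of continuous paths in $\{e: e\cdot e=-1\}$ from $e_0=(0,0,-1)$ to a point of $W$ (the endpoint may move inside $W$). $\tilde{\mathcal L}$ acts by $\tilde L\cdot(W,[t\mapsto e(t)])=(\Lambda W,[t\mapsto\Lambda(t)e(t)])$, where $t\mapsto \Lambda(t)$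 is a path from $1$ to $\Lambda$ representing $\tilde L$. $\tilde W_0$ is $W_0$ with a path from $e_0$ that stays inside $W_0$. If the wedge of $\tilde W'$ is the causal complement of that of $\tilde W$, then $k=k(\tilde W,\tilde W')$ denotes the odd integer such that $\tilde W'=\tilde L\,\tilde r(k\pi)\tilde W_0$ for some $\tilde L$ with $\tilde L\tilde W_0=\tilde W$. *Deformed fields.* The doubled Fock space $\mathcal H=\mathcal F_s(L^2(\mathbb R^3,d\mu))\otimes\mathcal F_s(L^2(\mathbb R^3,d\mu))$ consists of the square summable families $\Psi_n^l(p_1,\dots,p_{n+l})$ of square integrable functions symmetric in the first $n$ (particle) and the last $l$ (antiparticle) momenta; $q=n-l$ is the charge, and $\mathcal D\subset\mathcal H$ denotes the vectors of finite particle number. For $\tilde W$ choose $\tilde L_{\tilde W}$ with $\tilde L_{\tilde W}\tilde W_0=\tilde W$, with Lorentz matrix $L_W$, and put $$u_{\tilde W}(p)=e^{-i\lambda\Omega(\tilde L_{\tilde W},p)}u_0(L_W^{-1}p),\quad u_0(p)=\Bigl(\tfrac{m-ip_2}{\sqrt{m^2+p_2^2}}\Bigr)^{\lambda}\Bigl(\tfrac{p_0+m-p_1+ip_2}{p_0+m-p_1-ip_2}\Bigr)^{\lambda},$$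 with principal powers, and $Q_W=L_WQ_0L_W^{-1}$, $Q_0x=\kappa(x_1,x_0,0)$. With $$A_{\tilde W}^{n,l}(p;p_1,\dots,p_{n+l})=u_{\tilde W}(p)^{q+1}\prod_{i=1}^{n}u_{\tilde W}(p_i)R(Q_Wp\cdot p_i)\prod_{j=n+1}^{n+l}\overline{u_{\tilde W}(p_j)}R(Q_Wp\cdot p_j),$$ define on $\mathcal D$, for $\varphi\in L^2(\mathbb R^3,d\mu)$, $$(a_{\tilde W}(\varphi)\Psi)_n^l(\underline p)=\sqrt{n+1}\int d\mu(p)\,\overline{\varphi(p)}\,A^{n,l}_{\tilde W}(p;\underline p)\,\Psi_{n+1}^l(p,\underline p),\qquad b_{\tilde W}(\varphi)=C\,a_{\tilde W}(\varphi)\,C,$$ with $C$ the exchange of particles and antiparticles, and let $a^*_{\tilde W}(\varphi),b^*_{\tilde W}(\varphi)$ be their adjoints. For a Schwartz function $f$ on $\mathbb R^3$ let $f^+(p)=\int d^3x\,f(x)e^{ip\cdot x}$, restricted to the mass shell, and $$\Phi_{\tilde W}(f)=a^*_{\tilde W}(f^+)+b_{\tilde W}(\bar f^+),\qquad \Phi^*_{\tilde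 W}(f)=b^*_{\tilde W}(f^+)+a_{\tilde W}(\bar f^+).$$ **Theorem.** (i) For every $\tilde W$ a transformation $\tilde L_{\tilde W}$ exists, and $Q_W$ and the values of $u_{\tilde W}$ on the mass shell do not depend on its choice. (ii) Let $\tilde W,\tilde W'$ be paths of wedges such that the wedge $W'$ of $\tilde W'$ is the causal complement of the wedge $W$ of $\tilde W$. Then the odd integer $k=k(\tilde W,\tilde W')$ exists and is unique, and for all Schwartz functions $f,g$ with $\operatorname{supp}f+W\subset(\operatorname{supp}g+W')'$ one has on $\mathcal D$ $$\Phi_{\tilde W}(f)\Phi_{\tilde W'}(g)=e^{-2\pi i\lambda k}\,\Phi_{\tilde W'}(g)\Phi_{\tilde W}(f),\qquad \Phi_{\tilde W}(f)\Phi^*_{\tilde W'}(g)=e^{2\pi i\lambda k}\,\Phi^*_{\tilde W'}(g)\Phi_{\tilde W}(f).$$ (iii) The formula $$(U(a,\tilde L)\Psi)_n^l(\underline p)=e^{ia\cdot\sum_ip_i}\,e^{i\lambda q\left(\sum_{i\le n}\Omega(\tilde L,p_i)-\sum_{j>n}\Omega(\tilde L,p_j)\right)}\,\Psi_n^l(\Lambda^{-1}\underline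 p)$$ defines unitary operators on $\mathcal H$ with $U(a,\tilde L)U(a',\tilde L')=U(a+\Lambda a',\tilde L\tilde L')$, i.e. a spin-$\lambda$ representation of the covering of the proper orthochronous Poincaré group. They leave $\mathcal D$ invariant, and for every path of wedges $\tilde W$ and Schwartz function $f$, with $(\alpha_{(a,\Lambda)}f)(x)=f(\Lambda^{-1}(x-a))$, on $\mathcal D$ $$U(a,\tilde L)\,\Phi_{\tilde W}(f)\,U(a,\tilde L)^{-1}=\Phi_{\tilde L\tilde W}(\alpha_{(a,\Lambda)}f),\qquad U(a,\tilde L)\,\Phi^*_{\tilde W}(f)\,U(a,\tilde L)^{-1}=\Phi^*_{\tilde L\tilde W}(\alpha_{(a,\Lambda)}f).$$ -/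

import Mathlib

open MeasureTheory
open scoped ComplexConjugate

noncomputable section

namespace WedgeAnyons

/-! ### Minkowski space in `2+1` dimensions -/

/-- Minkowski space with coordinates `(x₀, x₁, x₂)`. -/
abbrev V : Type := Fin 3 → ℝ

/-- The Lorentz inner product, signature `(+,-,-)`. -/
def mdot (x y : V) : ℝ := x 0 * y 0 - x 1 * y 1 - x 2 * y 2

/-- Proper orthochronous Lorentz matrices. -/
structure IsRestrictedLorentz (Λ : Matrix (Fin 3) (Fin 3) ℝ) : Prop where
  isometry : ∀ x y, mdot (Λ.mulVec x) (Λ.mulVec y) = mdot x y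
  proper : Λ.det = 1
  orthochronous : ∀ x : V, 0 < mdot x x → 0 < x 0 → 0 < Λ.mulVec x 0

/-- The causal complement of a region: the interior of the set of points spacelike to all of it. -/
def causalCompl (A : Set V) : Set V := interior {x | ∀ y ∈ A, mdot (x - y) (x - y) < 0}

/-- The standard wedge. -/
def standardWedge : Set V := {x | |x 0| < x 1}

/-- Wedges (with the origin in their edge): the Lorentz orbit of the standard wedge. -/
def IsWedge (W : Set V) : Prop :=
  ∃ Λ, IsRestrictedLorentz Λ ∧ W = Λ.mulVec '' standardWedge

/-! ### The universal covering of the proper orthochronous Lorentz group -/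

/-- The universal covering group of the proper orthochronous Lorentz group, as the set of pairs
`(γ, ω)` with `|γ| < 1`. -/
@[ext]
structure CoverLorentz where
  γ : ℂ
  ω : ℝ
  norm_lt : ‖γ‖ < 1

/-- For `Re z > 0` this is `-i log (z / z̄)`, see `phase_eq`. -/
def phase (z : ℂ) : ℝ := 2 * z.arg

theorem phase_eq {z : ℂ} (hz : 0 < z.re) :
    (phase z : ℂ) = -Complex.I * Complex.log (z / conj z) := by
  have hz0 : z ≠ 0 := by rintro rfl; simp at hz
  have habs : |z.arg| < Real.pi / 2 := Complex.abs_arg_lt_pi_div_two_iff.2 (Or.inl hz)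
  have hn : (‖z‖ : ℂ) ≠ 0 := by simpa using hz0
  have h1 : z / conj z = Complex.exp ((phase z : ℝ) * Complex.I) := by
    rw [div_eq_iff (by simpa using hz0)]
    have e1 : conj z = ‖z‖ * Complex.exp (-(z.arg * Complex.I)) := by
      conv_lhs => rw [← Complex.norm_mul_exp_arg_mul_I z]
      rw [map_mul, ← Complex.exp_conj]
      simp
    rw [e1]
    conv_lhs => rw [← Complex.norm_mul_exp_arg_mul_I z]
    rw [mul_left_comm, ← Complex.exp_add]
    congr 2
    unfold phase; push_cast; ring
  rw [abs_lt] at habs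
  rw [h1, Complex.log_exp]
  · rw [mul_comm, mul_assoc, mul_neg, Complex.I_mul_I]; simp
  · unfold phase; simp; linarith
  · unfold phase; simp; linarith

namespace CoverLorentz

theorem one_add_re_pos {z : ℂ} (hz : ‖z‖ < 1) : 0 < (1 + z).re := by
  have := (abs_le.1 (Complex.abs_re_le_norm z)).1
  simp; linarith

theorem norm_aux (a b : ℂ) (w : ℝ) (ha : ‖a‖ < 1) (hb : ‖b‖ < 1) :
    ‖a * conj b * Complex.exp (-(w * Complex.I))‖ < 1 := by
  have : ‖Complex.exp (-(w * Complex.I))‖ = 1 := by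
    simp [Complex.norm_exp]
  rw [norm_mul, norm_mul, this, mul_one, RCLike.norm_conj]
  nlinarith [norm_nonneg a, norm_nonneg b]

theorem norm_mobius (a b : ℂ) (ha : ‖a‖ < 1) (hb : ‖b‖ < 1) :
    ‖(b + a) / (1 + a * conj b)‖ < 1 := by
  have hab : ‖a * conj b‖ < 1 := by
    simpa using norm_aux a b 0 ha hb
  have hre := one_add_re_pos hab
  have hne : 1 + a * conj b ≠ 0 := by
    intro h; rw [h] at hre; simp at hre
  rw [norm_div, div_lt_one (norm_pos_iff.2 hne)]
  have h1 : ‖a‖ ^ 2 < 1 := by nlinarith [norm_nonneg a]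
  have h2 : ‖b‖ ^ 2 < 1 := by nlinarith [norm_nonneg b]
  apply lt_of_pow_lt_pow_left₀ 2 (norm_nonneg _)
  rw [← Complex.normSq_eq_norm_sq, ← Complex.normSq_eq_norm_sq] at *
  simp only [Complex.normSq_apply, Complex.add_re, Complex.add_im, Complex.mul_re, Complex.mul_im,
    Complex.conj_re, Complex.conj_im, Complex.one_re, Complex.one_im] at *
  nlinarith [mul_pos (sub_pos.2 h1) (sub_pos.2 h2)]

/-- The group law
`γ₃ = (γ₂ + γ₁ e^{-iω₂}) / (1 + γ₁ γ̄₂ e^{-iω₂})`,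
`ω₃ = ω₁ + ω₂ - i log ((1 + γ₁ γ̄₂ e^{-iω₂}) / c.c.)`. -/
instance : Mul CoverLorentz where
  mul L₁ L₂ :=
    { γ := (L₂.γ + L₁.γ * Complex.exp (-(L₂.ω * Complex.I))) /
        (1 + L₁.γ * conj L₂.γ * Complex.exp (-(L₂.ω * Complex.I)))
      ω := L₁.ω + L₂.ω + phase (1 + L₁.γ * conj L₂.γ * Complex.exp (-(L₂.ω * Complex.I)))
      norm_lt := by
        have h := norm_mobius (L₁.γ * Complex.exp (-(L₂.ω * Complex.I))) L₂.γ
          (by simpa [Complex.norm_exp] using L₁.norm_lt) L₂.norm_lt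
        rwa [mul_right_comm] at h }

instance : One CoverLorentz := ⟨⟨0, 0, by simp⟩⟩

instance : Inv CoverLorentz where
  inv L := ⟨-L.γ * Complex.exp (L.ω * Complex.I), -L.ω, by
    simpa [Complex.norm_exp] using L.norm_lt⟩

theorem mul_γ (L₁ L₂ : CoverLorentz) :
    (L₁ * L₂).γ = (L₂.γ + L₁.γ * Complex.exp (-(L₂.ω * Complex.I))) /
        (1 + L₁.γ * conj L₂.γ * Complex.exp (-(L₂.ω * Complex.I))) := rfl

theorem mul_ω (L₁ L₂ : CoverLorentz) :
    (L₁ * L₂).ω = L₁.ω + L₂.ω +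
      phase (1 + L₁.γ * conj L₂.γ * Complex.exp (-(L₂.ω * Complex.I))) := rfl

theorem phase_mul {z w : ℂ} (hz : 0 < z.re) (hw : 0 < w.re) :
    phase (z * w) = phase z + phase w := by
  have hz0 : z ≠ 0 := by rintro rfl; simp at hz
  have hw0 : w ≠ 0 := by rintro rfl; simp at hw
  have a := abs_lt.1 (Complex.abs_arg_lt_pi_div_two_iff.2 (Or.inl hz))
  have b := abs_lt.1 (Complex.abs_arg_lt_pi_div_two_iff.2 (Or.inl hw))
  unfold phase
  rw [Complex.arg_mul hz0 hw0 ⟨by linarith, by linarith⟩]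
  ring

theorem exp_phase {z : ℂ} (hz : 0 < z.re) :
    Complex.exp (-(phase z * Complex.I)) = conj z / z := by
  have hz0 : z ≠ 0 := by rintro rfl; simp at hz
  have h0 : Complex.exp (Complex.log (z / conj z)) = z / conj z :=
    Complex.exp_log (div_ne_zero hz0 (by simpa using hz0))
  rw [phase_eq hz]
  have : -(-Complex.I * Complex.log (z / conj z) * Complex.I) = -Complex.log (z / conj z) := by
    linear_combination Complex.log (z / conj z) * Complex.I_mul_I
  rw [this, Complex.exp_neg, h0, inv_div]

theorem conj_exp_neg (w : ℝ) :
    conj (Complex.exp (-(w * Complex.I))) = (Complex.exp (-(w * Complex.I)))⁻¹ := by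
  rw [← Complex.exp_conj, ← Complex.exp_neg]; simp

protected theorem mul_assoc (a b c : CoverLorentz) : a * b * c = a * (b * c) := by
  set e := Complex.exp (-(b.ω * Complex.I)) with he
  set f := Complex.exp (-(c.ω * Complex.I)) with hf
  have hce : conj e = e⁻¹ := conj_exp_neg _
  have hcf : conj f = f⁻¹ := conj_exp_neg _
  have he0 : e ≠ 0 := Complex.exp_ne_zero _
  have hf0 : f ≠ 0 := Complex.exp_ne_zero _
  have p1 : 0 < (1 + a.γ * conj b.γ * e).re := one_add_re_pos (norm_aux _ _ _ a.norm_lt b.norm_lt)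
  have p2 : 0 < (1 + b.γ * conj c.γ * f).re := one_add_re_pos (norm_aux _ _ _ b.norm_lt c.norm_lt)
  have p3 : 0 < (1 + (a * b).γ * conj c.γ * f).re :=
    one_add_re_pos (norm_aux _ _ _ (a * b).norm_lt c.norm_lt)
  have p4 : 0 < (1 + a.γ * conj (b * c).γ * Complex.exp (-((b * c).ω * Complex.I))).re :=
    one_add_re_pos (norm_aux _ _ _ a.norm_lt (b * c).norm_lt)
  have n1 : 1 + a.γ * conj b.γ * e ≠ 0 := by intro h; rw [h] at p1; simp at p1
  have n2 : 1 + b.γ * conj c.γ * f ≠ 0 := by intro h; rw [h] at p2; simp at p2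
  have hff : f * f⁻¹ = 1 := mul_inv_cancel₀ hf0
  have hab : (1 + a.γ * conj b.γ * e) * (a * b).γ = b.γ + a.γ * e := by
    rw [mul_γ, ← he, mul_div_cancel₀ _ n1]
  have hbc : (1 + b.γ * conj c.γ * f) * (b * c).γ = c.γ + b.γ * f := by
    rw [mul_γ, ← hf, mul_div_cancel₀ _ n2]
  have hbc' : (1 + conj b.γ * c.γ * f⁻¹) * conj (b * c).γ = conj c.γ + conj b.γ * f⁻¹ := by
    have := congrArg conj hbc
    simpa [hcf] using this
  have hE : Complex.exp (-((b * c).ω * Complex.I)) * (1 + b.γ * conj c.γ * f) =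
      e * f * (1 + conj b.γ * c.γ * f⁻¹) := by
    have h := exp_phase p2
    rw [mul_ω, ← hf]
    have : (-(((b.ω + c.ω + phase (1 + b.γ * conj c.γ * f) : ℝ) : ℂ) * Complex.I)) =
        -(b.ω * Complex.I) + -(c.ω * Complex.I) +
          -(phase (1 + b.γ * conj c.γ * f) * Complex.I) := by push_cast; ring
    rw [this, Complex.exp_add, Complex.exp_add, h, ← he, ← hf, mul_assoc, div_mul_cancel₀ _ n2]
    simp [hcf]
  have hprod : (1 + a.γ * conj b.γ * e) * (1 + (a * b).γ * conj c.γ * f) =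
      (1 + b.γ * conj c.γ * f) *
        (1 + a.γ * conj (b * c).γ * Complex.exp (-((b * c).ω * Complex.I))) := by
    linear_combination (conj c.γ * f) * hab - (a.γ * conj (b * c).γ) * hE -
      (a.γ * e * f) * hbc' - (a.γ * conj b.γ * e) * hff
  have n3 : 1 + (a * b).γ * conj c.γ * f ≠ 0 := by intro h; rw [h] at p3; simp at p3
  have n4 : 1 + a.γ * conj (b * c).γ * Complex.exp (-((b * c).ω * Complex.I)) ≠ 0 := by
    intro h; rw [h] at p4; simp at p4
  ext
  · rw [mul_γ, ← hf, mul_γ a (b * c), div_eq_div_iff n3 n4]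
    apply mul_left_cancel₀ (mul_ne_zero n1 n2)
    have hl : (1 + a.γ * conj b.γ * e) * (c.γ + (a * b).γ * f) =
        (1 + b.γ * conj c.γ * f) *
          ((b * c).γ + a.γ * Complex.exp (-((b * c).ω * Complex.I))) := by
      linear_combination f * hab - hbc - a.γ * hE - (a.γ * conj b.γ * c.γ * e) * hff
    linear_combination (1 + b.γ * conj c.γ * f) *
      (1 + a.γ * conj (b * c).γ * Complex.exp (-((b * c).ω * Complex.I))) * hl -
      (1 + b.γ * conj c.γ * f) *
          ((b * c).γ + a.γ * Complex.exp (-((b * c).ω * Complex.I))) * hprod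
  · rw [mul_ω, ← hf, mul_ω a b, mul_ω a (b * c), mul_ω b c, ← he, ← hf]
    have h := phase_mul p1 p3
    rw [hprod, phase_mul p2 p4] at h
    rw [mul_ω b c, ← hf] at h
    linarith

instance : Group CoverLorentz :=
  Group.ofLeftAxioms CoverLorentz.mul_assoc
    (fun a => by ext <;> simp [mul_γ, mul_ω, phase, show (1 : CoverLorentz) = ⟨0, 0, by simp⟩ from rfl])
    (fun a => by
      have hi : a⁻¹ = ⟨-a.γ * Complex.exp (a.ω * Complex.I), -a.ω, by
          simpa [Complex.norm_exp] using a.norm_lt⟩ := rfl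
      have h : Complex.exp (a.ω * Complex.I) * Complex.exp (-(a.ω * Complex.I)) = 1 := by
        rw [← Complex.exp_add]; simp
      have h1 : (-a.γ * Complex.exp (a.ω * Complex.I)) * conj a.γ *
          Complex.exp (-(a.ω * Complex.I)) = ((-‖a.γ‖ ^ 2 : ℝ) : ℂ) := by
        have := Complex.mul_conj' a.γ
        push_cast
        linear_combination (-a.γ * conj a.γ) * h - this
      have h2 : (0 : ℝ) ≤ 1 + -‖a.γ‖ ^ 2 := by nlinarith [norm_nonneg a.γ, a.norm_lt]
      ext
      · rw [mul_γ, hi]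
        simp only [show (1 : CoverLorentz) = ⟨0, 0, by simp⟩ from rfl]
        rw [mul_assoc, h]; simp
      · rw [mul_ω, hi]
        simp only [show (1 : CoverLorentz) = ⟨0, 0, by simp⟩ from rfl]
        rw [h1, phase, show (1 : ℂ) + ((-‖a.γ‖ ^ 2 : ℝ) : ℂ) = ((1 + -‖a.γ‖ ^ 2 : ℝ) : ℂ) by
          push_cast; ring, Complex.arg_ofReal_of_nonneg h2]
        simp)

/-- The pure rotation `r̃(ω)`. -/
def rot (ω : ℝ) : CoverLorentz := ⟨0, ω, by simp⟩

/-- The covering homomorphism. With `z = x₁ + i x₂`, the transformed coordinates are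
`x₀' = ((1 + |γ|²) x₀ + 2 Re (γ̄ z)) / (1 - |γ|²)` and
`z' = e^{iω} (2 γ x₀ + z + γ² z̄) / (1 - |γ|²)`. -/
def toMatrix (L : CoverLorentz) : Matrix (Fin 3) (Fin 3) ℝ :=
  let D : ℝ := 1 - ‖L.γ‖ ^ 2
  let c₀ : ℂ := Complex.exp (L.ω * Complex.I) * (2 * L.γ)
  let c₁ : ℂ := Complex.exp (L.ω * Complex.I) * (1 + L.γ ^ 2)
  let c₂ : ℂ := Complex.exp (L.ω * Complex.I) * (Complex.I * (1 - L.γ ^ 2))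
  D⁻¹ • !![1 + ‖L.γ‖ ^ 2, 2 * L.γ.re, 2 * L.γ.im;
           c₀.re, c₁.re, c₂.re;
           c₀.im, c₁.im, c₂.im]

/-- The Lorentz action of the covering group on Minkowski space. -/
def act (L : CoverLorentz) (x : V) : V := L.toMatrix.mulVec x

end CoverLorentz

namespace CoverLorentz

theorem norm_sq_γ (L : CoverLorentz) : ‖L.γ‖ ^ 2 = L.γ.re ^ 2 + L.γ.im ^ 2 := by
  rw [← Complex.normSq_eq_norm_sq, Complex.normSq_apply]; ring

theorem denom_pos (L : CoverLorentz) : 0 < 1 - (L.γ.re ^ 2 + L.γ.im ^ 2) := by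
  rw [← norm_sq_γ]; nlinarith [norm_nonneg L.γ, L.norm_lt]

theorem act_apply_zero (L : CoverLorentz) (x : V) : L.act x 0 =
    ((1 + (L.γ.re ^ 2 + L.γ.im ^ 2)) * x 0 + 2 * (L.γ.re * x 1 + L.γ.im * x 2)) /
      (1 - (L.γ.re ^ 2 + L.γ.im ^ 2)) := by
  rw [← norm_sq_γ]
  simp only [act, toMatrix, Matrix.mulVec, dotProduct, Fin.sum_univ_three]
  simp
  ring

/-- First rotated coordinate, before the rotation by `ω` (numerator). -/
def auxRe (L : CoverLorentz) (x : V) : ℝ :=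
  2 * L.γ.re * x 0 + (1 + L.γ.re ^ 2 - L.γ.im ^ 2) * x 1 + 2 * L.γ.re * L.γ.im * x 2

/-- Second rotated coordinate, before the rotation by `ω` (numerator). -/
def auxIm (L : CoverLorentz) (x : V) : ℝ :=
  2 * L.γ.im * x 0 + 2 * L.γ.re * L.γ.im * x 1 + (1 - L.γ.re ^ 2 + L.γ.im ^ 2) * x 2

theorem act_apply_one (L : CoverLorentz) (x : V) : L.act x 1 =
    (Real.cos L.ω * auxRe L x - Real.sin L.ω * auxIm L x) /
      (1 - (L.γ.re ^ 2 + L.γ.im ^ 2)) := by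
  rw [← norm_sq_γ]
  simp only [act, toMatrix, Matrix.mulVec, dotProduct, Fin.sum_univ_three, auxRe, auxIm]
  simp [Complex.exp_ofReal_mul_I_re, Complex.exp_ofReal_mul_I_im, pow_two]
  ring

theorem act_apply_two (L : CoverLorentz) (x : V) : L.act x 2 =
    (Real.sin L.ω * auxRe L x + Real.cos L.ω * auxIm L x) /
      (1 - (L.γ.re ^ 2 + L.γ.im ^ 2)) := by
  rw [← norm_sq_γ]
  simp only [act, toMatrix, Matrix.mulVec, dotProduct, Fin.sum_univ_three, auxRe, auxIm]
  simp [Complex.exp_ofReal_mul_I_re, Complex.exp_ofReal_mul_I_im, pow_two]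
  ring

theorem mdot_act (L : CoverLorentz) (x y : V) : mdot (L.act x) (L.act y) = mdot x y := by
  have hD := (denom_pos L).ne'
  have hcs := Real.sin_sq_add_cos_sq L.ω
  simp only [mdot, act_apply_zero, act_apply_one, act_apply_two]
  have : ((1 + (L.γ.re ^ 2 + L.γ.im ^ 2)) * x 0 + 2 * (L.γ.re * x 1 + L.γ.im * x 2)) *
        ((1 + (L.γ.re ^ 2 + L.γ.im ^ 2)) * y 0 + 2 * (L.γ.re * y 1 + L.γ.im * y 2)) -
      (auxRe L x * auxRe L y + auxIm L x * auxIm L y) =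
      (1 - (L.γ.re ^ 2 + L.γ.im ^ 2)) ^ 2 * (x 0 * y 0 - x 1 * y 1 - x 2 * y 2) := by
    simp only [auxRe, auxIm]; ring
  rw [div_mul_div_comm, div_mul_div_comm, div_mul_div_comm, ← sub_div, ← sub_div,
    div_eq_iff (mul_ne_zero hD hD)]
  linear_combination this - (auxRe L x * auxRe L y + auxIm L x * auxIm L y) * hcs

theorem toMatrix_restricted (L : CoverLorentz) : IsRestrictedLorentz L.toMatrix where
  isometry := mdot_act L
  proper := by
    have hD := (denom_pos L).ne'
    have hcs := Real.sin_sq_add_cos_sq L.ω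
    rw [toMatrix, Matrix.det_smul, Matrix.det_fin_three, norm_sq_γ]
    simp [Complex.exp_ofReal_mul_I_re, Complex.exp_ofReal_mul_I_im, pow_two]
    rw [← pow_two, ← pow_two]
    have hD' : ((1 - (L.γ.re ^ 2 + L.γ.im ^ 2)) ^ 3)  ≠ 0 := pow_ne_zero _ hD
    rw [inv_mul_eq_iff_eq_mul₀ hD']
    linear_combination (1 - (L.γ.re ^ 2 + L.γ.im ^ 2)) ^ 3 * hcs
  orthochronous := fun x hx h0 => by
    have hD := denom_pos L
    change 0 < L.act x 0
    rw [act_apply_zero]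
    apply div_pos _ hD
    set a := L.γ.re
    set b := L.γ.im
    have h1 : (2 * (a * x 1 + b * x 2)) ^ 2 < ((1 + (a ^ 2 + b ^ 2)) * x 0) ^ 2 := by
      simp only [mdot] at hx
      have e1 : 0 < (1 - (a ^ 2 + b ^ 2)) ^ 2 * x 0 ^ 2 := by positivity
      have e2 : 0 ≤ (a ^ 2 + b ^ 2) * (x 0 * x 0 - x 1 * x 1 - x 2 * x 2) := by positivity
      nlinarith [sq_nonneg (a * x 2 - b * x 1)]
    have h2 := (abs_lt_of_sq_lt_sq' h1 (by positivity)).1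
    linarith

theorem continuous_act {X : Type*} [TopologicalSpace X] {g : X → CoverLorentz} {x : X → V}
    (hγ : Continuous fun t => (g t).γ) (hω : Continuous fun t => (g t).ω) (hx : Continuous x) :
    Continuous fun t => (g t).act (x t) := by
  have hre : Continuous fun t => (g t).γ.re := Complex.continuous_re.comp hγ
  have him : Continuous fun t => (g t).γ.im := Complex.continuous_im.comp hγ
  have hc : Continuous fun t => Real.cos (g t).ω := Real.continuous_cos.comp hω
  have hs : Continuous fun t => Real.sin (g t).ω := Real.continuous_sin.comp hω
  have h0 : Continuous fun t => x t 0 := (continuous_apply 0).comp hx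
  have h1 : Continuous fun t => x t 1 := (continuous_apply 1).comp hx
  have h2 : Continuous fun t => x t 2 := (continuous_apply 2).comp hx
  refine continuous_pi fun i => ?_
  fin_cases i
  · simp only [Fin.zero_eta, act_apply_zero]
    exact Continuous.div (by fun_prop) (by fun_prop) fun t => (denom_pos _).ne'
  · simp only [Fin.mk_one, act_apply_one, auxRe, auxIm]
    exact Continuous.div (by fun_prop) (by fun_prop) fun t => (denom_pos _).ne'
  · simp only [Fin.reduceFinMk, act_apply_two, auxRe, auxIm]
    exact Continuous.div (by fun_prop) (by fun_prop) fun t => (denom_pos _).ne'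

theorem one_act (x : V) : (1 : CoverLorentz).act x = x := by
  have hγ : (1 : CoverLorentz).γ = 0 := rfl
  have hω : (1 : CoverLorentz).ω = 0 := rfl
  ext i
  fin_cases i
  · simp [act_apply_zero, hγ]
  · simp [act_apply_one, auxRe, auxIm, hγ, hω]
  · simp [act_apply_two, auxRe, auxIm, hγ, hω]

theorem act_inv_act (L : CoverLorentz) (x : V) : L⁻¹.act (L.act x) = x := by
  have hD := (denom_pos L).ne'
  have hcs := Real.sin_sq_add_cos_sq L.ω
  have hω : L⁻¹.ω = -L.ω := rfl
  have hre : L⁻¹.γ.re = -(L.γ.re * Real.cos L.ω - L.γ.im * Real.sin L.ω) := by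
    change (-L.γ * Complex.exp (L.ω * Complex.I)).re = _
    simp [Complex.exp_ofReal_mul_I_re, Complex.exp_ofReal_mul_I_im]
    try ring
  have him : L⁻¹.γ.im = -(L.γ.re * Real.sin L.ω + L.γ.im * Real.cos L.ω) := by
    change (-L.γ * Complex.exp (L.ω * Complex.I)).im = _
    simp [Complex.exp_ofReal_mul_I_re, Complex.exp_ofReal_mul_I_im]
    try ring
  have hn : L⁻¹.γ.re ^ 2 + L⁻¹.γ.im ^ 2 = L.γ.re ^ 2 + L.γ.im ^ 2 := by
    rw [hre, him]; linear_combination (L.γ.re ^ 2 + L.γ.im ^ 2) * hcs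
  have key : ∀ x y, mdot (L⁻¹.act y) x = mdot y (L.act x) := by
    intro x y
    simp only [mdot, act_apply_zero, act_apply_one, act_apply_two, auxRe, auxIm, hn]
    rw [hre, him, hω, Real.cos_neg, Real.sin_neg]
    field_simp
    set a := L.γ.re
    set b := L.γ.im
    set c := Real.cos L.ω
    set s := Real.sin L.ω
    have hc2 : c ^ 2 = 1 - s ^ 2 := by linarith
    ring_nf
    have hc3 : c ^ 3 = c - c * s ^ 2 := by rw [pow_succ, hc2]; ring
    simp only [hc2, hc3]
    ring
  have h : ∀ z, mdot (L⁻¹.act (L.act x)) z = mdot x z := fun z => by rw [key, mdot_act]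
  have h0 := h ![1, 0, 0]
  have h1 := h ![0, 1, 0]
  have h2 := h ![0, 0, 1]
  simp [mdot] at h0 h1 h2
  ext i
  fin_cases i
  · exact h0
  · exact h1
  · exact h2

/-- The Lorentz action as a linear automorphism of Minkowski space. -/
def actEquiv (L : CoverLorentz) : V ≃L[ℝ] V :=
  LinearEquiv.toContinuousLinearEquiv
    { L.toMatrix.mulVecLin with
      invFun := L⁻¹.act
      left_inv := act_inv_act L
      right_inv := fun x => by simpa using! act_inv_act L⁻¹ x }

@[simp] theorem actEquiv_apply (L : CoverLorentz) (x : V) : L.actEquiv x = L.act x := rfl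

/-- The canonical path from the identity to `L`. The covering group being simply connected, its
homotopy class does not depend on the choice. -/
def pathTo (L : CoverLorentz) (t : unitInterval) : CoverLorentz :=
  ⟨(t : ℝ) * L.γ, t * L.ω, by
    rw [norm_mul, Complex.norm_real, Real.norm_of_nonneg t.2.1]
    exact lt_of_le_of_lt (mul_le_of_le_one_left (norm_nonneg _) t.2.2) L.norm_lt⟩

end CoverLorentz

/-! ### Paths of wedges -/

/-- The reference direction. -/
def refDir : V := ![0, 0, -1]

/-- Paths in the manifold of spacelike directions `{e | e·e = -1}` starting at the reference
direction and ending inside `W`. -/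
def IsPathInto (W : Set V) (e : C(unitInterval, V)) : Prop :=
  (∀ t, mdot (e t) (e t) = -1) ∧ e 0 = refDir ∧ e 1 ∈ W

/-- A wedge together with a path of spacelike directions ending inside it. -/
structure WedgeWithPath where
  wedge : Set V
  isWedge : IsWedge wedge
  path : C(unitInterval, V)
  isPathInto : IsPathInto wedge path

/-- Same wedge, and homotopic paths; during the homotopy the starting point is fixed and the
endpoint may move inside the wedge. -/
instance WedgeWithPath.setoid : Setoid WedgeWithPath where
  r a b := a.wedge = b.wedge ∧
    ContinuousMap.HomotopicWith a.path b.path (IsPathInto a.wedge)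
  iseqv :=
    { refl := fun a => ⟨rfl, .refl _ a.isPathInto⟩
      symm := fun {a b} h => ⟨h.1.symm, by rw [← h.1]; exact h.2.symm⟩
      trans := fun {a b c} h h' => ⟨h.1.trans h'.1, h.2.trans (by rw [h.1]; exact h'.2)⟩ }

/-- A path of wedges `W̃ = (W, ẽ)`: a wedge and a homotopy class of paths of spacelike directions
ending inside it. -/
def PathOfWedges : Type := Quotient WedgeWithPath.setoid

/-- The underlying wedge `W` of `W̃`. -/
def PathOfWedges.wedge : PathOfWedges → Set V := Quotient.lift WedgeWithPath.wedge fun _ _ h => h.1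

theorem IsWedge.act {W : Set V} (h : IsWedge W) (L : CoverLorentz) : IsWedge (L.act '' W) := by
  obtain ⟨Λ, hΛ, rfl⟩ := h
  have hL := L.toMatrix_restricted
  refine ⟨L.toMatrix * Λ, ⟨fun x y => ?_, ?_, fun x hx h0 => ?_⟩, ?_⟩
  · rw [← Matrix.mulVec_mulVec, ← Matrix.mulVec_mulVec, hL.isometry, hΛ.isometry]
  · rw [Matrix.det_mul, hL.proper, hΛ.proper, one_mul]
  · rw [← Matrix.mulVec_mulVec]
    exact hL.orthochronous _ (by rwa [hΛ.isometry]) (hΛ.orthochronous _ hx h0)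
  · rw [Set.image_image]
    simp [CoverLorentz.act, Matrix.mulVec_mulVec]

/-- The path `t ↦ L(t) e(t)`, where `L(t)` runs from the identity to `L`; it is homotopic to the
path `t ↦ L(t) e₀` followed by `t ↦ L e(t)`. -/
def actPath (L : CoverLorentz) (e : C(unitInterval, V)) : C(unitInterval, V) where
  toFun t := (L.pathTo t).act (e t)
  continuous_toFun := CoverLorentz.continuous_act
    (by simp only [CoverLorentz.pathTo]; fun_prop) (by simp only [CoverLorentz.pathTo]; fun_prop)
    e.continuous

theorem IsPathInto.actPath {W : Set V} {e : C(unitInterval, V)} (h : IsPathInto W e)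
    (L : CoverLorentz) : IsPathInto (L.act '' W) (actPath L e) := by
  have h0 : L.pathTo 0 = 1 := by ext <;> simp [CoverLorentz.pathTo] <;> rfl
  have h1 : L.pathTo 1 = L := by ext <;> simp [CoverLorentz.pathTo]
  refine ⟨fun t => ?_, ?_, ?_⟩
  · change mdot ((L.pathTo t).act (e t)) ((L.pathTo t).act (e t)) = -1
    rw [CoverLorentz.mdot_act, h.1]
  · change (L.pathTo 0).act (e 0) = _
    rw [h0, h.2.1, CoverLorentz.one_act]
  · change (L.pathTo 1).act (e 1) ∈ _
    rw [h1]
    exact ⟨_, h.2.2, rfl⟩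

theorem homotopicWith_actPath {W : Set V} {e e' : C(unitInterval, V)} (L : CoverLorentz)
    (h : ContinuousMap.HomotopicWith e e' (IsPathInto W)) :
    ContinuousMap.HomotopicWith (actPath L e) (actPath L e') (IsPathInto (L.act '' W)) := by
  obtain ⟨H⟩ := h
  refine ⟨{ toFun := fun x => (L.pathTo x.2).act (H x), continuous_toFun := ?_,
            map_zero_left := ?_, map_one_left := ?_, prop' := ?_ }⟩
  · exact CoverLorentz.continuous_act
      (by simp only [CoverLorentz.pathTo]; fun_prop) (by simp only [CoverLorentz.pathTo]; fun_prop)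
      (by fun_prop)
  · intro x; simp [actPath]
  · intro x; simp [actPath]
  · intro t; exact (H.prop' t).actPath L

/-- The action of the covering group on paths of wedges, `L̃ · (W, ẽ) = (Λ W, L̃ · ẽ)`. -/
instance : SMul CoverLorentz PathOfWedges where
  smul L := Quotient.map
    (fun a => ⟨L.act '' a.wedge, a.isWedge.act L, actPath L a.path, a.isPathInto.actPath L⟩)
    (fun a b h => ⟨by change _ '' _ = _ '' _; rw [h.1], homotopicWith_actPath L h.2⟩)

/-- The standard path of wedges `W̃₀`: the standard wedge with a path from the reference direction
which stays inside the standard wedge. -/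
def standardPath : PathOfWedges := Quotient.mk _
  { wedge := standardWedge
    isWedge := ⟨1, ⟨fun x y => by simp, by simp, fun x _ h => by simpa using h⟩, by simp⟩
    path := ⟨fun t => ![0, Real.sin (Real.pi / 2 * t), -Real.cos (Real.pi / 2 * t)], by
      refine continuous_pi fun i => ?_
      fin_cases i
      · exact continuous_const
      · change Continuous fun t : unitInterval => Real.sin (Real.pi / 2 * t); fun_prop
      · change Continuous fun t : unitInterval => -Real.cos (Real.pi / 2 * t); fun_prop⟩
    isPathInto := by
      refine ⟨fun t => ?_, ?_, ?_⟩
      · simp [mdot]; nlinarith [Real.sin_sq_add_cos_sq (Real.pi / 2 * t)]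
      · simp [refDir]
      · simp [standardWedge] }

/-- `k` is the statistics number `k(W̃, W̃')` of two paths of wedges with opposite wedges: the odd
integer with `W̃' = L̃ r̃(k π) W̃₀`, where `W̃ = L̃ W̃₀`. -/
def IsStatisticsNumber (W W' : PathOfWedges) (k : ℤ) : Prop :=
  Odd k ∧ ∃ L : CoverLorentz, L • standardPath = W ∧
    (L * CoverLorentz.rot (k * Real.pi)) • standardPath = W'

/-- A Lorentz transformation `L̃_W̃` connecting `W̃` to the standard path of wedges,
`L̃_W̃ · W̃₀ = W̃`. -/
def transporter (W : PathOfWedges) : CoverLorentz :=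
  @Classical.epsilon _ ⟨1⟩ fun L : CoverLorentz => L • standardPath = W

/-! ### The one-particle space -/

/-- The point of the upper mass shell with spatial momentum `q`. -/
def onShell (m : ℝ) (q : ℝ × ℝ) : V := ![√(m ^ 2 + q.1 ^ 2 + q.2 ^ 2), q.1, q.2]

/-- The Lorentz invariant measure `δ(p² - m²) θ(p₀) d³p` on the mass shell, i.e. the image of
`d²q / (2 ω_q)`, as a measure on `ℝ³`. -/
def shellMeasure (m : ℝ) : Measure V :=
  ((volume : Measure (ℝ × ℝ)).withDensity fun q =>
    ENNReal.ofReal (1 / (2 * √(m ^ 2 + q.1 ^ 2 + q.2 ^ 2)))).map (onShell m)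

theorem continuous_onShell (m : ℝ) : Continuous (onShell m) := by
  refine continuous_pi fun i => ?_
  fin_cases i
  · change Continuous fun q : ℝ × ℝ => √(m ^ 2 + q.1 ^ 2 + q.2 ^ 2); fun_prop
  · exact continuous_fst
  · exact continuous_snd

instance (m : ℝ) : SigmaFinite (shellMeasure m) := by
  have hinj : Function.Injective (onShell m) := fun p q h =>
    Prod.ext (by simpa [onShell] using congrFun h 1) (by simpa [onShell] using congrFun h 2)
  have : SigmaFinite ((volume : Measure (ℝ × ℝ)).withDensity fun q =>
      ENNReal.ofReal (1 / (2 * √(m ^ 2 + q.1 ^ 2 + q.2 ^ 2)))) :=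
    SigmaFinite.withDensity  fun q : ℝ × ℝ =>
      Real.toNNReal (1 / (2 * √(m ^ 2 + q.1 ^ 2 + q.2 ^ 2)))
  exact ((continuous_onShell m).measurableEmbedding hinj).sigmaFinite_map

/-- The one-particle space `L²(ℝ³, dμ)`. -/
abbrev OneParticle (m : ℝ) : Type := Lp ℂ 2 (shellMeasure m)

set_option linter.unusedSectionVars false

/-! ### Integrating out one momentum -/

section contract

variable {Y : Type*} [MeasurableSpace Y]

/-- `∫ dμ(p) conj(φ(p)) K(p; y) Ψ(y, p)`. -/
def contractFun (μ : Measure V) (φ : V → ℂ) (K : V → Y → ℂ) (Ψ : Y × V → ℂ) (y : Y) : ℂ :=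
  ∫ p, conj (φ p) * K p y * Ψ (y, p) ∂μ

variable {μ : Measure V} [SigmaFinite μ] {ν : Measure Y} [SigmaFinite ν] {φ : V → ℂ}
  {K : V → Y → ℂ} {Ψ Ψ' : Y × V → ℂ}

theorem aesm_integrand (hφ : AEStronglyMeasurable φ μ) (hK : Measurable (Function.uncurry K))
    (hΨ : AEStronglyMeasurable Ψ (ν.prod μ)) :
    AEStronglyMeasurable (fun z : Y × V => conj (φ z.2) * K z.2 z.1 * Ψ z) (ν.prod μ) := by
  have h1 : AEStronglyMeasurable (fun z : Y × V => conj (φ z.2)) (ν.prod μ) :=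
    Complex.continuous_conj.comp_aestronglyMeasurable hφ.comp_snd
  have h2 : Measurable (fun z : Y × V => K z.2 z.1) := hK.comp measurable_swap
  exact (h1.mul h2.aestronglyMeasurable).mul hΨ

theorem eLpNorm_contractFun_le (hφ : AEStronglyMeasurable φ μ) (hb : ∀ p y, ‖K p y‖ ≤ 1)
    (hΨ : AEStronglyMeasurable Ψ (ν.prod μ)) :
    eLpNorm (contractFun μ φ K Ψ) 2 ν ≤ eLpNorm φ 2 μ * eLpNorm Ψ 2 (ν.prod μ) := by
  have h2 : (2 : ENNReal).toReal = 2 := by simp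
  simp only [eLpNorm_eq_lintegral_rpow_enorm_toReal (p := 2) (by simp) (by simp), h2]
  set A : ENNReal := ∫⁻ p, ‖φ p‖ₑ ^ (2 : ℝ) ∂μ
  have key : ∀ᵐ y ∂ν, ‖contractFun μ φ K Ψ y‖ₑ ^ (2 : ℝ) ≤
      A * ∫⁻ p, ‖Ψ (y, p)‖ₑ ^ (2 : ℝ) ∂μ := by
    filter_upwards [hΨ.prodMk_left] with y hy
    have h1 : ‖contractFun μ φ K Ψ y‖ₑ ≤ ∫⁻ p, ‖φ p‖ₑ * ‖Ψ (y, p)‖ₑ ∂μ := by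
      refine (enorm_integral_le_lintegral_enorm _).trans (lintegral_mono fun p => ?_)
      rw [enorm_mul, enorm_mul]
      refine mul_le_mul_left (?_ : _ ≤ ‖φ p‖ₑ) _
      have hK1 : ‖K p y‖ₑ ≤ 1 := by
        rw [← ofReal_norm]; exact ENNReal.ofReal_le_one.2 (hb p y)
      have hc : ‖conj (φ p)‖ₑ = ‖φ p‖ₑ := by
        rw [← ofReal_norm, RCLike.norm_conj, ofReal_norm]
      rw [hc]
      exact mul_le_of_le_one_right' hK1
    have h3 := ENNReal.lintegral_mul_le_Lp_mul_Lq μ Real.HolderConjugate.two_two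
      hφ.enorm hy.enorm
    calc ‖contractFun μ φ K Ψ y‖ₑ ^ (2 : ℝ)
        ≤ ((A ^ (1 / 2 : ℝ)) * (∫⁻ p, ‖Ψ (y, p)‖ₑ ^ (2 : ℝ) ∂μ) ^ (1 / 2 : ℝ)) ^ (2 : ℝ) :=
          ENNReal.rpow_le_rpow (h1.trans h3) (by norm_num)
      _ = _ := by
          rw [ENNReal.mul_rpow_of_nonneg _ _ (by norm_num), ← ENNReal.rpow_mul,
            ← ENNReal.rpow_mul]
          norm_num
  rw [← ENNReal.mul_rpow_of_nonneg _ _ (by norm_num)]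
  refine ENNReal.rpow_le_rpow ?_ (by norm_num)
  refine (lintegral_mono_ae key).trans ?_
  have hm : AEMeasurable (fun z : Y × V => ‖Ψ z‖ₑ ^ (2 : ℝ)) (ν.prod μ) := hΨ.enorm.pow_const _
  rw [lintegral_const_mul'' _ hm.lintegral_prod_right', lintegral_prod _ hm]

theorem memLp_contractFun (hφ : MemLp φ 2 μ) (hK : Measurable (Function.uncurry K))
    (hb : ∀ p y, ‖K p y‖ ≤ 1) (hΨ : MemLp Ψ 2 (ν.prod μ)) :
    MemLp (contractFun μ φ K Ψ) 2 ν :=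
  ⟨(aesm_integrand hφ.1 hK hΨ.1).integral_prod_right',
    (eLpNorm_contractFun_le hφ.1 hb hΨ.1).trans_lt (ENNReal.mul_lt_top hφ.2 hΨ.2)⟩

theorem contractFun_congr (h : Ψ =ᵐ[ν.prod μ] Ψ') :
    contractFun μ φ K Ψ =ᵐ[ν] contractFun μ φ K Ψ' := by
  filter_upwards [Measure.ae_ae_of_ae_prod h] with y hy
  refine integral_congr_ae ?_
  filter_upwards [hy] with p hp
  rw [hp]

theorem contractFun_integrable (hφ : MemLp φ 2 μ) (hK : Measurable (Function.uncurry K))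
    (hb : ∀ p y, ‖K p y‖ ≤ 1) (hΨ : MemLp Ψ 2 (ν.prod μ)) :
    ∀ᵐ y ∂ν, Integrable (fun p => conj (φ p) * K p y * Ψ (y, p)) μ := by
  have hfin : ∫⁻ z, ‖Ψ z‖ₑ ^ (2 : ℝ) ∂(ν.prod μ) < ⊤ := by
    simpa using lintegral_rpow_enorm_lt_top_of_eLpNorm_lt_top (by simp) (by simp) hΨ.2
  have hm : AEMeasurable (fun z : Y × V => ‖Ψ z‖ₑ ^ (2 : ℝ)) (ν.prod μ) := hΨ.1.enorm.pow_const _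
  rw [lintegral_prod _ hm] at hfin
  filter_upwards [ae_lt_top' hm.lintegral_prod_right' hfin.ne, hΨ.1.prodMk_left] with y hy hy'
  have hL : MemLp (fun p => Ψ (y, p)) 2 μ := by
    refine ⟨hy', ?_⟩
    rw [eLpNorm_eq_lintegral_rpow_enorm_toReal (p := 2) (by simp) (by simp)]
    exact ENNReal.rpow_lt_top_of_nonneg (by simp) (by simpa using hy.ne)
  have hφK : MemLp (fun p => conj (φ p) * K p y) 2 μ := by
    refine hφ.of_le ?_ (Filter.Eventually.of_forall fun p => ?_)
    · exact (Complex.continuous_conj.comp_aestronglyMeasurable hφ.1).mul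
        (hK.comp (measurable_id.prodMk measurable_const)).aestronglyMeasurable
    · rw [norm_mul, RCLike.norm_conj]
      exact mul_le_of_le_one_right (norm_nonneg _) (hb p y)
  exact hφK.integrable_mul hL

/-- The bounded operator `Ψ ↦ ∫ dμ(p) conj(φ(p)) K(p; ·) Ψ(·, p)` between `L²` spaces. -/
def contract (φ : Lp ℂ 2 μ) (K : V → Y → ℂ) (hK : Measurable (Function.uncurry K))
    (hb : ∀ p y, ‖K p y‖ ≤ 1) : Lp ℂ 2 (ν.prod μ) →L[ℂ] Lp ℂ 2 ν :=
  LinearMap.mkContinuous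
    { toFun := fun Ψ => (memLp_contractFun (Lp.memLp φ) hK hb (Lp.memLp Ψ)).toLp _
      map_add' := fun Ψ Ψ' => by
        rw [← MemLp.toLp_add]
        refine (MemLp.toLp_eq_toLp_iff _ _).2 ?_
        refine (contractFun_congr (Lp.coeFn_add Ψ Ψ')).trans ?_
        filter_upwards [contractFun_integrable (Lp.memLp φ) hK hb (Lp.memLp Ψ),
          contractFun_integrable (Lp.memLp φ) hK hb (Lp.memLp Ψ')] with y h1 h2
        simp only [contractFun, Pi.add_apply, mul_add]
        exact integral_add h1 h2
      map_smul' := fun c Ψ => by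
        rw [RingHom.id_apply, ← MemLp.toLp_const_smul]
        refine (MemLp.toLp_eq_toLp_iff _ _).2 ?_
        refine (contractFun_congr (Lp.coeFn_smul c Ψ)).trans (Filter.Eventually.of_forall ?_)
        intro y
        simp only [contractFun, Pi.smul_apply, smul_eq_mul]
        rw [← integral_const_mul]
        congr 1; ext p; ring }
    ‖φ‖ fun Ψ => by
      simp only [LinearMap.coe_mk, AddHom.coe_mk]
      rw [Lp.norm_toLp, Lp.norm_def, Lp.norm_def, ← ENNReal.toReal_mul]
      exact ENNReal.toReal_mono (ENNReal.mul_ne_top (Lp.eLpNorm_ne_top φ) (Lp.eLpNorm_ne_top Ψ))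
        (eLpNorm_contractFun_le (Lp.aestronglyMeasurable φ) hb (Lp.aestronglyMeasurable Ψ))

theorem coeFn_contract (φ : Lp ℂ 2 μ) (K : V → Y → ℂ) (hK : Measurable (Function.uncurry K))
    (hb : ∀ p y, ‖K p y‖ ≤ 1) (Ψ : Lp ℂ 2 (ν.prod μ)) :
    contract φ K hK hb Ψ =ᵐ[ν] contractFun μ φ K Ψ :=
  MemLp.coeFn_toLp (memLp_contractFun (Lp.memLp φ) hK hb (Lp.memLp Ψ))

end contract

/-! ### The doubled Fock space -/

/-- Momenta of `n` particles and `k` antiparticles. -/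
abbrev Conf (n k : ℕ) : Type := (Fin n → V) × (Fin k → V)

/-- The `(n + k)`-fold product of the measure on the mass shell. -/
def confMeasure (m : ℝ) (n k : ℕ) : Measure (Conf n k) :=
  (Measure.pi fun _ => shellMeasure m).prod (Measure.pi fun _ => shellMeasure m)

instance (m : ℝ) (n k : ℕ) : SigmaFinite (confMeasure m n k) := by
  unfold confMeasure; infer_instance

/-- Permuting the momenta of the particles among each other, and those of the antiparticles. -/
def permute {n k : ℕ} (σ : Equiv.Perm (Fin n)) (τ : Equiv.Perm (Fin k)) (x : Conf n k) :
    Conf n k := (x.1 ∘ σ, x.2 ∘ τ)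

theorem measurePreserving_comp_perm (m : ℝ) {n : ℕ} (σ : Equiv.Perm (Fin n)) :
    MeasurePreserving (fun x : Fin n → V => x ∘ σ) (Measure.pi fun _ => shellMeasure m)
      (Measure.pi fun _ => shellMeasure m) := by
  have h := measurePreserving_piCongrLeft (α := fun _ : Fin n => V) (fun _ => shellMeasure m) σ.symm
  convert h using 1
  ext x i
  simp [MeasurableEquiv.piCongrLeft, Equiv.piCongrLeft, Equiv.piCongrLeft']

theorem measurePreserving_permute (m : ℝ) {n k : ℕ} (σ : Equiv.Perm (Fin n))
    (τ : Equiv.Perm (Fin k)) :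
    MeasurePreserving (permute σ τ) (confMeasure m n k) (confMeasure m n k) :=
  (measurePreserving_comp_perm m σ).prod (measurePreserving_comp_perm m τ)

/-- The subspace of vectors with `n` particles and `k` antiparticles: square integrable functions
of `n + k` momenta, symmetric in the first `n` and in the last `k` of them. -/
def Sector (m : ℝ) (n k : ℕ) : Submodule ℂ (Lp ℂ 2 (confMeasure m n k)) where
  carrier := {Ψ | ∀ σ τ, Lp.compMeasurePreserving (permute σ τ)
    (measurePreserving_permute m σ τ) Ψ = Ψ}
  zero_mem' := fun σ τ => map_zero _
  add_mem' := fun h h' σ τ => by rw [map_add, h, h']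
  smul_mem' := fun c Ψ h σ τ => by
    have := (Lp.compMeasurePreservingₗ ℂ (permute σ τ)
      (measurePreserving_permute m σ τ)).map_smul c Ψ
    exact this.trans (congrArg (c • ·) (h σ τ))

theorem isClosed_sector (m : ℝ) (n k : ℕ) :
    IsClosed (Sector m n k : Set (Lp ℂ 2 (confMeasure m n k))) := by
  have : (Sector m n k : Set (Lp ℂ 2 (confMeasure m n k))) = ⋂ σ, ⋂ τ,
      {Ψ | Lp.compMeasurePreserving (permute σ τ) (measurePreserving_permute m σ τ) Ψ = Ψ} := by
    ext Ψ; simp only [Set.mem_iInter]; rfl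
  rw [this]
  exact isClosed_iInter fun σ => isClosed_iInter fun τ =>
    isClosed_eq (Lp.isometry_compMeasurePreserving _).continuous continuous_id

instance (m : ℝ) (n k : ℕ) : CompleteSpace (Sector m n k) :=
  (isClosed_sector m n k).completeSpace_coe

/-- The doubled Fock space: square summable families of vectors `Ψ_n^k` with `n` particles and `k`
antiparticles. -/
abbrev Fock (m : ℝ) : Type := lp (fun i : ℕ × ℕ => Sector m i.1 i.2) 2

/-- The vectors of finite particle number. -/
def FiniteParticle (m : ℝ) : Submodule ℂ (Fock m) where
  carrier := {Ψ | {i | Ψ i ≠ 0}.Finite}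
  zero_mem' := by simp
  add_mem' := fun {Ψ Ψ'} h h' => (h.union h').subset fun i hi => by
    by_contra hc
    simp only [Set.mem_union, Set.mem_ofPred_eq, not_or, not_not] at hc
    exact hi (by simp [hc.1, hc.2])
  smul_mem' := fun c Ψ h => h.subset fun i hi => by
    intro hc
    exact hi (by simp [hc])

/-! ### The data of the model -/

/-- Deformation functions: `R(-a) = conj (R(a)) = R(a)⁻¹` on the real line, with a bounded analytic
continuation to the upper half plane which is continuous on the closure. -/
structure IsDeformationFunction (R : ℂ → ℂ) : Prop where
  neg (a : ℝ) : R ((-a : ℝ) : ℂ) = conj (R a)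
  unimodular (a : ℝ) : conj (R a) * R a = 1
  analytic : DifferentiableOn ℂ R {z | 0 < z.im}
  continuousOn : ContinuousOn R {z | 0 ≤ z.im}
  bounded : ∃ C, ∀ z : ℂ, 0 ≤ z.im → ‖R z‖ ≤ C

/-- The parameters of the model: mass `m`, deformation strength `κ`, spin `λ`, deformation
function `R`. -/
structure Model where
  mass : ℝ
  mass_pos : 0 < mass
  kappa : ℝ
  kappa_pos : 0 < kappa
  spin : ℝ
  R : ℂ → ℂ
  isDeformationFunction : IsDeformationFunction R

/-! ### Wigner rotations, intertwiners and deformation kernels -/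

/-- `γ(p)`: the boost `(γ(p), 0)` maps `(m, 0, 0)` to `p`. -/
def boostParam (m : ℝ) (p : V) : ℂ := (p 1 + p 2 * Complex.I) / (p 0 + m)

/-- The Wigner rotation angle `Ω(L̃, p)`, for `p` on the mass shell. -/
def wigner (m : ℝ) (L : CoverLorentz) (p : V) : ℝ :=
  L.ω + phase (1 - boostParam m p * conj L.γ * Complex.exp (-(L.ω * Complex.I))) +
    phase (1 + (L.γ - boostParam m p * Complex.exp (-(L.ω * Complex.I))) /
      (1 - boostParam m p * conj L.γ * Complex.exp (-(L.ω * Complex.I))) *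
        conj (boostParam m (L⁻¹.act p)))

namespace Model

variable (P : Model)

/-- The intertwiner of the standard wedge,
`u₀(p) = ((m - i p₂) / √(m² + p₂²))^λ ((p₀ + m - p₁ + i p₂) / (p₀ + m - p₁ - i p₂))^λ`. -/
def u₀ (p : V) : ℂ :=
  ((P.mass - p 2 * Complex.I) / √(P.mass ^ 2 + p 2 ^ 2)) ^ (P.spin : ℂ) *
    ((p 0 + P.mass - p 1 + p 2 * Complex.I) / (p 0 + P.mass - p 1 - p 2 * Complex.I)) ^
      (P.spin : ℂ)

/-- The function `p ↦ e^{-i λ Ω(L̃, p)} u₀(Λ⁻¹ p)`. -/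
def boostedIntertwiner (L : CoverLorentz) (p : V) : ℂ :=
  Complex.exp (-(Complex.I * (P.spin * wigner P.mass L p : ℝ))) * P.u₀ (L⁻¹.act p)

/-- The deformation matrix of the standard wedge. -/
def Q₀ : Matrix (Fin 3) (Fin 3) ℝ := P.kappa • !![0, 1, 0; 1, 0, 0; 0, 0, 0]

/-- The matrix `Λ Q₀ Λ⁻¹`. -/
def boostedMatrix (L : CoverLorentz) : Matrix (Fin 3) (Fin 3) ℝ :=
  L.toMatrix * P.Q₀ * L⁻¹.toMatrix

/-- The intertwiner `u_W̃`. -/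
def u (W : PathOfWedges) : V → ℂ := P.boostedIntertwiner (transporter W)

/-- The deformation matrix `Q(W)`. -/
def Q (W : PathOfWedges) : Matrix (Fin 3) (Fin 3) ℝ := P.boostedMatrix (transporter W)

/-- The deformation kernel
`A_W̃^{n,k}(p; x) = u(p)^{q+1} ∏ᵢ u(xᵢ) R(Qp·xᵢ) ∏ⱼ conj(u(xⱼ)) R(Qp·xⱼ)`, with `q = n - k`, the
products running over the particles and over the antiparticles, respectively. -/
def kernel (W : PathOfWedges) (n k : ℕ) (p : V) (x : Conf n k) : ℂ :=
  P.u W p ^ ((n : ℤ) - k + 1) *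
    (∏ i, P.u W (x.1 i) * P.R (mdot ((P.Q W).mulVec p) (x.1 i) : ℝ)) *
    ∏ j, conj (P.u W (x.2 j)) * P.R (mdot ((P.Q W).mulVec p) (x.2 j) : ℝ)

theorem continuous_R : Continuous fun a : ℝ => P.R a :=
  P.isDeformationFunction.continuousOn.comp_continuous Complex.continuous_ofReal
    fun a => by simp

theorem norm_R (a : ℝ) : ‖P.R a‖ = 1 := by
  have h := congrArg norm (P.isDeformationFunction.unimodular a)
  rw [norm_mul, RCLike.norm_conj, norm_one] at h
  nlinarith [norm_nonneg (P.R a)]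

theorem continuous_mulVec (M : Matrix (Fin 3) (Fin 3) ℝ) : Continuous fun p : V => M.mulVec p :=
  M.mulVecLin.continuous_of_finiteDimensional

theorem measurable_u₀ : Measurable P.u₀ := by
  unfold u₀
  have h (i : Fin 3) : Measurable fun p : V => ((p i : ℝ) : ℂ) :=
    Complex.measurable_ofReal.comp (measurable_pi_apply i)
  have h2 : Measurable fun p : V => ((√(P.mass ^ 2 + p 2 ^ 2) : ℝ) : ℂ) :=
    Complex.measurable_ofReal.comp (by fun_prop)
  exact (((measurable_const.sub ((h 2).mul_const _)).div h2).pow_const _).mul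
    ((((((h 0).add_const _).sub (h 1)).add ((h 2).mul_const _)).div
      ((((h 0).add_const _).sub (h 1)).sub ((h 2).mul_const _))).pow_const _)

theorem measurable_boostParam (m : ℝ) : Measurable (boostParam m) := by
  unfold boostParam
  have h (i : Fin 3) : Measurable fun p : V => ((p i : ℝ) : ℂ) :=
    Complex.measurable_ofReal.comp (measurable_pi_apply i)
  exact ((h 1).add ((h 2).mul_const _)).div ((h 0).add_const _)

theorem measurable_wigner (m : ℝ) (L : CoverLorentz) : Measurable (wigner m L) := by
  unfold wigner phase
  have h := measurable_boostParam m
  have h' : Measurable fun p => conj (boostParam m (L⁻¹.act p)) :=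
    Complex.continuous_conj.measurable.comp (h.comp (continuous_mulVec _).measurable)
  fun_prop

theorem measurable_u (W : PathOfWedges) : Measurable (P.u W) := by
  unfold u boostedIntertwiner
  have h1 : Measurable fun p => ((P.spin * wigner P.mass (transporter W) p : ℝ) : ℂ) :=
    Complex.measurable_ofReal.comp ((measurable_wigner _ _).const_mul _)
  have h2 : Measurable fun p => P.u₀ ((transporter W)⁻¹.act p) :=
    P.measurable_u₀.comp (continuous_mulVec _).measurable
  exact (Complex.measurable_exp.comp (h1.const_mul _).neg).mul h2

theorem norm_div_conj_cpow (w : ℂ) (t : ℝ) :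
    ‖(w / conj w) ^ (t : ℂ)‖ = 0 ∨ ‖(w / conj w) ^ (t : ℂ)‖ = 1 := by
  rw [Complex.norm_cpow_real, norm_div, RCLike.norm_conj]
  by_cases h : ‖w‖ = 0
  · rw [h, div_zero]
    by_cases ht : t = 0
    · right; rw [ht, Real.rpow_zero]
    · left; rw [Real.zero_rpow ht]
  · right; rw [div_self h, Real.one_rpow]

theorem norm_u (W : PathOfWedges) (p : V) : ‖P.u W p‖ = 0 ∨ ‖P.u W p‖ = 1 := by
  unfold u boostedIntertwiner u₀
  set x := (transporter W)⁻¹.act p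
  have h1 : ‖Complex.exp (-(Complex.I * (P.spin * wigner P.mass (transporter W) p : ℝ)))‖ = 1 := by
    rw [Complex.norm_exp]; simp
  have h2 : ‖((P.mass - x 2 * Complex.I) / √(P.mass ^ 2 + x 2 ^ 2) : ℂ) ^ (P.spin : ℂ)‖ = 1 := by
    have h3 : ‖(P.mass - x 2 * Complex.I : ℂ)‖ = √(P.mass ^ 2 + x 2 ^ 2) := by
      rw [Complex.norm_def, Complex.normSq_apply]; simp [pow_two]
    have h4 : 0 < √(P.mass ^ 2 + x 2 ^ 2) := Real.sqrt_pos.2 (by have := P.mass_pos; positivity)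
    rw [Complex.norm_cpow_real, norm_div, h3, Complex.norm_real, Real.norm_of_nonneg h4.le,
      div_self h4.ne', Real.one_rpow]
  have h5 : (x 0 + P.mass - x 1 - x 2 * Complex.I : ℂ) =
      conj (x 0 + P.mass - x 1 + x 2 * Complex.I : ℂ) := by simp [sub_eq_add_neg]
  rw [norm_mul, norm_mul, h1, h2, h5, one_mul, one_mul]
  exact norm_div_conj_cpow _ _

theorem measurable_R_mdot (M : Matrix (Fin 3) (Fin 3) ℝ) :
    Measurable fun z : V × V => P.R (mdot (M.mulVec z.1) z.2 : ℝ) := by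
  have h := (continuous_mulVec M).comp (continuous_fst (X := V) (Y := V))
  have h' (i : Fin 3) : Continuous fun z : V × V => M.mulVec z.1 i :=
    (continuous_apply i).comp h
  have h'' (i : Fin 3) : Continuous fun z : V × V => z.2 i :=
    (continuous_apply i).comp continuous_snd
  have h3 : Continuous fun z : V × V => mdot (M.mulVec z.1) z.2 := by
    unfold mdot
    exact (((h' 0).mul (h'' 0)).sub ((h' 1).mul (h'' 1))).sub ((h' 2).mul (h'' 2))
  exact (P.continuous_R.comp h3).measurable

theorem measurable_prod_kernel {n k : ℕ} {u : V → ℂ} {G : V × V → ℂ} (hu : Measurable u)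
    (hG : Measurable G) (q : ℤ) :
    Measurable fun z : V × Conf n k => u z.1 ^ q * (∏ i, u (z.2.1 i) * G (z.1, z.2.1 i)) *
      ∏ j, conj (u (z.2.2 j)) * G (z.1, z.2.2 j) := by
  have h1 (i : Fin n) : Measurable fun z : V × Conf n k => z.2.1 i :=
    (measurable_pi_apply i).comp (measurable_fst.comp measurable_snd)
  have h2 (i : Fin k) : Measurable fun z : V × Conf n k => z.2.2 i :=
    (measurable_pi_apply i).comp (measurable_snd.comp measurable_snd)
  have hz : Measurable fun z : ℂ => z ^ q := measurable_id.pow_const _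
  refine ((hz.comp (hu.comp measurable_fst)).mul ?_).mul ?_
  · exact Finset.measurable_fun_prod _ fun i _ =>
      (hu.comp (h1 i)).mul (hG.comp (measurable_fst.prodMk (h1 i)))
  · exact Finset.measurable_fun_prod _ fun i _ =>
      (Complex.continuous_conj.measurable.comp (hu.comp (h2 i))).mul
        (hG.comp (measurable_fst.prodMk (h2 i)))

theorem measurable_kernel (W : PathOfWedges) (n k : ℕ) :
    Measurable (Function.uncurry (P.kernel W n k)) :=
  measurable_prod_kernel (P.measurable_u W) (P.measurable_R_mdot (P.Q W)) _

theorem norm_kernel_le (W : PathOfWedges) (n k : ℕ) (p : V) (x : Conf n k) :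
    ‖P.kernel W n k p x‖ ≤ 1 := by
  have hu (p : V) : ‖P.u W p‖ ≤ 1 := by rcases P.norm_u W p with h | h <;> simp [h]
  unfold kernel
  rw [norm_mul, norm_mul, norm_prod, norm_prod, norm_zpow]
  refine mul_le_one₀ (mul_le_one₀ ?_ (by positivity) ?_) (by positivity) ?_
  · rcases P.norm_u W p with h | h
    · rw [h]
      by_cases h0 : (n : ℤ) - k + 1 = 0
      · simp [h0]
      · simp [zero_zpow _ h0]
    · simp [h]
  · refine Finset.prod_le_one (fun i _ => norm_nonneg _) fun i _ => ?_
    rw [norm_mul, P.norm_R, mul_one]; exact hu _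
  · refine Finset.prod_le_one (fun i _ => norm_nonneg _) fun i _ => ?_
    rw [norm_mul, P.norm_R, mul_one, RCLike.norm_conj]; exact hu _

theorem kernel_permute (W : PathOfWedges) {n k : ℕ} (p : V) (x : Conf n k)
    (σ : Equiv.Perm (Fin n)) (τ : Equiv.Perm (Fin k)) :
    P.kernel W n k p (permute σ τ x) = P.kernel W n k p x := by
  simp only [kernel, permute, Function.comp_apply]
  rw [Equiv.prod_comp σ fun i => P.u W (x.1 i) * P.R (mdot ((P.Q W).mulVec p) (x.1 i) : ℝ),
    Equiv.prod_comp τ fun j => conj (P.u W (x.2 j)) * P.R (mdot ((P.Q W).mulVec p) (x.2 j) : ℝ)]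

end Model

/-! ### Test functions -/

/-- Test functions on Minkowski space: complex-valued Schwartz functions. -/
abbrev SchwartzTest : Type := SchwartzMap V ℂ

/-- The complex conjugate test function. -/
def conjTest (f : SchwartzTest) : SchwartzTest :=
  SchwartzMap.postcompCLM (𝕜 := ℝ) (Complex.conjCLE : ℂ →L[ℝ] ℂ) f

/-- The transformed test function `x ↦ f(Λ⁻¹(x - a))`. -/
def poincareTest (a : V) (L : CoverLorentz) (f : SchwartzTest) : SchwartzTest :=
  SchwartzMap.compSubConstCLM ℂ a
    (SchwartzMap.compCLMOfContinuousLinearEquiv ℂ (CoverLorentz.actEquiv L⁻¹) f)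

theorem conjTest_apply (f : SchwartzTest) (x : V) : conjTest f x = conj (f x) := rfl

theorem poincareTest_apply (a : V) (L : CoverLorentz) (f : SchwartzTest) (x : V) :
    poincareTest a L f x = f (L⁻¹.act (x - a)) := rfl

/-- `f⁺(p) = ∫ d³x f(x) e^{i p·x}`. -/
def fPlus (f : SchwartzTest) (p : V) : ℂ :=
  ∫ x : V, f x * Complex.exp (Complex.I * (mdot p x : ℝ))

theorem fPlus_eq_fourier (f : SchwartzTest) (p : V) :
    fPlus f p = FourierTransform.fourier (SchwartzMap.compCLMOfContinuousLinearEquiv ℂ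
      (EuclideanSpace.equiv (Fin 3) ℝ) f)
      ((-(2 * Real.pi)⁻¹ : ℝ) • (WithLp.toLp 2 ![p 0, -p 1, -p 2] : EuclideanSpace ℝ (Fin 3))) := by
  rw [SchwartzMap.fourier_coe, Real.fourier_eq', fPlus,
    ← (PiLp.volume_preserving_ofLp (Fin 3)).integral_comp
      (MeasurableEquiv.toLp 2 (Fin 3 → ℝ)).symm.measurableEmbedding]
  refine integral_congr_ae (Filter.Eventually.of_forall fun x => ?_)
  have hx : (inner ℝ x ((-(2 * Real.pi)⁻¹ : ℝ) •
      (WithLp.toLp 2 ![p 0, -p 1, -p 2] : EuclideanSpace ℝ (Fin 3)))) =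
      -(2 * Real.pi)⁻¹ * mdot p x.ofLp := by
    rw [inner_smul_right, PiLp.inner_apply]
    simp [Fin.sum_univ_three, mdot]
    ring
  simp only [hx, smul_eq_mul]
  rw [mul_comm]
  congr 2
  rw [mul_comm]
  congr 2
  field_simp

theorem fPlus_memLp {m : ℝ} (hm : 0 < m) (f : SchwartzTest) :
    MemLp (fPlus f) 2 (shellMeasure m) := by
  set g : SchwartzMap (EuclideanSpace ℝ (Fin 3)) ℂ := FourierTransform.fourier
    (SchwartzMap.compCLMOfContinuousLinearEquiv ℂ (EuclideanSpace.equiv (Fin 3) ℝ) f) with hg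
  have hcont : Continuous (fPlus f) := by
    have : fPlus f = fun p => g ((-(2 * Real.pi)⁻¹ : ℝ) •
        (WithLp.toLp 2 ![p 0, -p 1, -p 2] : EuclideanSpace ℝ (Fin 3))) :=
      funext fun p => fPlus_eq_fourier f p
    rw [this]
    have hv : Continuous fun p : V => (![p 0, -p 1, -p 2] : Fin 3 → ℝ) := ?_
    · have hv' : Continuous fun p : V =>
          (WithLp.toLp 2 ![p 0, -p 1, -p 2] : EuclideanSpace ℝ (Fin 3)) :=
        (PiLp.continuous_toLp 2 _).comp hv
      have hv'' : Continuous fun p : V => (-(2 * Real.pi)⁻¹ : ℝ) •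
          (WithLp.toLp 2 ![p 0, -p 1, -p 2] : EuclideanSpace ℝ (Fin 3)) :=
        (continuous_const_smul (-(2 * Real.pi)⁻¹ : ℝ)).comp hv'
      exact g.continuous.comp hv''
    refine continuous_pi fun i => ?_
    fin_cases i
    · exact continuous_apply 0
    · exact (continuous_apply 1).neg
    · exact (continuous_apply 2).neg
  obtain ⟨C, hC⟩ : ∃ C, ∀ w, (1 + ‖w‖) ^ 2 * ‖g w‖ ≤ C := by
    refine ⟨2 ^ 2 * (Finset.Iic ((2, 0) : ℕ × ℕ)).sup
      (fun m => SchwartzMap.seminorm ℝ m.1 m.2) g, fun w => ?_⟩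
    have h := SchwartzMap.one_add_le_sup_seminorm_apply (𝕜 := ℝ) (m := ((2, 0) : ℕ × ℕ))
      (show 2 ≤ ((2, 0) : ℕ × ℕ).1 from le_rfl) (show 0 ≤ ((2, 0) : ℕ × ℕ).2 from le_rfl) g w
    rwa [norm_iteratedFDeriv_zero] at h
  have hbound : ∀ q : ℝ × ℝ, ‖fPlus f (onShell m q)‖ ≤
      C * (2 * Real.pi) ^ 2 * (1 + ‖q‖) ^ (-2 : ℝ) := by
    intro q
    rw [fPlus_eq_fourier, ← hg]
    set w : EuclideanSpace ℝ (Fin 3) := (-(2 * Real.pi)⁻¹ : ℝ) •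
      WithLp.toLp 2 ![onShell m q 0, -onShell m q 1, -onShell m q 2]
    have hw : (1 + ‖q‖) ≤ 2 * Real.pi * (1 + ‖w‖) := by
      have h1 : 2 * Real.pi * ‖w‖ =
          ‖(WithLp.toLp 2 ![onShell m q 0, -onShell m q 1, -onShell m q 2] :
            EuclideanSpace ℝ (Fin 3))‖ := by
        rw [norm_smul, Real.norm_eq_abs, abs_neg, abs_of_pos (by positivity)]
        field_simp
      have h2 : ‖q‖ ≤ 2 * Real.pi * ‖w‖ := by
        rw [h1, Prod.norm_def]
        refine max_le ?_ ?_
        · simpa [onShell] using PiLp.norm_apply_le (WithLp.toLp 2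
            ![onShell m q 0, -onShell m q 1, -onShell m q 2] : EuclideanSpace ℝ (Fin 3)) 1
        · simpa [onShell] using PiLp.norm_apply_le (WithLp.toLp 2
            ![onShell m q 0, -onShell m q 1, -onShell m q 2] : EuclideanSpace ℝ (Fin 3)) 2
      nlinarith [Real.pi_gt_three]
    have hq : 0 < 1 + ‖q‖ := by positivity
    rw [Real.rpow_neg hq.le, ← div_eq_mul_inv, le_div_iff₀ (by positivity)]
    have h3 : (1 + ‖q‖) ^ (2 : ℝ) ≤ (2 * Real.pi) ^ 2 * (1 + ‖w‖) ^ 2 := by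
      rw [Real.rpow_two, ← mul_pow]
      exact pow_le_pow_left₀ hq.le hw 2
    calc ‖g w‖ * (1 + ‖q‖) ^ (2 : ℝ) ≤ ‖g w‖ * ((2 * Real.pi) ^ 2 * (1 + ‖w‖) ^ 2) := by gcongr
      _ = (1 + ‖w‖) ^ 2 * ‖g w‖ * (2 * Real.pi) ^ 2 := by ring
      _ ≤ C * (2 * Real.pi) ^ 2 := by gcongr; exact hC w
  have hvol : MemLp (fun q => fPlus f (onShell m q)) 2 (volume : Measure (ℝ × ℝ)) := by
    have hJ : MemLp (fun q : ℝ × ℝ => C * (2 * Real.pi) ^ 2 * (1 + ‖q‖) ^ (-2 : ℝ)) 2 volume := by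
      refine MemLp.const_mul ?_ _
      have hc : Continuous fun q : ℝ × ℝ => (1 + ‖q‖) ^ (-2 : ℝ) := by
        refine Continuous.rpow_const (by fun_prop) fun q => Or.inl ?_
        positivity
      refine (memLp_two_iff_integrable_sq hc.aestronglyMeasurable).2 ?_
      have := integrable_one_add_norm (E := ℝ × ℝ) (μ := volume) (r := 4) (by simp; norm_num)
      refine this.congr (Filter.Eventually.of_forall fun q => ?_)
      have hq : 0 < 1 + ‖q‖ := by positivity
      change _ = ((1 + ‖q‖) ^ (-2 : ℝ)) ^ 2
      rw [← Real.rpow_natCast, ← Real.rpow_mul hq.le]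
      norm_num
    refine hJ.of_le (hcont.comp (continuous_onShell m)).aestronglyMeasurable
      (Filter.Eventually.of_forall fun q => (hbound q).trans (le_abs_self _))
  rw [shellMeasure, memLp_map_measure_iff hcont.aestronglyMeasurable
    (continuous_onShell m).measurable.aemeasurable]
  refine MemLp.mono_measure (μ := ENNReal.ofReal (1 / (2 * m)) • volume) ?_
    (hvol.smul_measure ENNReal.ofReal_ne_top)
  rw [← withDensity_const]
  refine withDensity_mono (Filter.Eventually.of_forall fun q => ENNReal.ofReal_le_ofReal ?_)
  have h1 : m ≤ √(m ^ 2 + q.1 ^ 2 + q.2 ^ 2) := Real.le_sqrt_of_sq_le (by nlinarith)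
  gcongr

/-- The restriction to the mass shell of the Fourier transform of a test function, as a
one-particle vector. -/
def Model.plus (P : Model) (f : SchwartzTest) : OneParticle P.mass :=
  (fPlus_memLp P.mass_pos f).toLp (fPlus f)

/-! ### Deformed creation and annihilation operators -/

/-- Adding a particle of momentum `p` in front of the other particles. -/
def insertParticle {n k : ℕ} (z : Conf n k × V) : Conf (n + 1) k :=
  (Fin.cons z.2 z.1.1, z.1.2)

theorem measurePreserving_insertParticle (m : ℝ) (n k : ℕ) :
    MeasurePreserving (insertParticle (n := n) (k := k))
      ((confMeasure m n k).prod (shellMeasure m)) (confMeasure m (n + 1) k) := by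
  have h1 : MeasurePreserving (fun z : V × (Fin n → V) => (Fin.cons z.1 z.2 : Fin (n + 1) → V))
      ((shellMeasure m).prod (Measure.pi fun _ => shellMeasure m))
      (Measure.pi fun _ => shellMeasure m) := by
    have h := (measurePreserving_piFinSuccAbove (α := fun _ : Fin (n + 1) => V)
      (fun _ => shellMeasure m) 0).symm
    convert h using 1
    ext z i
    simp [MeasurableEquiv.piFinSuccAbove]
  have h2 : MeasurePreserving (Prod.swap : Conf n k × V → V × Conf n k)
      ((confMeasure m n k).prod (shellMeasure m)) ((shellMeasure m).prod (confMeasure m n k)) :=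
    Measure.measurePreserving_swap
  have h3 := (measurePreserving_prodAssoc (shellMeasure m)
    (Measure.pi fun _ : Fin n => shellMeasure m) (Measure.pi fun _ : Fin k => shellMeasure m)).symm
  exact ((h1.prod (MeasurePreserving.id _)).comp h3).comp h2

/-- Exchanging particles and antiparticles. -/
theorem measurePreserving_swap_conf (m : ℝ) (n k : ℕ) :
    MeasurePreserving (Prod.swap : Conf n k → Conf k n) (confMeasure m n k)
      (confMeasure m k n) :=
  Measure.measurePreserving_swap

/-- The charge conjugation `(CΨ)_n^k(x, y) = Ψ_k^n(y, x)`, from `k` particles and `n` antiparticles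
to `n` particles and `k` antiparticles. -/
def chargeConj (m : ℝ) (n k : ℕ) : Sector m k n →L[ℂ] Sector m n k :=
  ((Lp.compMeasurePreservingₗᵢ ℂ Prod.swap
      (measurePreserving_swap_conf m n k)).toContinuousLinearMap.comp
    (Sector m k n).subtypeL).codRestrict (Sector m n k) fun Ψ σ τ => by
      refine Lp.ext ?_
      have hs := measurePreserving_swap_conf m n k
      have hp := measurePreserving_permute m σ τ
      have h1 := Lp.coeFn_compMeasurePreserving (Ψ : Lp ℂ 2 (confMeasure m k n)) hs
      have h2 : (Ψ : Conf k n → ℂ) ∘ permute τ σ =ᵐ[confMeasure m k n] Ψ :=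
        (Lp.coeFn_compMeasurePreserving (Ψ : Lp ℂ 2 (confMeasure m k n))
          (measurePreserving_permute m τ σ)).symm.trans (by rw [Ψ.2 τ σ])
      refine (Lp.coeFn_compMeasurePreserving _ hp).trans ?_
      refine (hp.quasiMeasurePreserving.ae_eq_comp h1).trans ?_
      exact (hs.quasiMeasurePreserving.ae_eq_comp h2).trans h1.symm

namespace Model

variable (P : Model)

theorem annihilate_symm (W : PathOfWedges) (φ : OneParticle P.mass) (n k : ℕ)
    (Ψ : Sector P.mass (n + 1) k) :
    contract φ (P.kernel W n k) (P.measurable_kernel W n k) (P.norm_kernel_le W n k)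
      (Lp.compMeasurePreserving insertParticle (measurePreserving_insertParticle P.mass n k) Ψ) ∈
      Sector P.mass n k := by
  intro σ τ
  have hi := measurePreserving_insertParticle P.mass n k
  have hp := measurePreserving_permute P.mass σ τ
  set Ξ := Lp.compMeasurePreserving insertParticle hi (Ψ : Lp ℂ 2 (confMeasure P.mass (n + 1) k))
  have hΞ : Ξ =ᵐ[(confMeasure P.mass n k).prod (shellMeasure P.mass)] Ψ ∘ insertParticle :=
    Lp.coeFn_compMeasurePreserving _ hi
  have hsym : (Ξ : Conf n k × V → ℂ) ∘ Prod.map (permute σ τ) id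
      =ᵐ[(confMeasure P.mass n k).prod (shellMeasure P.mass)] Ξ := by
    have h2 : (Ψ : Conf (n + 1) k → ℂ) ∘ permute (Equiv.Perm.decomposeFin.symm (0, σ)) τ
        =ᵐ[confMeasure P.mass (n + 1) k] Ψ :=
      (Lp.coeFn_compMeasurePreserving (Ψ : Lp ℂ 2 (confMeasure P.mass (n + 1) k))
        (measurePreserving_permute P.mass _ τ)).symm.trans (by rw [Ψ.2 _ τ])
    have hpi := hp.prod (MeasurePreserving.id (shellMeasure P.mass))
    refine (hpi.quasiMeasurePreserving.ae_eq_comp hΞ).trans ?_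
    refine Filter.EventuallyEq.trans (Filter.Eventually.of_forall fun z => ?_)
      ((hi.quasiMeasurePreserving.ae_eq_comp h2).trans hΞ.symm)
    simp only [Function.comp_apply]
    congr 1
    refine Prod.ext (funext fun j => ?_) rfl
    refine Fin.cases ?_ (fun j => ?_) j
    · simp [insertParticle, permute]
    · simp [insertParticle, permute]
  refine Lp.ext ?_
  have hc := coeFn_contract φ (P.kernel W n k) (P.measurable_kernel W n k)
    (P.norm_kernel_le W n k) Ξ
  refine (Lp.coeFn_compMeasurePreserving _ hp).trans ?_
  refine (hp.quasiMeasurePreserving.ae_eq_comp hc).trans ?_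
  refine Filter.EventuallyEq.trans (Filter.Eventually.of_forall fun x => ?_)
    ((contractFun_congr hsym).trans hc.symm)
  simp only [Function.comp_apply, contractFun, P.kernel_permute]
  rfl


/-- The deformed annihilation operator of particles, from `n + 1` to `n` particles:
`(a_W̃(φ)Ψ)_n^k(x) = √(n+1) ∫ dμ(p) conj(φ(p)) A_W̃^{n,k}(p; x) Ψ_{n+1}^k(p, x)`. -/
def annihilate (W : PathOfWedges) (φ : OneParticle P.mass) (n k : ℕ) :
    Sector P.mass (n + 1) k →L[ℂ] Sector P.mass n k :=
  ((√(n + 1) : ℝ) : ℂ) •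
    (((contract φ (P.kernel W n k) (P.measurable_kernel W n k) (P.norm_kernel_le W n k)).comp
      (Lp.compMeasurePreservingₗᵢ ℂ insertParticle
        (measurePreserving_insertParticle P.mass n k)).toContinuousLinearMap).comp
      (Sector P.mass (n + 1) k).subtypeL).codRestrict (Sector P.mass n k)
        (P.annihilate_symm W φ n k)

/-- The deformed annihilation operator of antiparticles, `b_W̃(φ) = C a_W̃(φ) C`. -/
def annihilateAnti (W : PathOfWedges) (φ : OneParticle P.mass) (n k : ℕ) :
    Sector P.mass n (k + 1) →L[ℂ] Sector P.mass n k :=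
  ((chargeConj P.mass n k).comp (P.annihilate W φ k n)).comp (chargeConj P.mass (k + 1) n)

/-- The deformed creation operator of particles, `a_W̃*(φ) = a_W̃(φ)*`. -/
def create (W : PathOfWedges) (φ : OneParticle P.mass) (n k : ℕ) :
    Sector P.mass n k →L[ℂ] Sector P.mass (n + 1) k :=
  ContinuousLinearMap.adjoint (P.annihilate W φ n k)

/-- The deformed creation operator of antiparticles, `b_W̃*(φ) = b_W̃(φ)*`. -/
def createAnti (W : PathOfWedges) (φ : OneParticle P.mass) (n k : ℕ) :
    Sector P.mass n k →L[ℂ] Sector P.mass n (k + 1) :=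
  ContinuousLinearMap.adjoint (P.annihilateAnti W φ n k)

end Model

/-! ### The operators on the vectors of finite particle number -/

/-- The components of a vector of finite particle number. -/
def components (m : ℝ) : FiniteParticle m →ₗ[ℂ] ∀ i : ℕ × ℕ, Sector m i.1 i.2 where
  toFun Ψ i := (Ψ : Fock m) i
  map_add' _ _ := rfl
  map_smul' _ _ := rfl

theorem components_injective (m : ℝ) : Function.Injective (components m) :=
  fun _ _ h => Subtype.ext (lp.ext h)

/-- The vector of finite particle number with given components. -/
def ofComponents {m : ℝ} (F : ∀ i : ℕ × ℕ, Sector m i.1 i.2) (hF : {i | F i ≠ 0}.Finite) :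
    FiniteParticle m :=
  ⟨⟨F, (memℓp_zero hF).of_exponent_ge zero_le⟩, hF⟩

theorem components_ofComponents {m : ℝ} (F : ∀ i : ℕ × ℕ, Sector m i.1 i.2)
    (hF : {i | F i ≠ 0}.Finite) : components m (ofComponents F hF) = F := rfl

theorem components_smul (m : ℝ) (c : ℂ) (Ψ : FiniteParticle m) :
    components m (c • Ψ) = c • components m Ψ := rfl

/-- An operator on the vectors of finite particle number from its action on components. -/
def liftFinite {m : ℝ}
    (T : (∀ i : ℕ × ℕ, Sector m i.1 i.2) →ₗ[ℂ] (∀ i : ℕ × ℕ, Sector m i.1 i.2))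
    (hT : ∀ Ψ, {i | Ψ i ≠ 0}.Finite → {i | T Ψ i ≠ 0}.Finite) :
    FiniteParticle m →ₗ[ℂ] FiniteParticle m where
  toFun Ψ := ofComponents (T (components m Ψ)) (hT _ Ψ.2)
  map_add' Ψ Ψ' := components_injective m <| (components_ofComponents _ _).trans <| by
    rw [(components m).map_add Ψ Ψ', T.map_add]
    exact ((components m).map_add (ofComponents _ _) (ofComponents _ _)).symm
  map_smul' c Ψ := by
    change _ = c • ofComponents _ _
    apply components_injective m
    refine (components_ofComponents _ _).trans ?_
    refine Eq.trans ?_ (components_smul m c _).symm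
    refine (congrArg T (components_smul m c Ψ)).trans ?_
    exact T.map_smul c _

namespace Model

variable (P : Model) (W : PathOfWedges) (φ : OneParticle P.mass)

/-- `a_W̃(φ)`. -/
def a : FiniteParticle P.mass →ₗ[ℂ] FiniteParticle P.mass :=
  liftFinite
    { toFun := fun Ψ i => P.annihilate W φ i.1 i.2 (Ψ (i.1 + 1, i.2))
      map_add' := fun Ψ Ψ' => by ext1 i; simp
      map_smul' := fun c Ψ => by ext1 i; simp }
    fun Ψ h => (h.image fun i => (i.1 - 1, i.2)).subset fun i hi =>
      ⟨(i.1 + 1, i.2), fun h0 => hi (by simp [h0]), by simp⟩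

/-- `b_W̃(φ)`. -/
def b : FiniteParticle P.mass →ₗ[ℂ] FiniteParticle P.mass :=
  liftFinite
    { toFun := fun Ψ i => P.annihilateAnti W φ i.1 i.2 (Ψ (i.1, i.2 + 1))
      map_add' := fun Ψ Ψ' => by ext1 i; simp
      map_smul' := fun c Ψ => by ext1 i; simp }
    fun Ψ h => (h.image fun i => (i.1, i.2 - 1)).subset fun i hi =>
      ⟨(i.1, i.2 + 1), fun h0 => hi (by simp [h0]), by simp⟩

/-- The components of `a_W̃*(φ) Ψ`. -/
def aStarFun (Ψ : ∀ i : ℕ × ℕ, Sector P.mass i.1 i.2) : ∀ i : ℕ × ℕ, Sector P.mass i.1 i.2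
  | (0, _) => 0
  | (n + 1, k) => P.create W φ n k (Ψ (n, k))

/-- The components of `b_W̃*(φ) Ψ`. -/
def bStarFun (Ψ : ∀ i : ℕ × ℕ, Sector P.mass i.1 i.2) : ∀ i : ℕ × ℕ, Sector P.mass i.1 i.2
  | (_, 0) => 0
  | (n, k + 1) => P.createAnti W φ n k (Ψ (n, k))

/-- `a_W̃*(φ)`. -/
def aStar : FiniteParticle P.mass →ₗ[ℂ] FiniteParticle P.mass :=
  liftFinite
    { toFun := P.aStarFun W φ
      map_add' := fun Ψ Ψ' => by
        ext1 ⟨n, k⟩; cases n <;> simp [aStarFun]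
      map_smul' := fun c Ψ => by
        ext1 ⟨n, k⟩; cases n <;> simp [aStarFun] }
    fun Ψ h => (h.image fun i => (i.1 + 1, i.2)).subset fun ⟨n, k⟩ hi => by
      cases n with
      | zero => exact absurd rfl hi
      | succ n => exact ⟨(n, k), fun h0 => hi (by simp [aStarFun, h0]), rfl⟩

/-- `b_W̃*(φ)`. -/
def bStar : FiniteParticle P.mass →ₗ[ℂ] FiniteParticle P.mass :=
  liftFinite
    { toFun := P.bStarFun W φ
      map_add' := fun Ψ Ψ' => by
        ext1 ⟨n, k⟩; cases k <;> simp [bStarFun]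
      map_smul' := fun c Ψ => by
        ext1 ⟨n, k⟩; cases k <;> simp [bStarFun] }
    fun Ψ h => (h.image fun i => (i.1, i.2 + 1)).subset fun ⟨n, k⟩ hi => by
      cases k with
      | zero => exact absurd rfl hi
      | succ k => exact ⟨(n, k), fun h0 => hi (by simp [bStarFun, h0]), rfl⟩

/-- The deformed field `Φ_W̃(f) = a_W̃*(f⁺) + b_W̃(f̄⁺)`. -/
def field (f : SchwartzTest) : FiniteParticle P.mass →ₗ[ℂ] FiniteParticle P.mass :=
  P.aStar W (P.plus f) + P.b W (P.plus (conjTest f))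

/-- The charge conjugate deformed field `Φ*_W̃(f) = b_W̃*(f⁺) + a_W̃(f̄⁺)`. -/
def fieldStar (f : SchwartzTest) : FiniteParticle P.mass →ₗ[ℂ] FiniteParticle P.mass :=
  P.bStar W (P.plus f) + P.a W (P.plus (conjTest f))

/-- `(U(a, L̃)Ψ)_n^k(x) = e^{i a·Σx} e^{i λ q Ω_n^k(L̃, x)} Ψ_n^k(Λ⁻¹x)` with `q = n - k` and
`Ω_n^k(L̃, x)` the sum of the Wigner rotation angles of the particles minus the sum of those of the
antiparticles: the spin `λ` action of `(a, L̃)` on a function of `n + k` momenta. -/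
def spinAction (a : V) (L : CoverLorentz) {n k : ℕ} (ψ : Conf n k → ℂ) (x : Conf n k) : ℂ :=
  Complex.exp (Complex.I * (mdot a (∑ i, x.1 i + ∑ j, x.2 j) : ℝ)) *
    Complex.exp (Complex.I * (P.spin * ((n : ℝ) - k) *
      (∑ i, wigner P.mass L (x.1 i) - ∑ j, wigner P.mass L (x.2 j)) : ℝ)) *
    ψ (fun i => L⁻¹.act (x.1 i), fun j => L⁻¹.act (x.2 j))

/-- `U` is the spin `λ` representation of the covering of the proper orthochronous Poincaré group
(the pairs `(a, L̃)` with product `(a, L̃)(a', L̃') = (a + Λa', L̃L̃')`) on the Fock space. -/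
structure IsSpinRepresentation (U : V → CoverLorentz → Fock P.mass ≃ₗᵢ[ℂ] Fock P.mass) :
    Prop where
  mul (a a' : V) (L L' : CoverLorentz) (Ψ : Fock P.mass) :
    U (a + L.act a') (L * L') Ψ = U a L (U a' L' Ψ)
  formula (a : V) (L : CoverLorentz) (Ψ : Fock P.mass) (n k : ℕ) :
    ((U a L Ψ (n, k) : Lp ℂ 2 (confMeasure P.mass n k)) : Conf n k → ℂ)
      =ᵐ[confMeasure P.mass n k]
        P.spinAction a L ((Ψ (n, k) : Lp ℂ 2 (confMeasure P.mass n k)) : Conf n k → ℂ)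

end Model

end WedgeAnyons

end

open WedgeAnyons MeasureTheory
open scoped Pointwise

/-!
# Wedge-local fields of anyons by multiplicative deformation

*Intertwiners.* The boosts `B(p)` turn the Wigner rotation angle into a cocycle: `B(p)⁻¹ L̃ B(Λ⁻¹p)`
fixes `(m, 0, 0)`, hence is the pure rotation by `Ω(L̃, p)` (`wigner_rotation`, `wigner_mul`). For a
boost preserving the standard wedge this cocycle is the coboundary of the angle of `u₀`
(`Model.angle₀_boost`), and such a boost commutes with `Q₀`. The covering group acts transitively on
the paths of wedges (`exists_smul_standardPath`), and the stabilizer of the standard one consists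
exactly of these boosts (`smul_standardPath_iff`): paths of spacelike directions are lifted to the
coordinates `(x₀, θ)` of the universal covering of the hyperboloid, where homotopies into the standard
wedge are straight lines and the winding number is read off the angle. Hence `u` and `Q` do not
depend on the transformation used to define them. The same description of the stabilizer gives
existence and uniqueness of the statistics number of opposite paths of wedges, after the causal
complement of the standard wedge has been identified with its rotation by `π`.

*Exchange relations.* Since `u₀` is invariant under the reflection of `p₁` and `p₂`, opposite paths of
wedges with statistics number `k` have intertwiners `u' = c u` with `c = e^{-iλkπ}`, and `Q' = -Q`
(`Model.Opposite`). Because `Q` is skew, the deformation functions `R(Qp·p')` cancel whenever two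
deformed operators for opposite wedges are exchanged, and only the phases `c²` or `c⁻²` of the
intertwiners remain. This gives all the relations in which no particle is contracted
(`Model.Opposite.annihilate_annihilate`, `Model.Opposite.annihilate_annihilateAnti`,
`Model.Opposite.annihilateAnti_create`, `Model.Opposite.annihilate_create_succ`, together with their
adjoints and charge conjugates), and with them the first commutation relation.

*Contractions.* In the second commutation relation there remain two multiplication operators, one
from contracting particles and one from contracting antiparticles. Up to the phase they are the
integrals over the mass shell of `∏ R(Qp·pᵢ)² f⁺(-p) g⁺(p)` and `∏ R(Qp·pᵢ)⁻² f⁺(p) g⁺(-p)`. In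
rapidity coordinates adapted to the wedge, the first integrand continues analytically to the strip
`0 < Im θ < π`: there `Qp·pᵢ` lies in the upper half plane, on which `R` is bounded, and the
exponential `e^{-ip·(x-y)}` is bounded because the support condition places `x - y` in the closed
wedge. At `θ + iπ` the momentum becomes `-p`, up to the sign of its second component, and the second
integral appears (`integral_eq_integral_add_pi`, `Model.integral_prodR_eq`).

*Covariance.* The cocycle identity and the invariance of the measure on the mass shell make
`Model.spinFock` a unitary representation. The factor of `u` in the kernel `A^{n,l}` is precisely the
one which turns the multiplier of the sector with `n + 1` particles into that of the sector with `n`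
particles (`Model.kernel_smul`), and therefore the deformed operators are covariant.
-/

noncomputable section

namespace WedgeAnyons

/-! ### The covering homomorphism -/

namespace CoverLorentz

/-- The spatial part of a vector as a complex number, `x₁ + i x₂`. -/
def zC (x : V) : ℂ := x 1 + x 2 * Complex.I

theorem V_ext {x y : V} (h0 : (x 0 : ℂ) = y 0) (hz : zC x = zC y) : x = y := by
  have h1 : x 1 = y 1 := by simpa [zC] using congrArg Complex.re hz
  have h2 : x 2 = y 2 := by simpa [zC] using congrArg Complex.im hz
  ext i; fin_cases i
  · exact_mod_cast h0
  · exact h1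
  · exact h2

theorem denomC_ne (L : CoverLorentz) : (1 - L.γ * conj L.γ : ℂ) ≠ 0 := by
  rw [Complex.mul_conj']
  have h := (denom_pos L).ne'
  rw [← norm_sq_γ] at h
  exact_mod_cast h

theorem act_zero_complex (L : CoverLorentz) (x : V) : (1 - L.γ * conj L.γ) * (L.act x 0 : ℂ) =
    (1 + L.γ * conj L.γ) * x 0 + (conj L.γ * zC x + L.γ * conj (zC x)) := by
  have h := (denom_pos L).ne'
  have h1 : (1 - (L.γ.re ^ 2 + L.γ.im ^ 2)) * L.act x 0 =
      (1 + (L.γ.re ^ 2 + L.γ.im ^ 2)) * x 0 + 2 * (L.γ.re * x 1 + L.γ.im * x 2) := by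
    rw [act_apply_zero, mul_div_cancel₀ _ h]
  have h2 : L.γ * conj L.γ = ((L.γ.re ^ 2 + L.γ.im ^ 2 : ℝ) : ℂ) := by
    rw [Complex.mul_conj']; exact_mod_cast norm_sq_γ L
  have h3 : conj L.γ * zC x + L.γ * conj (zC x) =
      ((2 * (L.γ.re * x 1 + L.γ.im * x 2) : ℝ) : ℂ) := by
    apply Complex.ext <;> simp [zC] <;> ring
  rw [h2, h3]
  exact_mod_cast h1

theorem act_zC (L : CoverLorentz) (x : V) : (1 - L.γ * conj L.γ) * zC (L.act x) =
    Complex.exp (L.ω * Complex.I) * (2 * L.γ * x 0 + zC x + L.γ ^ 2 * conj (zC x)) := by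
  have h := (denom_pos L).ne'
  have h2 : L.γ * conj L.γ = ((L.γ.re ^ 2 + L.γ.im ^ 2 : ℝ) : ℂ) := by
    rw [Complex.mul_conj']; exact_mod_cast norm_sq_γ L
  have h3 : 1 - L.γ * conj L.γ = ((1 - (L.γ.re ^ 2 + L.γ.im ^ 2) : ℝ) : ℂ) := by
    rw [h2]; push_cast; ring
  rw [h3]
  have e1 : (1 - (L.γ.re ^ 2 + L.γ.im ^ 2)) * L.act x 1 =
      Real.cos L.ω * auxRe L x - Real.sin L.ω * auxIm L x := by
    rw [act_apply_one, mul_div_cancel₀ _ h]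
  have e2 : (1 - (L.γ.re ^ 2 + L.γ.im ^ 2)) * L.act x 2 =
      Real.sin L.ω * auxRe L x + Real.cos L.ω * auxIm L x := by
    rw [act_apply_two, mul_div_cancel₀ _ h]
  apply Complex.ext
  · simp only [zC, Complex.re_ofReal_mul]
    simp [Complex.exp_ofReal_mul_I_re, Complex.exp_ofReal_mul_I_im, pow_two] at e1 ⊢
    rw [e1]; simp only [auxRe, auxIm]; ring
  · simp only [zC, Complex.im_ofReal_mul]
    simp [Complex.exp_ofReal_mul_I_re, Complex.exp_ofReal_mul_I_im, pow_two] at e2 ⊢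
    rw [e2]; simp only [auxRe, auxIm]; ring

/-- The covering homomorphism is multiplicative: the group law describes the composition of
Lorentz transformations. -/
theorem act_mul (a b : CoverLorentz) (x : V) : (a * b).act x = a.act (b.act x) := by
  set e := Complex.exp (b.ω * Complex.I) with he
  have hei : Complex.exp (-(b.ω * Complex.I)) = e⁻¹ := Complex.exp_neg _
  have he0 : e ≠ 0 := Complex.exp_ne_zero _
  have hce : conj e = e⁻¹ := by rw [he, ← Complex.exp_conj, ← Complex.exp_neg]; simp
  have hn : 0 < (1 + a.γ * conj b.γ * e⁻¹).re := by
    rw [← hei]; exact one_add_re_pos (norm_aux _ _ _ a.norm_lt b.norm_lt)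
  set n := 1 + a.γ * conj b.γ * e⁻¹ with hndef
  have hn0 : n ≠ 0 := by intro h; rw [h] at hn; simp at hn
  set n' := 1 + conj a.γ * b.γ * e with hn'def
  have hcn : conj n = n' := by simp [hndef, hn'def, hce]
  have hn'0 : n' ≠ 0 := by rw [← hcn]; simpa using hn0
  have hee : e * e⁻¹ = 1 := mul_inv_cancel₀ he0
  have hgn : n * (a * b).γ = b.γ + a.γ * e⁻¹ := by rw [mul_γ, hei, mul_div_cancel₀ _ hn0]
  have hgn' : n' * conj (a * b).γ = conj b.γ + conj a.γ * e := by
    have := congrArg conj hgn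
    simpa [hcn, hce] using this
  have hE : n' * Complex.exp ((a * b).ω * Complex.I) = Complex.exp (a.ω * Complex.I) * e * n := by
    have h := exp_phase hn
    rw [hcn] at h
    have h' : Complex.exp (phase n * Complex.I) = n / n' := by
      rw [← inv_inj, ← Complex.exp_neg, h, inv_div]
    rw [mul_ω, hei, ← hndef]
    have h2 : (((a.ω + b.ω + phase n : ℝ) : ℂ) * Complex.I) =
      a.ω * Complex.I + b.ω * Complex.I + phase n * Complex.I := by push_cast; ring
    rw [h2, Complex.exp_add, Complex.exp_add, h', ← he]
    field_simp
  have hD := denomC_ne (a * b)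
  have a0 := act_zero_complex a (b.act x)
  have az := act_zC a (b.act x)
  have b0 := act_zero_complex b x
  have bz := act_zC b x
  have bz' : (1 - b.γ * conj b.γ) * conj (zC (b.act x)) =
      e⁻¹ * (2 * conj b.γ * x 0 + conj (zC x) + conj b.γ ^ 2 * zC x) := by
    have := congrArg conj bz
    rw [← he] at this
    simp only [map_mul, map_sub, map_add, map_pow, map_one, Complex.conj_conj, hce,
      Complex.conj_ofReal, map_ofNat] at this
    linear_combination this
  rw [← he] at bz
  have c0 := act_zero_complex (a * b) x
  have cz := act_zC (a * b) x
  set g := (a * b).γ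
  set g' := conj g
  have hDD : n * n' * (1 - g * g') = (1 - a.γ * conj a.γ) * (1 - b.γ * conj b.γ) := by
    have h1 : n * n' * (1 - g * g') = n * n' - (n * g) * (n' * g') := by ring
    rw [h1, hgn, hgn', hndef, hn'def]
    linear_combination (a.γ * conj a.γ * b.γ * conj b.γ - a.γ * conj a.γ) * hee
  have hnn := mul_ne_zero hn0 hn'0
  apply V_ext
  · apply mul_left_cancel₀ hD
    rw [c0]
    apply mul_left_cancel₀ hnn
    rw [← mul_assoc (n * n') (1 - _), hDD]
    have h1 : n * n' * ((1 + g * g') * (x 0 : ℂ) + (g' * zC x + g * conj (zC x))) =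
        (n * n' + (n * g) * (n' * g')) * (x 0 : ℂ) +
          (n * (n' * g') * zC x + n' * (n * g) * conj (zC x)) := by ring
    rw [h1, hgn, hgn', hndef, hn'def]
    linear_combination -(1 - b.γ * conj b.γ) * a0 - (1 + a.γ * conj a.γ) * b0 -
      conj a.γ * bz - a.γ * bz' +
      (a.γ * conj a.γ * b.γ * conj b.γ * x 0 + a.γ * conj a.γ * x 0 +
        a.γ * conj a.γ * conj b.γ * zC x + a.γ * conj a.γ * b.γ * conj (zC x)) * hee
  · apply mul_left_cancel₀ hD
    rw [cz]
    apply mul_left_cancel₀ hnn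
    rw [← mul_assoc (n * n') (1 - _), hDD]
    set E := Complex.exp (a.ω * Complex.I)
    have h1 : n * n' * (Complex.exp ((a * b).ω * Complex.I) *
        (2 * g * (x 0 : ℂ) + zC x + g ^ 2 * conj (zC x))) =
        n' * Complex.exp ((a * b).ω * Complex.I) * (2 * (n * g) * (x 0 : ℂ) + n * zC x +
          (n * g) * g * conj (zC x)) := by ring
    have h2 : E * e * n * (2 * (b.γ + a.γ * e⁻¹) * (x 0 : ℂ) + n * zC x +
          (b.γ + a.γ * e⁻¹) * g * conj (zC x)) = E * e * (n * (2 * (b.γ + a.γ * e⁻¹) * (x 0 : ℂ) +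
          n * zC x) + (b.γ + a.γ * e⁻¹) * (n * g) * conj (zC x)) := by ring
    rw [h1, hE, hgn, h2, hgn, hndef]
    have l2 : E * e * ((1 + a.γ * conj b.γ * e⁻¹) * (2 * (b.γ + a.γ * e⁻¹) * (x 0 : ℂ) +
        (1 + a.γ * conj b.γ * e⁻¹) * zC x) + (b.γ + a.γ * e⁻¹) * (b.γ + a.γ * e⁻¹) *
          conj (zC x)) =
        E * (2 * (e + a.γ * conj b.γ) * (b.γ + a.γ * e⁻¹) * (x 0 : ℂ) +
        (e + a.γ * conj b.γ) * (1 + a.γ * conj b.γ * e⁻¹) * zC x +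
        (b.γ * e + a.γ) * (b.γ + a.γ * e⁻¹) * conj (zC x)) := by
      field_simp
    rw [l2]
    linear_combination -(1 - b.γ * conj b.γ) * az - E * (2 * a.γ * b0 + bz + a.γ ^ 2 * bz') +
      E * (2 * a.γ * x 0 + a.γ * conj b.γ * zC x + a.γ * b.γ * conj (zC x)) * hee

end CoverLorentz

/-! ### Lorentz transformations and the mass shell -/

namespace CoverLorentz

theorem act_act_inv (L : CoverLorentz) (x : V) : L.act (L⁻¹.act x) = x := by
  simpa using act_inv_act L⁻¹ x

theorem act_add (L : CoverLorentz) (x y : V) : L.act (x + y) = L.act x + L.act y :=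
  Matrix.mulVec_add _ _ _

theorem act_sub (L : CoverLorentz) (x y : V) : L.act (x - y) = L.act x - L.act y :=
  Matrix.mulVec_sub _ _ _

theorem act_neg (L : CoverLorentz) (x : V) : L.act (-x) = -L.act x :=
  Matrix.mulVec_neg _ _

theorem act_smul (L : CoverLorentz) (c : ℝ) (x : V) : L.act (c • x) = c • L.act x :=
  Matrix.mulVec_smul _ _ _

theorem act_sum (L : CoverLorentz) {ι : Type*} (s : Finset ι) (f : ι → V) :
    L.act (∑ i ∈ s, f i) = ∑ i ∈ s, L.act (f i) :=
  map_sum L.toMatrix.mulVecLin f s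

theorem continuous_act_right (L : CoverLorentz) : Continuous L.act :=
  continuous_act continuous_const continuous_const continuous_id

theorem mdot_act_left (L : CoverLorentz) (x y : V) : mdot (L.act x) y = mdot x (L⁻¹.act y) := by
  rw [← mdot_act L x, act_act_inv]

theorem toMatrix_mul (a b : CoverLorentz) : (a * b).toMatrix = a.toMatrix * b.toMatrix := by
  apply Matrix.toLin'.injective
  refine LinearMap.ext fun x => ?_
  rw [Matrix.toLin'_mul, LinearMap.comp_apply, Matrix.toLin'_apply, Matrix.toLin'_apply,
    Matrix.toLin'_apply]
  exact act_mul a b x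

theorem toMatrix_one : (1 : CoverLorentz).toMatrix = 1 := by
  apply Matrix.toLin'.injective
  refine LinearMap.ext fun x => ?_
  rw [Matrix.toLin'_apply, Matrix.toLin'_one]
  exact one_act x

theorem one_γ : (1 : CoverLorentz).γ = 0 := rfl
theorem one_ω : (1 : CoverLorentz).ω = 0 := rfl
theorem rot_γ (ω : ℝ) : (rot ω).γ = 0 := rfl
theorem rot_ω (ω : ℝ) : (rot ω).ω = ω := rfl

theorem phase_one : phase 1 = 0 := by simp [phase]

theorem rot_zero : rot 0 = 1 := rfl

theorem rot_mul_γ (ω : ℝ) (L : CoverLorentz) : (rot ω * L).γ = L.γ := by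
  simp [mul_γ, rot_γ]

theorem rot_mul_ω (ω : ℝ) (L : CoverLorentz) : (rot ω * L).ω = ω + L.ω := by
  simp [mul_ω, rot_γ, rot_ω, phase_one]

theorem mul_rot_γ (L : CoverLorentz) (ω : ℝ) :
    (L * rot ω).γ = L.γ * Complex.exp (-(ω * Complex.I)) := by
  simp [mul_γ, rot_γ, rot_ω]

theorem mul_rot_ω (L : CoverLorentz) (ω : ℝ) : (L * rot ω).ω = L.ω + ω := by
  simp [mul_ω, rot_γ, rot_ω, phase_one]

theorem rot_mul_rot (ω ω' : ℝ) : rot ω * rot ω' = rot (ω + ω') := by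
  ext
  · simp [rot_mul_γ, rot_γ]
  · simp [rot_mul_ω, rot_ω]

theorem rot_inv (ω : ℝ) : (rot ω)⁻¹ = rot (-ω) := by
  rw [inv_eq_iff_mul_eq_one, rot_mul_rot]; simp [rot_zero]

theorem rot_act (ω : ℝ) (x : V) : (rot ω).act x =
    ![x 0, Real.cos ω * x 1 - Real.sin ω * x 2, Real.sin ω * x 1 + Real.cos ω * x 2] := by
  ext i; fin_cases i
  · simp [act_apply_zero, rot_γ]
  · simp [act_apply_one, auxRe, auxIm, rot_γ, rot_ω]
  · simp [act_apply_two, auxRe, auxIm, rot_γ, rot_ω]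

theorem mul_inv_toMatrix (L : CoverLorentz) : L.toMatrix * L⁻¹.toMatrix = 1 := by
  rw [← toMatrix_mul, mul_inv_cancel, toMatrix_one]

end CoverLorentz

/-- The upper mass shell. -/
def massShell (m : ℝ) : Set V := {p | 0 < p 0 ∧ mdot p p = m ^ 2}

theorem onShell_mem_massShell {m : ℝ} (hm : 0 < m) (q : ℝ × ℝ) : onShell m q ∈ massShell m := by
  have h : 0 < m ^ 2 + q.1 ^ 2 + q.2 ^ 2 := by positivity
  refine ⟨Real.sqrt_pos.2 h, ?_⟩
  have := Real.mul_self_sqrt h.le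
  simp only [mdot, onShell, Matrix.cons_val_zero, Matrix.cons_val_one, Matrix.cons_val]
  linarith

theorem act_mem_massShell {m : ℝ} (hm : 0 < m) (L : CoverLorentz) {p : V} (hp : p ∈ massShell m) :
    L.act p ∈ massShell m :=
  ⟨L.toMatrix_restricted.orthochronous p (by rw [hp.2]; positivity) hp.1,
    by rw [CoverLorentz.mdot_act, hp.2]⟩

theorem norm_boostParam_lt {m : ℝ} (hm : 0 < m) {p : V} (hp : p ∈ massShell m) :
    ‖boostParam m p‖ < 1 := by
  obtain ⟨h0, h⟩ := hp
  simp only [mdot] at h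
  have hpm : 0 < p 0 + m := by linarith
  have e : boostParam m p = (p 1 + p 2 * Complex.I) / ((p 0 + m : ℝ) : ℂ) := by
    simp [boostParam]
  rw [e, norm_div, Complex.norm_real, Real.norm_of_nonneg hpm.le, div_lt_one hpm]
  apply lt_of_pow_lt_pow_left₀ 2 hpm.le
  rw [← Complex.normSq_eq_norm_sq, Complex.normSq_apply]
  simp
  nlinarith

/-- The rotation free boost from `(m, 0, 0)` to `p`. -/
def boostTo {m : ℝ} (hm : 0 < m) {p : V} (hp : p ∈ massShell m) : CoverLorentz :=
  ⟨boostParam m p, 0, norm_boostParam_lt hm hp⟩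

theorem boostTo_act {m : ℝ} (hm : 0 < m) {p : V} (hp : p ∈ massShell m) :
    (boostTo hm hp).act ![m, 0, 0] = p := by
  have hpm : 0 < p 0 + m := by linarith [hp.1]
  have h := hp.2
  simp only [mdot] at h
  have hre : (boostTo hm hp).γ.re = p 1 / (p 0 + m) := by
    have e : boostParam m p = (p 1 + p 2 * Complex.I) / ((p 0 + m : ℝ) : ℂ) := by simp [boostParam]
    simp only [boostTo, e, Complex.div_ofReal_re]; simp
  have him : (boostTo hm hp).γ.im = p 2 / (p 0 + m) := by
    have e : boostParam m p = (p 1 + p 2 * Complex.I) / ((p 0 + m : ℝ) : ℂ) := by simp [boostParam]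
    simp only [boostTo, e, Complex.div_ofReal_im]; simp
  have hω : (boostTo hm hp).ω = 0 := rfl
  have hD : 1 - ((p 1 / (p 0 + m)) ^ 2 + (p 2 / (p 0 + m)) ^ 2) = 2 * m / (p 0 + m) := by
    field_simp
    linear_combination h
  ext i; fin_cases i
  · simp only [Fin.zero_eta, CoverLorentz.act_apply_zero, hre, him, hD]
    simp
    field_simp
    linear_combination -h
  · simp only [Fin.mk_one, CoverLorentz.act_apply_one, CoverLorentz.auxRe, CoverLorentz.auxIm,
      hre, him, hD, hω]
    simp
    field_simp
  · simp only [Fin.reduceFinMk, CoverLorentz.act_apply_two, CoverLorentz.auxRe,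
      CoverLorentz.auxIm, hre, him, hD, hω]
    simp
    field_simp

/-- The stabilizer of `(m, 0, 0)` in the covering group consists of the rotations. -/
theorem eq_rot_of_act_rest {m : ℝ} (hm : 0 < m) {L : CoverLorentz}
    (h : L.act ![m, 0, 0] = ![m, 0, 0]) : L = CoverLorentz.rot L.ω := by
  have h0 := congrFun h 0
  have hD := CoverLorentz.denom_pos L
  rw [CoverLorentz.act_apply_zero, div_eq_iff hD.ne'] at h0
  simp at h0
  have h1 : m * (L.γ.re ^ 2 + L.γ.im ^ 2) = 0 := by linarith
  have h2 : L.γ.re ^ 2 + L.γ.im ^ 2 = 0 := by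
    rcases mul_eq_zero.1 h1 with h | h
    · exact absurd h hm.ne'
    · exact h
  ext
  · apply Complex.ext
    · simp [CoverLorentz.rot]; nlinarith [sq_nonneg L.γ.re, sq_nonneg L.γ.im]
    · simp [CoverLorentz.rot]; nlinarith [sq_nonneg L.γ.re, sq_nonneg L.γ.im]
  · rfl

/-! ### Wigner rotations -/

/-- The Wigner rotation `B(p)⁻¹ L̃ B(Λ⁻¹p)` fixes `(m, 0, 0)`, hence is a pure rotation; its angle
is the number `Ω(L̃, p)`. -/
theorem wigner_rotation {m : ℝ} (hm : 0 < m) (L : CoverLorentz) {p p' : V}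
    (hp : p ∈ massShell m) (hp' : p' ∈ massShell m) (h : L⁻¹.act p = p') :
    (boostTo hm hp)⁻¹ * L * boostTo hm hp' = CoverLorentz.rot (wigner m L p) := by
  have hω : ((boostTo hm hp)⁻¹ * L * boostTo hm hp').ω = wigner m L p := by
    have hi : (boostTo hm hp)⁻¹.γ = -boostParam m p := by
      change -boostParam m p * Complex.exp (((0 : ℝ) : ℂ) * Complex.I) = _
      simp
    have hiω : (boostTo hm hp)⁻¹.ω = 0 := by change -(0 : ℝ) = 0; simp
    rw [CoverLorentz.mul_ω, CoverLorentz.mul_ω, CoverLorentz.mul_γ, hi, hiω, wigner, h]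
    have h1 : (boostTo hm hp').γ = boostParam m p' := rfl
    have h2 : (boostTo hm hp').ω = 0 := rfl
    rw [h1, h2]
    simp [sub_eq_add_neg]
  rw [← hω]
  apply eq_rot_of_act_rest hm
  rw [CoverLorentz.act_mul, CoverLorentz.act_mul, boostTo_act, ← h, CoverLorentz.act_act_inv]
  exact (congrArg _ (boostTo_act hm hp).symm).trans (CoverLorentz.act_inv_act _ _)

/-- The cocycle identity of the Wigner rotation angles. -/
theorem wigner_mul {m : ℝ} (hm : 0 < m) (L L' : CoverLorentz) {p : V} (hp : p ∈ massShell m) :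
    wigner m (L * L') p = wigner m L p + wigner m L' (L⁻¹.act p) := by
  have hp' := act_mem_massShell hm L⁻¹ hp
  have hp'' := act_mem_massShell hm L'⁻¹ hp'
  have h1 := wigner_rotation hm L hp hp' rfl
  have h2 := wigner_rotation hm L' hp' hp'' rfl
  have h3 := wigner_rotation hm (L * L') hp hp'' (by rw [mul_inv_rev, CoverLorentz.act_mul])
  have h4 : CoverLorentz.rot (wigner m (L * L') p) =
      CoverLorentz.rot (wigner m L p + wigner m L' (L⁻¹.act p)) := by
    rw [← CoverLorentz.rot_mul_rot, ← h1, ← h2, ← h3]; group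
  exact congrArg CoverLorentz.ω h4

theorem wigner_one {m : ℝ} (hm : 0 < m) {p : V} (hp : p ∈ massShell m) : wigner m 1 p = 0 := by
  have h := wigner_mul hm 1 1 hp
  simp [CoverLorentz.one_act] at h
  exact h

theorem wigner_rot {m : ℝ} (hm : 0 < m) (ω : ℝ) {p : V} (hp : p ∈ massShell m) :
    wigner m (CoverLorentz.rot ω) p = ω := by
  have hp' := act_mem_massShell hm (CoverLorentz.rot ω)⁻¹ hp
  set q := (CoverLorentz.rot ω)⁻¹.act p with hq
  have hb : boostParam m p = boostParam m q * Complex.exp (ω * Complex.I) := by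
    have hpq : p = (CoverLorentz.rot ω).act q := by rw [hq, CoverLorentz.act_act_inv]
    rw [hpq, CoverLorentz.rot_act]
    simp only [boostParam, Matrix.cons_val_zero, Matrix.cons_val_one, Matrix.cons_val]
    rw [div_mul_eq_mul_div]
    congr 1
    rw [Complex.exp_mul_I, ← Complex.ofReal_cos, ← Complex.ofReal_sin]
    apply Complex.ext <;> simp <;> ring
  have hre : 0 ≤ 1 - ‖boostParam m q‖ ^ 2 := by
    nlinarith [norm_boostParam_lt hm hp', norm_nonneg (boostParam m q)]
  rw [wigner, hb, ← hq]
  simp only [CoverLorentz.rot_γ, CoverLorentz.rot_ω, map_zero, mul_zero, zero_mul, sub_zero,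
    CoverLorentz.phase_one, add_zero, zero_sub, div_one]
  have he : boostParam m q * Complex.exp (ω * Complex.I) * Complex.exp (-(ω * Complex.I)) =
      boostParam m q := by
    rw [mul_assoc, ← Complex.exp_add]; simp
  rw [he, neg_mul, Complex.mul_conj', ← sub_eq_add_neg,
    show (1 : ℂ) - (‖boostParam m q‖ : ℂ) ^ 2 = ((1 - ‖boostParam m q‖ ^ 2 : ℝ) : ℂ) by
      push_cast; rfl]
  rw [phase, Complex.arg_ofReal_of_nonneg hre]
  simp

/-! ### The intertwiner of the standard wedge -/

theorem phase_real_mul {r : ℝ} (hr : 0 < r) (z : ℂ) : phase (r * z) = phase z := by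
  rw [phase, phase, Complex.arg_real_mul _ hr]

theorem phase_conj {z : ℂ} (hz : 0 < z.re) : phase (conj z) = -phase z := by
  rw [phase, phase, Complex.arg_conj, if_neg]
  · ring
  · intro h
    have := abs_lt.1 (Complex.abs_arg_lt_pi_div_two_iff.2 (Or.inl hz))
    linarith [Real.pi_pos]

theorem abs_lt_of_mem_massShell {m : ℝ} (hm : 0 < m) {p : V} (hp : p ∈ massShell m) :
    |p 1| < p 0 := by
  obtain ⟨h0, h⟩ := hp
  simp only [mdot] at h
  refine abs_lt_of_sq_lt_sq ?_ h0.le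
  nlinarith [sq_nonneg (p 2)]

namespace Model

variable (P : Model)

/-- An angle `χ`, continuous on the mass shell, with `u₀ = exp (i λ χ)` there. -/
def angle₀ (p : V) : ℝ :=
  -(P.mass + p 2 * Complex.I : ℂ).arg + phase (p 0 + P.mass - p 1 + p 2 * Complex.I)

theorem re_pos_aux {p : V} (hp : p ∈ massShell P.mass) :
    0 < (p 0 + P.mass - p 1 + p 2 * Complex.I : ℂ).re := by
  have h := abs_lt_of_mem_massShell P.mass_pos hp
  have := P.mass_pos
  simp
  linarith [(abs_lt.1 h).2]

theorem u₀_eq {p : V} (hp : p ∈ massShell P.mass) :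
    P.u₀ p = Complex.exp (Complex.I * (P.spin * P.angle₀ p : ℝ)) := by
  have hm := P.mass_pos
  have hre := P.re_pos_aux hp
  set w : ℂ := p 0 + P.mass - p 1 + p 2 * Complex.I with hw
  set z : ℂ := P.mass + p 2 * Complex.I with hz
  have hzre : 0 < z.re := by simp [hz, hm]
  have hz0 : z ≠ 0 := by intro h; rw [h] at hzre; simp at hzre
  have hw0 : w ≠ 0 := by intro h; rw [h] at hre; simp at hre
  have hcw : (p 0 + P.mass - p 1 - p 2 * Complex.I : ℂ) = conj w := by
    simp [hw, sub_eq_add_neg]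
  have hcz : (P.mass - p 2 * Complex.I : ℂ) = conj z := by simp [hz, sub_eq_add_neg]
  have hn : √(P.mass ^ 2 + p 2 ^ 2) = ‖z‖ := by
    rw [Complex.norm_def, Complex.normSq_apply]; simp [hz, pow_two]
  have hnz : (‖z‖ : ℂ) ≠ 0 := by simpa using hz0
  have harg := abs_lt.1 (Complex.abs_arg_lt_pi_div_two_iff.2 (Or.inl hzre))
  have l1 : Complex.log (conj z / ‖z‖) = -(z.arg * Complex.I) := by
    have e : conj z / ‖z‖ = Complex.exp (-(z.arg * Complex.I)) := by
      rw [div_eq_iff hnz]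
      conv_lhs => rw [← Complex.norm_mul_exp_arg_mul_I z]
      rw [map_mul, ← Complex.exp_conj]
      simp [mul_comm]
    rw [e, Complex.log_exp] <;> simp <;> linarith [Real.pi_pos]
  have l2 : Complex.log (w / conj w) = phase w * Complex.I := by
    rw [phase_eq hre]
    linear_combination Complex.log (w / conj w) * Complex.I_mul_I
  rw [u₀, hcw, hcz, hn, Complex.cpow_def_of_ne_zero, Complex.cpow_def_of_ne_zero, l1, l2,
    ← Complex.exp_add, angle₀, ← hz, ← hw]
  · congr 1; push_cast; ring
  · exact div_ne_zero hw0 (by simpa using hw0)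
  · exact div_ne_zero (by simpa using hz0) hnz

/-- The Wigner rotation angle of a boost along the edge-orthogonal direction of the standard wedge
is a coboundary, which the intertwiner of the standard wedge trivialises. -/
theorem angle₀_boost {L : CoverLorentz} (hγ : L.γ.im = 0) (hω : L.ω = 0) {p : V}
    (hp : p ∈ massShell P.mass) :
    wigner P.mass L p = P.angle₀ (L⁻¹.act p) - P.angle₀ p := by
  have hm := P.mass_pos
  have hp' := act_mem_massShell hm L⁻¹ hp
  set p' := L⁻¹.act p with hp'def
  have hpp : p = L.act p' := (L.act_act_inv p).symm
  obtain ⟨g, hg⟩ : ∃ g : ℝ, L.γ = g := ⟨L.γ.re, Complex.ext rfl (by simpa using hγ)⟩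
  have hg1 : |g| < 1 := by
    have := L.norm_lt; rw [hg, Complex.norm_real] at this; exact this
  have hD : 0 < 1 - g ^ 2 := by nlinarith [abs_lt.1 hg1, sq_abs g, abs_nonneg g]
  have hgb := abs_lt.1 hg1
  have e0 : p 0 = ((1 + g ^ 2) * p' 0 + 2 * g * p' 1) / (1 - g ^ 2) := by
    conv_lhs => rw [hpp, CoverLorentz.act_apply_zero]
    simp [hg]; ring
  have e1 : p 1 = (2 * g * p' 0 + (1 + g ^ 2) * p' 1) / (1 - g ^ 2) := by
    conv_lhs => rw [hpp, CoverLorentz.act_apply_one]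
    simp [hg, hω, CoverLorentz.auxRe, CoverLorentz.auxIm]
  have e2 : p 2 = p' 2 := by
    conv_lhs => rw [hpp, CoverLorentz.act_apply_two]
    simp [hg, hω, CoverLorentz.auxRe, CoverLorentz.auxIm]
    field_simp
  set b := boostParam P.mass p with hb
  set b' := boostParam P.mass p' with hb'
  have hbn : ‖b‖ < 1 := norm_boostParam_lt hm hp
  have hbn' : ‖b'‖ < 1 := norm_boostParam_lt hm hp'
  have hpm : 0 < p 0 + P.mass := by linarith [hp.1]
  have hpm' : 0 < p' 0 + P.mass := by linarith [hp'.1]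
  have hpmC : (p 0 + P.mass : ℂ) ≠ 0 := by exact_mod_cast hpm.ne'
  have hpmC' : (p' 0 + P.mass : ℂ) ≠ 0 := by exact_mod_cast hpm'.ne'
  have hshell := hp'.2
  simp only [mdot] at hshell
  -- the Möbius transformation by which the boost acts on velocities
  have hmob : b * (1 + g * b') = b' + g := by
    have h1 : b * (p 0 + P.mass) = p 1 + p 2 * Complex.I := by
      rw [hb, boostParam, div_mul_cancel₀ _ hpmC]
    have h2 : b' * (p' 0 + P.mass) = p' 1 + p' 2 * Complex.I := by
      rw [hb', boostParam, div_mul_cancel₀ _ hpmC']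
    have hDC : (1 - (g : ℂ) ^ 2) ≠ 0 := by exact_mod_cast hD.ne'
    have e0' : (1 - (g : ℂ) ^ 2) * p 0 = (1 + g ^ 2) * p' 0 + 2 * g * p' 1 := by
      rw [e0]; push_cast; field_simp
    have e1' : (1 - (g : ℂ) ^ 2) * p 1 = 2 * g * p' 0 + (1 + g ^ 2) * p' 1 := by
      rw [e1]; push_cast; field_simp
    have hs : (p' 0 : ℂ) * p' 0 - p' 1 * p' 1 - p' 2 * p' 2 = P.mass ^ 2 := by
      exact_mod_cast hshell
    apply mul_left_cancel₀ (mul_ne_zero (mul_ne_zero hDC hpmC) hpmC')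
    have e2' : (p 2 : ℂ) = p' 2 := by rw [e2]
    rw [e2'] at h1
    linear_combination (1 - (g : ℂ) ^ 2) * (p' 0 + P.mass + g * (p' 1 + p' 2 * Complex.I)) * h1 +
      (1 - (g : ℂ) ^ 2) * (b * (p 0 + P.mass) * g - (p 0 + P.mass)) * h2 +
      (p' 0 + P.mass + g * (p' 1 + p' 2 * Complex.I)) * e1' -
      (g * (p' 0 + P.mass) + p' 1 + p' 2 * Complex.I) * e0' +
      (g - g ^ 3) * hs + (1 - (g : ℂ) ^ 2) * g * p' 2 ^ 2 * Complex.I_sq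
  have hgg : ‖(g : ℂ) * b'‖ < 1 := by
    rw [norm_mul, Complex.norm_real, Real.norm_eq_abs]
    nlinarith [norm_nonneg b', abs_nonneg g]
  have hgg2 : ‖(g : ℂ) * b‖ < 1 := by
    rw [norm_mul, Complex.norm_real, Real.norm_eq_abs]
    nlinarith [norm_nonneg b, abs_nonneg g]
  have r1 : 0 < (1 - b * g).re := by
    have := CoverLorentz.one_add_re_pos (z := -(g * b)) (by rwa [norm_neg])
    rwa [← sub_eq_add_neg, mul_comm] at this
  have n1 : (1 - b * g) ≠ 0 := by intro h; rw [h] at r1; simp at r1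
  have hquot : (g - b) / (1 - b * g) = -b' := by
    rw [div_eq_iff n1]; linear_combination -hmob
  have hb'2 : 0 < 1 - ‖b'‖ ^ 2 := by nlinarith [norm_nonneg b']
  have second : 1 + (g - b) / (1 - b * g) * conj b' = ((1 - ‖b'‖ ^ 2 : ℝ) : ℂ) := by
    rw [hquot, neg_mul, Complex.mul_conj']; push_cast; ring
  have hwig : wigner P.mass L p = phase (1 - b * g) := by
    rw [wigner, hω, hg, ← hp'def, ← hb, ← hb']
    simp only [Complex.conj_ofReal, Complex.ofReal_zero, zero_mul, neg_zero, Complex.exp_zero,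
      mul_one, zero_add]
    rw [second, phase, phase, Complex.arg_ofReal_of_nonneg hb'2.le]
    simp
  have ang (q : V) (hq : q ∈ massShell P.mass) (c : ℂ) (hc : boostParam P.mass q = c) :
      phase (q 0 + P.mass - q 1 + q 2 * Complex.I) = -phase (1 - c) := by
    have hqm : 0 < q 0 + P.mass := by linarith [hq.1]
    have hcn : ‖c‖ < 1 := hc ▸ norm_boostParam_lt hm hq
    have hr : 0 < (1 - c).re := by
      have := CoverLorentz.one_add_re_pos (z := -c) (by rwa [norm_neg])
      rwa [← sub_eq_add_neg] at this
    rw [← phase_conj hr, ← phase_real_mul hqm (conj (1 - c))]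
    congr 1
    have hq0 : (q 0 + P.mass : ℂ) ≠ 0 := by exact_mod_cast hqm.ne'
    have : conj c * (q 0 + P.mass) = q 1 - q 2 * Complex.I := by
      have h2 : c * (q 0 + P.mass) = q 1 + q 2 * Complex.I := by
        rw [← hc, boostParam, div_mul_cancel₀ _ hq0]
      simpa [sub_eq_add_neg] using congrArg conj h2
    rw [map_sub, map_one]; push_cast; linear_combination this
  have hr : 0 < (1 - b).re := by
    have := CoverLorentz.one_add_re_pos (z := -b) (by rwa [norm_neg])
    rwa [← sub_eq_add_neg] at this
  have hr' : 0 < (1 - b').re := by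
    have := CoverLorentz.one_add_re_pos (z := -b') (by rwa [norm_neg])
    rwa [← sub_eq_add_neg] at this
  rw [hwig, angle₀, angle₀, ang p hp b rfl, ang p' hp' b' rfl, e2]
  have key : phase (1 - b * g) + phase (1 - b') = phase (1 - b) := by
    rw [← CoverLorentz.phase_mul r1 hr']
    have : (1 - b * g) * (1 - b') = ((1 + g : ℝ) : ℂ) * (1 - b) := by
      push_cast; linear_combination hmob
    rw [this, phase_real_mul (by linarith)]
  linarith

/-- The intertwiner of the standard wedge is invariant under the boosts which preserve the
wedge. -/
theorem boostedIntertwiner_boost {L : CoverLorentz} (hγ : L.γ.im = 0) (hω : L.ω = 0) {p : V}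
    (hp : p ∈ massShell P.mass) : P.boostedIntertwiner L p = P.u₀ p := by
  rw [boostedIntertwiner, P.u₀_eq hp, P.u₀_eq (act_mem_massShell P.mass_pos _ hp),
    ← Complex.exp_add, P.angle₀_boost hγ hω hp]
  congr 1; push_cast; ring

theorem boostedIntertwiner_mul (L L' : CoverLorentz) {p : V} (hp : p ∈ massShell P.mass) :
    P.boostedIntertwiner (L * L') p =
      Complex.exp (-(Complex.I * (P.spin * wigner P.mass L p : ℝ))) *
        P.boostedIntertwiner L' (L⁻¹.act p) := by
  rw [boostedIntertwiner, boostedIntertwiner, wigner_mul P.mass_pos L L' hp, mul_inv_rev,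
    CoverLorentz.act_mul, ← mul_assoc, ← Complex.exp_add]
  congr 2; push_cast; ring

theorem norm_boostedIntertwiner (L : CoverLorentz) {p : V} (hp : p ∈ massShell P.mass) :
    ‖P.boostedIntertwiner L p‖ = 1 := by
  rw [boostedIntertwiner, P.u₀_eq (act_mem_massShell P.mass_pos _ hp), ← Complex.exp_add,
    Complex.norm_exp]
  simp

/-- The two intertwiners of the standard wedge and of its causal complement coincide up to a
constant phase; for `u₀` this means invariance under the reflection of `p₁` and `p₂`. -/
theorem u₀_reflect {p : V} (hp : p ∈ massShell P.mass) : P.u₀ ![p 0, -p 1, -p 2] = P.u₀ p := by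
  have hm := P.mass_pos
  have hp' : ![p 0, -p 1, -p 2] ∈ massShell P.mass :=
    ⟨hp.1, by simpa [mdot] using hp.2⟩
  rw [P.u₀_eq hp, P.u₀_eq hp']
  congr 3
  have r1 := P.re_pos_aux hp
  have r2 := P.re_pos_aux hp'
  simp only [angle₀, Matrix.cons_val_zero, Matrix.cons_val_one, Matrix.cons_val] at r2 ⊢
  set w : ℂ := p 0 + P.mass - p 1 + p 2 * Complex.I with hw
  set z : ℂ := P.mass + p 2 * Complex.I with hz
  have hzre : 0 < z.re := by simp [hz, hm]
  set w' : ℂ := p 0 + P.mass + p 1 + p 2 * Complex.I with hw'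
  have ew : (p 0 + P.mass - (-p 1 : ℝ) + (-p 2 : ℝ) * Complex.I : ℂ) = conj w' := by
    simp [hw']
  have ez : (P.mass + (-p 2 : ℝ) * Complex.I : ℂ) = conj z := by simp [hz]
  have r3 : 0 < w'.re := by rw [ew] at r2; simpa using r2
  have hs := hp.2
  simp only [mdot] at hs
  have hprod : w * w' = ((2 * (p 0 + P.mass) : ℝ) : ℂ) * z := by
    have hsC : (p 0 : ℂ) * p 0 - p 1 * p 1 - p 2 * p 2 = P.mass ^ 2 := by exact_mod_cast hs
    rw [hw, hw', hz]; push_cast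
    linear_combination hsC + (p 2 : ℂ) ^ 2 * Complex.I_sq
  have h1 := CoverLorentz.phase_mul r1 r3
  rw [hprod, phase_real_mul (by linarith [hp.1])] at h1
  have h2 : (conj z).arg = -z.arg := by
    have := phase_conj hzre
    simp only [phase] at this; linarith
  rw [ew, ez, h2, phase_conj r3]
  simp only [phase] at h1 ⊢
  linear_combination P.spin * h1

/-- Rotating a wedge by an odd multiple of `π` multiplies the intertwiner by a constant. -/
theorem boostedIntertwiner_mul_rot (L : CoverLorentz) {k : ℤ} (hk : Odd k) {p : V}
    (hp : p ∈ massShell P.mass) :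
    P.boostedIntertwiner (L * CoverLorentz.rot (k * Real.pi)) p =
      Complex.exp (-(Complex.I * (P.spin * (k * Real.pi) : ℝ))) * P.boostedIntertwiner L p := by
  have hp' := act_mem_massShell P.mass_pos L⁻¹ hp
  rw [P.boostedIntertwiner_mul _ _ hp, boostedIntertwiner, wigner_rot P.mass_pos _ hp',
    boostedIntertwiner]
  have hrot : (CoverLorentz.rot (k * Real.pi))⁻¹.act (L⁻¹.act p) =
      ![L⁻¹.act p 0, -L⁻¹.act p 1, -L⁻¹.act p 2] := by
    obtain ⟨j, rfl⟩ := hk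
    have hc : Real.cos (-(((2 * j + 1 : ℤ) : ℝ) * Real.pi)) = -1 := by
      rw [Real.cos_neg]; push_cast
      rw [show (2 * (j : ℝ) + 1) * Real.pi = Real.pi + j * (2 * Real.pi) by ring,
        Real.cos_add_int_mul_two_pi, Real.cos_pi]
    have hs : Real.sin (-(((2 * j + 1 : ℤ) : ℝ) * Real.pi)) = 0 := by
      rw [Real.sin_neg, Real.sin_int_mul_pi, neg_zero]
    rw [CoverLorentz.rot_inv, CoverLorentz.rot_act, hc, hs]
    simp
  rw [hrot, P.u₀_reflect hp']
  ring

/-! ### The deformation matrices -/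

theorem boostedMatrix_mul (L L' : CoverLorentz) :
    P.boostedMatrix (L * L') = L.toMatrix * P.boostedMatrix L' * L⁻¹.toMatrix := by
  rw [boostedMatrix, boostedMatrix, mul_inv_rev, CoverLorentz.toMatrix_mul,
    CoverLorentz.toMatrix_mul]
  simp only [Matrix.mul_assoc]

theorem Q₀_mulVec (x : V) : P.Q₀.mulVec x = ![P.kappa * x 1, P.kappa * x 0, 0] := by
  ext i; fin_cases i <;> simp [Q₀, Matrix.mulVec, dotProduct, Fin.sum_univ_three]

theorem boostedMatrix_mulVec (L : CoverLorentz) (x : V) :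
    (P.boostedMatrix L).mulVec x = L.act (P.Q₀.mulVec (L⁻¹.act x)) := by
  rw [boostedMatrix, ← Matrix.mulVec_mulVec, ← Matrix.mulVec_mulVec]; rfl

theorem matrix_ext {M N : Matrix (Fin 3) (Fin 3) ℝ} (h : ∀ x, M.mulVec x = N.mulVec x) : M = N :=
  Matrix.toLin'.injective (LinearMap.ext fun x => by
    rw [Matrix.toLin'_apply, Matrix.toLin'_apply, h])

theorem boostedMatrix_boost {L : CoverLorentz} (hγ : L.γ.im = 0) (hω : L.ω = 0) :
    P.boostedMatrix L = P.Q₀ := by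
  have h : L.toMatrix * P.Q₀ = P.Q₀ * L.toMatrix := by
    apply matrix_ext
    intro x
    rw [← Matrix.mulVec_mulVec, ← Matrix.mulVec_mulVec]
    change L.act _ = P.Q₀.mulVec (L.act x)
    rw [Q₀_mulVec, Q₀_mulVec]
    ext i; fin_cases i
    · simp [CoverLorentz.act_apply_zero, CoverLorentz.act_apply_one, hγ, hω, CoverLorentz.auxRe,
        CoverLorentz.auxIm]
      ring
    · simp [CoverLorentz.act_apply_zero, CoverLorentz.act_apply_one, hγ, hω, CoverLorentz.auxRe,
        CoverLorentz.auxIm]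
      ring
    · simp [CoverLorentz.act_apply_two, hγ, hω, CoverLorentz.auxRe, CoverLorentz.auxIm]
  rw [boostedMatrix, h, Matrix.mul_assoc, CoverLorentz.mul_inv_toMatrix, Matrix.mul_one]

theorem boostedMatrix_mul_rot (L : CoverLorentz) {k : ℤ} (hk : Odd k) :
    P.boostedMatrix (L * CoverLorentz.rot (k * Real.pi)) = -P.boostedMatrix L := by
  have h : P.boostedMatrix (CoverLorentz.rot (k * Real.pi)) = -P.Q₀ := by
    obtain ⟨j, rfl⟩ := hk
    have hc : Real.cos (((2 * j + 1 : ℤ) : ℝ) * Real.pi) = -1 := by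
      push_cast
      rw [show (2 * (j : ℝ) + 1) * Real.pi = Real.pi + j * (2 * Real.pi) by ring,
        Real.cos_add_int_mul_two_pi, Real.cos_pi]
    have hs : Real.sin (((2 * j + 1 : ℤ) : ℝ) * Real.pi) = 0 := Real.sin_int_mul_pi _
    apply matrix_ext
    intro x
    rw [boostedMatrix_mulVec, CoverLorentz.rot_inv, CoverLorentz.rot_act, CoverLorentz.rot_act,
      Q₀_mulVec, Real.sin_neg, Real.cos_neg, hc, hs, Matrix.neg_mulVec, Q₀_mulVec]
    ext i; fin_cases i <;> simp
  rw [boostedMatrix_mul, h]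
  simp [boostedMatrix]

theorem mdot_Q₀ (x y : V) :
    mdot (P.Q₀.mulVec x) y = P.kappa * (x 1 * y 0 - x 0 * y 1) := by
  rw [Q₀_mulVec]; simp [mdot]; ring

/-- `Λ Q₀ Λ⁻¹` is skew with respect to the Lorentz product. -/
theorem mdot_boostedMatrix_skew (L : CoverLorentz) (x y : V) :
    mdot ((P.boostedMatrix L).mulVec x) y = -mdot ((P.boostedMatrix L).mulVec y) x := by
  rw [boostedMatrix_mulVec, boostedMatrix_mulVec, CoverLorentz.mdot_act_left,
    CoverLorentz.mdot_act_left, mdot_Q₀, mdot_Q₀]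
  ring

end Model

/-! ### The action of the covering group on paths of wedges -/

/-- The straight line between two elements of the covering group, in the coordinates `(γ, ω)`. -/
def CoverLorentz.interp (s : unitInterval) (a b : CoverLorentz) : CoverLorentz :=
  ⟨(1 - s : ℝ) * a.γ + (s : ℝ) * b.γ, (1 - s) * a.ω + s * b.ω, by
    have hs0 := s.2.1
    have hs1 := s.2.2
    have h := (convex_ball (0 : ℂ) 1) (show a.γ ∈ _ by simpa using a.norm_lt)
      (show b.γ ∈ _ by simpa using b.norm_lt) (show 0 ≤ 1 - (s : ℝ) by linarith) hs0 (by ring)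
    simpa using h⟩

/-- The covering group is simply connected: the image of a path of spacelike directions under a
path in the covering group depends, up to homotopy, only on the endpoint of the latter. -/
theorem homotopicWith_act_path {W : Set V} {e : C(unitInterval, V)} (he : IsPathInto W e)
    {g g' : unitInterval → CoverLorentz} {L : CoverLorentz} (E E' : C(unitInterval, V))
    (hE : ∀ t, E t = (g t).act (e t)) (hE' : ∀ t, E' t = (g' t).act (e t))
    (hγ : Continuous fun t => (g t).γ) (hω : Continuous fun t => (g t).ω)
    (hγ' : Continuous fun t => (g' t).γ) (hω' : Continuous fun t => (g' t).ω)
    (h0 : g 0 = 1) (h0' : g' 0 = 1) (h1 : g 1 = L) (h1' : g' 1 = L) :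
    ContinuousMap.HomotopicWith E E' (IsPathInto (L.act '' W)) := by
  -- the straight lines between `g t` and `g' t` deform one path into the other
  refine ⟨{ toFun := fun x => (CoverLorentz.interp x.1 (g x.2) (g' x.2)).act (e x.2),
            continuous_toFun := ?_, map_zero_left := ?_, map_one_left := ?_, prop' := ?_ }⟩
  · refine CoverLorentz.continuous_act ?_ ?_ (by fun_prop)
    · simp only [CoverLorentz.interp]
      have := hγ.comp (continuous_snd (X := unitInterval) (Y := unitInterval))
      have := hγ'.comp (continuous_snd (X := unitInterval) (Y := unitInterval))
      fun_prop
    · simp only [CoverLorentz.interp]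
      have := hω.comp (continuous_snd (X := unitInterval) (Y := unitInterval))
      have := hω'.comp (continuous_snd (X := unitInterval) (Y := unitInterval))
      fun_prop
  · intro t; rw [hE]; congr 1
    ext <;> simp [CoverLorentz.interp]
  · intro t; rw [hE']; congr 1
    ext <;> simp [CoverLorentz.interp]
  · intro s
    refine ⟨fun t => ?_, ?_, ?_⟩
    · exact (CoverLorentz.mdot_act _ _ _).trans (he.1 t)
    · change (CoverLorentz.interp s (g 0) (g' 0)).act (e 0) = _
      have : CoverLorentz.interp s (g 0) (g' 0) = 1 := by
        rw [h0, h0']; ext <;> simp [CoverLorentz.interp, CoverLorentz.one_γ, CoverLorentz.one_ω]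
      rw [this, he.2.1, CoverLorentz.one_act]
    · change (CoverLorentz.interp s (g 1) (g' 1)).act (e 1) ∈ _
      have : CoverLorentz.interp s (g 1) (g' 1) = L := by
        rw [h1, h1']
        ext
        · simp only [CoverLorentz.interp]; push_cast; ring
        · simp only [CoverLorentz.interp]; ring
      rw [this]
      exact ⟨_, he.2.2, rfl⟩

theorem CoverLorentz.pathTo_zero (L : CoverLorentz) : L.pathTo 0 = 1 := by
  ext <;> simp [CoverLorentz.pathTo] <;> rfl

theorem CoverLorentz.pathTo_one (L : CoverLorentz) : L.pathTo 1 = L := by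
  ext <;> simp [CoverLorentz.pathTo]

theorem CoverLorentz.continuous_pathTo_γ (L : CoverLorentz) :
    Continuous fun t => (L.pathTo t).γ := by
  simp only [CoverLorentz.pathTo]; fun_prop

theorem CoverLorentz.continuous_pathTo_ω (L : CoverLorentz) :
    Continuous fun t => (L.pathTo t).ω := by
  simp only [CoverLorentz.pathTo]; fun_prop

theorem CoverLorentz.one_add_ne_zero (a b : CoverLorentz) :
    (1 + a.γ * conj b.γ * Complex.exp (-(b.ω * Complex.I))) ∈ Complex.slitPlane :=
  Or.inl (CoverLorentz.one_add_re_pos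
    (CoverLorentz.norm_aux a.γ b.γ b.ω a.norm_lt b.norm_lt))

theorem CoverLorentz.continuous_mul {g g' : unitInterval → CoverLorentz}
    (hγ : Continuous fun t => (g t).γ) (hω : Continuous fun t => (g t).ω)
    (hγ' : Continuous fun t => (g' t).γ) (hω' : Continuous fun t => (g' t).ω) :
    (Continuous fun t => (g t * g' t).γ) ∧ Continuous fun t => (g t * g' t).ω := by
  have hc : Continuous fun t => conj (g' t).γ := Complex.continuous_conj.comp hγ'
  have hn : Continuous fun t => 1 + (g t).γ * conj (g' t).γ *
      Complex.exp (-((g' t).ω * Complex.I)) := by fun_prop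
  constructor
  · simp only [CoverLorentz.mul_γ]
    refine Continuous.div (by fun_prop) hn fun t => ?_
    exact Complex.slitPlane_ne_zero (CoverLorentz.one_add_ne_zero _ _)
  · simp only [CoverLorentz.mul_ω, phase]
    refine (hω.add hω').add (continuous_const.mul ?_)
    refine continuous_iff_continuousAt.2 fun t => ?_
    exact ContinuousAt.comp (f := fun t => 1 + (g t).γ * conj (g' t).γ *
      Complex.exp (-((g' t).ω * Complex.I)))
      (Complex.continuousAt_arg (CoverLorentz.one_add_ne_zero (g t) (g' t))) hn.continuousAt

instance : MulAction CoverLorentz PathOfWedges where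
  one_smul W := by
    induction W using Quotient.inductionOn with | _ a => ?_
    refine Quotient.sound ⟨?_, ?_⟩
    · change (fun x => CoverLorentz.act 1 x) '' a.wedge = a.wedge
      simp [CoverLorentz.one_act]
    · have hp : actPath 1 a.path = a.path := by
        ext1 t
        change (CoverLorentz.pathTo 1 t).act (a.path t) = _
        have : CoverLorentz.pathTo 1 t = 1 := by
          ext <;> simp [CoverLorentz.pathTo, CoverLorentz.one_γ, CoverLorentz.one_ω]
        rw [this, CoverLorentz.one_act]
      change ContinuousMap.HomotopicWith (actPath 1 a.path) a.path
        (IsPathInto (CoverLorentz.act 1 '' a.wedge))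
      rw [hp]
      refine .refl _ ?_
      have := a.isPathInto.actPath 1
      rwa [hp] at this
  mul_smul L L' W := by
    induction W using Quotient.inductionOn with | _ a => ?_
    refine Quotient.sound ⟨?_, ?_⟩
    · change (L * L').act '' a.wedge = L.act '' (L'.act '' a.wedge)
      rw [Set.image_image]
      exact Set.image_congr fun x _ => CoverLorentz.act_mul L L' x
    · have hc := CoverLorentz.continuous_mul L.continuous_pathTo_γ L.continuous_pathTo_ω
        L'.continuous_pathTo_γ L'.continuous_pathTo_ω
      refine homotopicWith_act_path (L := L * L') (g := (L * L').pathTo)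
        (g' := fun t => L.pathTo t * L'.pathTo t) a.isPathInto _ _
        (fun t => rfl) (fun t => ?_) (CoverLorentz.continuous_pathTo_γ _)
        (CoverLorentz.continuous_pathTo_ω _) hc.1 hc.2 (CoverLorentz.pathTo_zero _) ?_
        (CoverLorentz.pathTo_one _) ?_
      · exact (CoverLorentz.act_mul _ _ _).symm
      · simp [CoverLorentz.pathTo_zero]
      · simp [CoverLorentz.pathTo_one]

theorem wedge_smul (L : CoverLorentz) (W : PathOfWedges) : (L • W).wedge = L.act '' W.wedge := by
  induction W using Quotient.inductionOn with | _ a => rfl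

theorem wedge_standardPath : standardPath.wedge = standardWedge := rfl

/-! ### Angles of spacelike directions -/

/-- The spacelike direction with time component `x` and angle `θ`. -/
def dirOf (x θ : ℝ) : V := ![x, √(1 + x ^ 2) * Real.cos θ, √(1 + x ^ 2) * Real.sin θ]

theorem mdot_dirOf (x θ : ℝ) : mdot (dirOf x θ) (dirOf x θ) = -1 := by
  have h := Real.mul_self_sqrt (show 0 ≤ 1 + x ^ 2 by positivity)
  simp only [mdot, dirOf, Matrix.cons_val_zero, Matrix.cons_val_one, Matrix.cons_val]
  linear_combination -(1 + x ^ 2) * Real.sin_sq_add_cos_sq θ -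
    (Real.sin θ ^ 2 + Real.cos θ ^ 2) * h

theorem continuous_dirOf {X : Type*} [TopologicalSpace X] {f g : X → ℝ} (hf : Continuous f)
    (hg : Continuous g) : Continuous fun t => dirOf (f t) (g t) := by
  refine continuous_pi fun i => ?_
  fin_cases i
  · exact hf
  · change Continuous fun t => √(1 + f t ^ 2) * Real.cos (g t); fun_prop
  · change Continuous fun t => √(1 + f t ^ 2) * Real.sin (g t); fun_prop

theorem dirOf_mem_standardWedge {x θ : ℝ} :
    dirOf x θ ∈ standardWedge ↔ |x| < √(1 + x ^ 2) * Real.cos θ := Iff.rfl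

theorem rot_act_dirOf (ω x θ : ℝ) : (CoverLorentz.rot ω).act (dirOf x θ) = dirOf x (θ + ω) := by
  rw [CoverLorentz.rot_act]
  simp only [dirOf, Matrix.cons_val_zero, Matrix.cons_val_one, Matrix.cons_val, Real.cos_add,
    Real.sin_add]
  ext i; fin_cases i
  · rfl
  · simp; ring
  · simp; ring

/-- The spatial direction of a spacelike unit vector. -/
def dirCircle (e : {e : V // mdot e e = -1}) : Circle :=
  ⟨(e.1 1 + e.1 2 * Complex.I) / (√(1 + e.1 0 ^ 2) : ℝ), by
    have h := e.2
    simp only [mdot] at h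
    have hp : 0 < √(1 + e.1 0 ^ 2) := Real.sqrt_pos.2 (by positivity)
    rw [← SetLike.mem_coe, Submonoid.coe_unitSphere, mem_sphere_zero_iff_norm, norm_div,
      Complex.norm_real, Real.norm_of_nonneg hp.le, div_eq_one_iff_eq hp.ne', Complex.norm_def,
      Complex.normSq_apply]
    congr 1
    simp
    linarith⟩

theorem continuous_dirCircle : Continuous dirCircle := by
  have h (i : Fin 3) : Continuous fun e : {e : V // mdot e e = -1} => e.1 i :=
    (continuous_apply i).comp continuous_subtype_val
  refine Continuous.subtype_mk (Continuous.div ?_ ?_ ?_) _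
  · exact (Complex.continuous_ofReal.comp (h 1)).add
      ((Complex.continuous_ofReal.comp (h 2)).mul continuous_const)
  · exact Complex.continuous_ofReal.comp
      (Real.continuous_sqrt.comp (continuous_const.add ((h 0).pow 2)))
  · intro e
    have hp : 0 < √(1 + e.1 0 ^ 2) := Real.sqrt_pos.2 (by positivity)
    exact_mod_cast hp.ne'

theorem eq_dirOf_of_exp {e : {e : V // mdot e e = -1}} {θ : ℝ} (h : Circle.exp θ = dirCircle e) :
    e.1 = dirOf (e.1 0) θ := by
  have hp : 0 < √(1 + e.1 0 ^ 2) := Real.sqrt_pos.2 (by positivity)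
  have h1 := congrArg (fun z : Circle => (z : ℂ)) h
  simp only [Circle.coe_exp, dirCircle] at h1
  have hpC : ((√(1 + e.1 0 ^ 2) : ℝ) : ℂ) ≠ 0 := by exact_mod_cast hp.ne'
  rw [eq_div_iff hpC] at h1
  have hr := congrArg Complex.re h1
  have hi := congrArg Complex.im h1
  simp [Complex.exp_ofReal_mul_I_re, Complex.exp_ofReal_mul_I_im] at hr hi
  ext i; fin_cases i
  · rfl
  · simp [dirOf]; linarith
  · simp [dirOf]; linarith

theorem dirCircle_dirOf (x θ : ℝ) : dirCircle ⟨dirOf x θ, mdot_dirOf x θ⟩ = Circle.exp θ := by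
  have hp : 0 < √(1 + x ^ 2) := Real.sqrt_pos.2 (by positivity)
  have hpC : ((√(1 + x ^ 2) : ℝ) : ℂ) ≠ 0 := by exact_mod_cast hp.ne'
  apply Circle.ext
  simp only [dirCircle, Circle.coe_exp]
  rw [div_eq_iff (by simpa [dirOf] using hpC)]
  simp only [dirOf, Matrix.cons_val_zero, Matrix.cons_val_one, Matrix.cons_val]
  rw [Complex.exp_mul_I, ← Complex.ofReal_cos, ← Complex.ofReal_sin]
  push_cast; ring

theorem refDir_eq : refDir = dirOf 0 (-(Real.pi / 2)) := by
  ext i; fin_cases i <;> simp [refDir, dirOf]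

/-- The angle along a family of paths of spacelike directions which start at the reference
direction. -/
theorem exists_angle {A : Type*} [TopologicalSpace A] (H : C(unitInterval × A, V))
    (h : ∀ x, mdot (H x) (H x) = -1) (h0 : ∀ a, H (0, a) = refDir) :
    ∃ Θ : C(unitInterval × A, ℝ), (∀ a, Θ (0, a) = -(Real.pi / 2)) ∧
      ∀ x, H x = dirOf (H x 0) (Θ x) := by
  have hcont : Continuous fun x => (⟨H x, h x⟩ : {e : V // mdot e e = -1}) :=
    H.continuous.subtype_mk _
  let c : C(unitInterval × A, Circle) := ⟨_, continuous_dirCircle.comp hcont⟩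
  have hstart : ∀ a, c (0, a) = Circle.exp (ContinuousMap.const A (-(Real.pi / 2)) a) := fun a => by
    rw [ContinuousMap.const_apply, ← dirCircle_dirOf 0]
    change dirCircle ⟨H (0, a), _⟩ = _
    congr 2
    rw [h0, refDir_eq]
  refine ⟨Circle.isCoveringMap_exp.liftHomotopy c (ContinuousMap.const A (-(Real.pi / 2))) hstart,
    fun a => Circle.isCoveringMap_exp.liftHomotopy_zero .., fun x => ?_⟩
  exact eq_dirOf_of_exp (e := ⟨H x, h x⟩)
    (congrFun (Circle.isCoveringMap_exp.liftHomotopy_lifts c _ hstart) x)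

/-- The angle along a path of spacelike directions is determined by its initial value. -/
theorem angle_unique {x : unitInterval → ℝ} {θ θ' : unitInterval → ℝ} (hθ : Continuous θ)
    (hθ' : Continuous θ') (h0 : θ 0 = θ' 0) (h : ∀ t, dirOf (x t) (θ t) = dirOf (x t) (θ' t)) :
    θ = θ' := by
  have hex : ∀ t, Circle.exp (θ t) = Circle.exp (θ' t) := fun t => by
    rw [← dirCircle_dirOf (x t), ← dirCircle_dirOf (x t)]
    congr 2
    exact h t
  exact Circle.isCoveringMap_exp.eq_of_comp_eq hθ hθ' (funext hex) 0 h0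

/-! ### Paths of wedges over the standard wedge -/

/-- Rotating a path by `r̃(ω)` adds `t ω` to the angle at time `t`. -/
theorem actPath_rot (ω : ℝ) (e : C(unitInterval, V)) (x θ : unitInterval → ℝ)
    (he : ∀ t, e t = dirOf (x t) (θ t)) (t : unitInterval) :
    actPath (CoverLorentz.rot ω) e t = dirOf (x t) (θ t + t * ω) := by
  change ((CoverLorentz.rot ω).pathTo t).act (e t) = _
  have : (CoverLorentz.rot ω).pathTo t = CoverLorentz.rot (t * ω) := by
    ext
    · simp [CoverLorentz.pathTo, CoverLorentz.rot]
    · simp [CoverLorentz.pathTo, CoverLorentz.rot]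
  rw [this, he, rot_act_dirOf]

theorem standard_path_eq (t : unitInterval) :
    (![0, Real.sin (Real.pi / 2 * t), -Real.cos (Real.pi / 2 * t)] : V) =
      dirOf 0 (-(Real.pi / 2) + Real.pi / 2 * t) := by
  have h1 : Real.cos (-(Real.pi / 2) + Real.pi / 2 * t) = Real.sin (Real.pi / 2 * t) := by
    rw [add_comm, ← sub_eq_add_neg, Real.cos_sub_pi_div_two]
  have h2 : Real.sin (-(Real.pi / 2) + Real.pi / 2 * t) = -Real.cos (Real.pi / 2 * t) := by
    rw [add_comm, ← sub_eq_add_neg, Real.sin_sub_pi_div_two]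
  ext i; fin_cases i
  · simp [dirOf]
  · simp [dirOf, h1]
  · simp [dirOf, h2]

theorem rot_two_pi_act (n : ℤ) (x : V) : (CoverLorentz.rot (2 * Real.pi * n)).act x = x := by
  have h1 : Real.cos (2 * Real.pi * n) = 1 := by
    rw [mul_comm]; exact Real.cos_int_mul_two_pi n
  have h2 : Real.sin (2 * Real.pi * n) = 0 := by
    rw [mul_comm, ← zero_add ((n : ℝ) * (2 * Real.pi)), Real.sin_add_int_mul_two_pi, Real.sin_zero]
  rw [CoverLorentz.rot_act, h1, h2]
  ext i; fin_cases i <;> simp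

/-- The part of the standard wedge on the hyperboloid is star shaped in the coordinates `(x, θ)`. -/
theorem dirOf_mem_standardWedge_smul {x δ s : ℝ} (hδ : |δ| < Real.pi / 2) (hs0 : 0 ≤ s)
    (hs1 : s ≤ 1) (h : dirOf x δ ∈ standardWedge) : dirOf (s * x) (s * δ) ∈ standardWedge := by
  rw [dirOf_mem_standardWedge] at h ⊢
  have hcos : Real.cos δ ≤ Real.cos (s * δ) := by
    rw [← Real.cos_abs δ, ← Real.cos_abs (s * δ), abs_mul, abs_of_nonneg hs0]
    exact Real.cos_le_cos_of_nonneg_of_le_pi (by positivity) (by linarith [Real.pi_pos])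
      (mul_le_of_le_one_left (abs_nonneg _) hs1)
  have hcpos : 0 < Real.cos δ := Real.cos_pos_of_mem_Ioo ⟨(abs_lt.1 hδ).1, (abs_lt.1 hδ).2⟩
  have hc1 : Real.cos δ ≤ 1 := Real.cos_le_one δ
  refine lt_of_lt_of_le ?_ (mul_le_mul_of_nonneg_left hcos (Real.sqrt_nonneg _))
  have h1 : x ^ 2 < (1 + x ^ 2) * Real.cos δ ^ 2 := by
    have := pow_lt_pow_left₀ h (abs_nonneg x) (two_ne_zero)
    rwa [sq_abs, mul_pow, Real.sq_sqrt (by positivity)] at this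
  apply lt_of_pow_lt_pow_left₀ 2 (by positivity)
  rw [sq_abs, mul_pow (√_), Real.sq_sqrt (by positivity)]
  have hs2 : s ^ 2 ≤ 1 := by nlinarith
  have hc2 : 0 < Real.cos δ ^ 2 := by positivity
  have hcc : Real.cos δ ^ 2 ≤ 1 := by nlinarith
  nlinarith [mul_nonneg (sq_nonneg s) (mul_nonneg (sq_nonneg x) (sub_nonneg.2 hcc)), sq_nonneg x,
    mul_nonneg (sq_nonneg x) (sub_nonneg.2 hcc)]

/-- A path of wedges over the standard wedge is obtained from the standard path by winding around
the hyperboloid of spacelike directions. -/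
theorem exists_eq_rot_smul {W : PathOfWedges} (hW : W.wedge = standardWedge) :
    ∃ n : ℤ, W = CoverLorentz.rot (2 * Real.pi * n) • standardPath := by
  induction W using Quotient.inductionOn with | _ a => ?_
  change a.wedge = standardWedge at hW
  obtain ⟨Θ, h0, hΘ⟩ := exists_angle (A := Unit) ⟨fun x => a.path x.1, by fun_prop⟩
    (fun x => a.isPathInto.1 x.1) (fun _ => a.isPathInto.2.1)
  set θ : unitInterval → ℝ := fun t => Θ (t, ()) with hθ
  have hθc : Continuous θ := by fun_prop
  have hpath : ∀ t, a.path t = dirOf (a.path t 0) (θ t) := fun t => hΘ (t, ())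
  have hend : dirOf (a.path 1 0) (θ 1) ∈ standardWedge := by
    rw [← hpath, ← hW]; exact a.isPathInto.2.2
  have hcos : 0 < Real.cos (θ 1) := by
    rw [dirOf_mem_standardWedge] at hend
    exact pos_of_mul_pos_right ((abs_nonneg _).trans_lt hend) (Real.sqrt_nonneg _)
  -- the winding number of the path
  set n : ℤ := round (θ 1 / (2 * Real.pi)) with hn
  set δ : ℝ := θ 1 - 2 * Real.pi * n with hδ
  have hδ1 : |δ| ≤ Real.pi := by
    have h := abs_sub_round (θ 1 / (2 * Real.pi))
    have : δ = 2 * Real.pi * (θ 1 / (2 * Real.pi) - n) := by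
      rw [hδ]; field_simp
    rw [this, abs_mul, abs_of_pos (by positivity)]
    nlinarith [Real.pi_pos]
  have hcosδ : Real.cos δ = Real.cos (θ 1) := by
    rw [hδ, mul_comm, Real.cos_sub_int_mul_two_pi]
  have hsinδ : Real.sin δ = Real.sin (θ 1) := by
    rw [hδ, mul_comm, Real.sin_sub_int_mul_two_pi]
  have hδ2 : |δ| < Real.pi / 2 := by
    by_contra hcon
    push Not at hcon
    have := Real.cos_nonpos_of_pi_div_two_le_of_le hcon (by linarith [Real.pi_pos])
    rw [Real.cos_abs, hcosδ] at this
    linarith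
  have hend' : dirOf (a.path 1 0) δ ∈ standardWedge := by
    rw [dirOf_mem_standardWedge] at hend ⊢; rwa [hcosδ]
  -- in the coordinates `(x, θ)` the two paths are joined by straight lines; their endpoints stay in
  -- the wedge because this is star shaped about the angle `2πn`
  refine ⟨n, Quotient.sound ⟨?_, ?_⟩⟩
  · change a.wedge = (CoverLorentz.rot (2 * Real.pi * n)).act '' standardWedge
    rw [hW, Set.image_congr fun x _ => rot_two_pi_act n x, Set.image_id']
  · refine ⟨{ toFun := fun x => dirOf ((1 - (x.1 : ℝ)) * a.path x.2 0)
                ((1 - (x.1 : ℝ)) * θ x.2 +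
                  x.1 * (-(Real.pi / 2) + Real.pi / 2 * x.2 + x.2 * (2 * Real.pi * n))),
              continuous_toFun := ?_, map_zero_left := ?_, map_one_left := ?_, prop' := ?_ }⟩
    · refine continuous_dirOf ?_ ?_
      · have : Continuous fun x : unitInterval × unitInterval => a.path x.2 0 :=
          (continuous_apply 0).comp (by fun_prop)
        fun_prop
      · fun_prop
    · intro t; simp; exact (hpath t).symm
    · intro t
      refine Eq.trans ?_ (actPath_rot _ _ (fun _ => 0) _ standard_path_eq t).symm
      simp
    · intro s
      refine ⟨fun t => mdot_dirOf _ _, ?_, ?_⟩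
      · have e1 : a.path 0 0 = 0 := by rw [a.isPathInto.2.1]; rfl
        have e2 : θ 0 = -(Real.pi / 2) := h0 ()
        simp [e1, e2]
        rw [refDir_eq]; congr 1; ring
      · simp only [ContinuousMap.coe_mk, hW]
        have : (1 - (s : ℝ)) * θ 1 + s * (-(Real.pi / 2) + Real.pi / 2 * ((1 : unitInterval) : ℝ) +
            ((1 : unitInterval) : ℝ) * (2 * Real.pi * n)) = (1 - s) * δ + n * (2 * Real.pi) := by
          rw [hδ]; simp; ring
        rw [this]
        have h := dirOf_mem_standardWedge_smul (s := 1 - s) hδ2 (by linarith [s.2.2])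
          (by linarith [s.2.1]) hend'
        rw [dirOf_mem_standardWedge] at h ⊢
        rwa [Real.cos_add_int_mul_two_pi]

/-- A path from the reference direction into the standard wedge which winds around the hyperboloid
is not homotopic to the standard one. -/
theorem winding_eq_zero {n : ℤ} (H : C(unitInterval × unitInterval, V))
    (hmd : ∀ s t, mdot (H (s, t)) (H (s, t)) = -1) (hst : ∀ s, H (s, 0) = refDir)
    (hin : ∀ s, H (s, 1) ∈ standardWedge)
    (hA : ∀ t : unitInterval, H (0, t) =
      dirOf 0 (-(Real.pi / 2) + Real.pi / 2 * t + t * (2 * Real.pi * n)))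
    (hB : ∀ t : unitInterval, H (1, t) = dirOf 0 (-(Real.pi / 2) + Real.pi / 2 * t)) : n = 0 := by
  obtain ⟨Θ, h0, hΘ⟩ := exists_angle (A := unitInterval) ⟨fun x => H (x.2, x.1), by fun_prop⟩
    (fun x => hmd x.2 x.1) (fun s => hst s)
  have hend : ∀ s, 0 < Real.cos (Θ (1, s)) := fun s => by
    have h1 : H (s, 1) ∈ standardWedge := hin s
    have h2 : H (s, 1) = dirOf (H (s, 1) 0) (Θ (1, s)) := hΘ (1, s)
    rw [h2, dirOf_mem_standardWedge] at h1
    exact pos_of_mul_pos_right ((abs_nonneg _).trans_lt h1) (Real.sqrt_nonneg _)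
  have hΘ0 : Θ (1, 0) = 2 * Real.pi * n := by
    have := angle_unique (x := fun _ => 0) (θ := fun t => Θ (t, 0))
      (θ' := fun t => -(Real.pi / 2) + Real.pi / 2 * t + t * (2 * Real.pi * n)) (by fun_prop)
      (by fun_prop) (by simp [h0]) fun t => by
        rw [← hA]
        have h2 : H (0, t) = dirOf (H (0, t) 0) (Θ (t, 0)) := hΘ (t, 0)
        rw [h2]; rw [hA t]; rfl
    have h1 := congrFun this 1
    simp at h1
    exact h1
  have hΘ1 : Θ (1, 1) = 0 := by
    have := angle_unique (x := fun _ => 0) (θ := fun t => Θ (t, 1))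
      (θ' := fun t => -(Real.pi / 2) + Real.pi / 2 * t) (by fun_prop)
      (by fun_prop) (by simp [h0]) fun t => by
        rw [← hB]
        have h2 : H (1, t) = dirOf (H (1, t) 0) (Θ (t, 1)) := hΘ (t, 1)
        rw [h2]; rw [hB t]; rfl
    have h1 := congrFun this 1
    simp at h1
    exact h1
  -- otherwise the angle of the endpoint would pass through an odd multiple of `π`
  by_contra hn
  have hc : Continuous fun s => Θ (1, s) := by fun_prop
  have hconn := isPreconnected_univ (α := unitInterval).image _ hc.continuousOn
  have h00 : (0 : ℝ) ∈ (fun s => Θ (1, s)) '' Set.univ := ⟨1, trivial, hΘ1⟩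
  have h01 : (2 * Real.pi * n : ℝ) ∈ (fun s => Θ (1, s)) '' Set.univ := ⟨0, trivial, hΘ0⟩
  rcases lt_or_gt_of_ne hn with hn | hn
  · have hn' : (n : ℝ) ≤ -1 := by exact_mod_cast Int.le_sub_one_of_lt hn
    have hπ : -Real.pi ∈ Set.Icc (2 * Real.pi * n) 0 :=
      ⟨by nlinarith [Real.pi_pos], by linarith [Real.pi_pos]⟩
    obtain ⟨s, -, hs⟩ := hconn.Icc_subset h01 h00 hπ
    have := hend s
    simp only at hs
    rw [hs, Real.cos_neg, Real.cos_pi] at this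
    linarith
  · have hn' : (1 : ℝ) ≤ n := by exact_mod_cast hn
    have hπ : Real.pi ∈ Set.Icc 0 (2 * Real.pi * n) :=
      ⟨by linarith [Real.pi_pos], by nlinarith [Real.pi_pos]⟩
    obtain ⟨s, -, hs⟩ := hconn.Icc_subset h00 h01 hπ
    have := hend s
    simp only at hs
    rw [hs, Real.cos_pi] at this
    linarith

theorem homotopicWith_of_smul_eq {L : CoverLorentz} {a : WedgeWithPath} {W : PathOfWedges}
    (ha : W = Quotient.mk _ a) (h : L • W = W) : L.act '' a.wedge = a.wedge ∧
      ContinuousMap.HomotopicWith (actPath L a.path) a.path (IsPathInto (L.act '' a.wedge)) := by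
  subst ha
  exact Quotient.exact h

theorem exists_rep_standardPath : ∃ a : WedgeWithPath,
    standardPath = Quotient.mk _ a ∧ a.wedge = standardWedge ∧
      ∀ t, a.path t = dirOf 0 (-(Real.pi / 2) + Real.pi / 2 * t) :=
  ⟨_, rfl, rfl, standard_path_eq⟩

/-- Winding around the hyperboloid changes the path of wedges. -/
theorem eq_zero_of_rot_smul {n : ℤ}
    (h : CoverLorentz.rot (2 * Real.pi * n) • standardPath = standardPath) : n = 0 := by
  obtain ⟨a, ha, haw, hap⟩ := exists_rep_standardPath
  obtain ⟨hW, hH⟩ := homotopicWith_of_smul_eq ha h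
  rw [hW, haw] at hH
  obtain ⟨H⟩ := hH
  have hp := H.prop'
  refine winding_eq_zero H.toContinuousMap (fun s => (hp s).1) (fun s => (hp s).2.1)
    (fun s => (hp s).2.2) (fun t => ?_) fun t => ?_
  · exact (H.map_zero_left t).trans (actPath_rot _ _ (fun _ => 0) _ hap t)
  · exact (H.map_one_left t).trans (hap t)

/-! ### Transitivity and stabilizers -/

theorem mem_standardWedge {x : V} : x ∈ standardWedge ↔ |x 0| < x 1 := Iff.rfl

/-- The covering homomorphism is onto the proper orthochronous Lorentz group. -/
theorem exists_toMatrix_eq {Λ : Matrix (Fin 3) (Fin 3) ℝ} (h : IsRestrictedLorentz Λ) :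
    ∃ L : CoverLorentz, L.toMatrix = Λ := by
  have hp : Λ.mulVec ![1, 0, 0] ∈ massShell 1 :=
    ⟨h.orthochronous _ (by simp [mdot]) (by simp), by rw [h.isometry]; simp [mdot]⟩
  set B := boostTo one_pos hp with hB
  set M := B⁻¹.toMatrix * Λ with hM
  have hMiso : ∀ x y, mdot (M.mulVec x) (M.mulVec y) = mdot x y := fun x y => by
    rw [hM, ← Matrix.mulVec_mulVec, ← Matrix.mulVec_mulVec, B⁻¹.toMatrix_restricted.isometry,
      h.isometry]
  have hMdet : M.det = 1 := by
    rw [hM, Matrix.det_mul, B⁻¹.toMatrix_restricted.proper, h.proper, one_mul]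
  have hM0 : M.mulVec ![1, 0, 0] = ![1, 0, 0] := by
    rw [hM, ← Matrix.mulVec_mulVec]
    have h1 := congrArg B⁻¹.act (boostTo_act one_pos hp)
    rw [← hB, CoverLorentz.act_inv_act] at h1
    exact h1.symm
  have c0 : M 0 0 = 1 ∧ M 1 0 = 0 ∧ M 2 0 = 0 := by
    have a0 := congrFun hM0 0
    have a1 := congrFun hM0 1
    have a2 := congrFun hM0 2
    simp [Matrix.mulVec, dotProduct, Fin.sum_univ_three] at a0 a1 a2
    exact ⟨a0, a1, a2⟩
  obtain ⟨c00, c10, c20⟩ := c0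
  have i1 := hMiso ![1, 0, 0] ![0, 1, 0]
  have i2 := hMiso ![1, 0, 0] ![0, 0, 1]
  have i3 := hMiso ![0, 1, 0] ![0, 1, 0]
  have i4 := hMiso ![0, 1, 0] ![0, 0, 1]
  have i5 := hMiso ![0, 0, 1] ![0, 0, 1]
  simp [mdot, Matrix.mulVec, dotProduct, Fin.sum_univ_three, c00, c10, c20] at i1 i2 i3 i4 i5
  rw [Matrix.det_fin_three, c00, c10, c20, i1, i2] at hMdet
  rw [i1] at i3 i4
  rw [i2] at i4 i5
  have e22 : M 2 2 = M 1 1 := by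
    linear_combination M 1 1 * hMdet + M 2 2 * i3 - M 2 1 * i4
  have e12 : M 1 2 = -M 2 1 := by
    linear_combination -M 2 1 * hMdet + M 1 2 * i3 - M 1 1 * i4
  have hcs : M 1 1 ^ 2 + M 2 1 ^ 2 = 1 := by linear_combination -i3
  set z : ℂ := ⟨M 1 1, M 2 1⟩ with hz
  have hz1 : ‖z‖ = 1 := by
    rw [Complex.norm_def, Complex.normSq_apply, Real.sqrt_eq_one]
    simp [hz]; linarith
  have hcos : Real.cos z.arg = M 1 1 := by
    rw [Complex.cos_arg (by intro h0; rw [h0] at hz1; simp at hz1), hz1]; simp [hz]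
  have hsin : Real.sin z.arg = M 2 1 := by rw [Complex.sin_arg, hz1]; simp [hz]
  have hMrot : (CoverLorentz.rot z.arg).toMatrix = M := by
    apply Model.matrix_ext
    intro x
    refine (CoverLorentz.rot_act z.arg x).trans ?_
    rw [hcos, hsin]
    ext i; fin_cases i
    · simp [Matrix.mulVec, dotProduct, Fin.sum_univ_three, c00, i1, i2]
    · simp [Matrix.mulVec, dotProduct, Fin.sum_univ_three, c10, e12]; ring
    · simp [Matrix.mulVec, dotProduct, Fin.sum_univ_three, c20, e22]
  refine ⟨B * CoverLorentz.rot z.arg, ?_⟩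
  rw [CoverLorentz.toMatrix_mul, hMrot, hM, ← Matrix.mul_assoc, CoverLorentz.mul_inv_toMatrix,
    Matrix.one_mul]

/-- The covering group acts transitively on the paths of wedges. -/
theorem exists_smul_standardPath (W : PathOfWedges) :
    ∃ L : CoverLorentz, L • standardPath = W := by
  have hW : IsWedge W.wedge := by
    induction W using Quotient.inductionOn with | _ a => exact a.isWedge
  obtain ⟨Λ, hΛ, hWΛ⟩ := hW
  obtain ⟨L, rfl⟩ := exists_toMatrix_eq hΛ
  have h1 : (L⁻¹ • W).wedge = standardWedge := by
    rw [wedge_smul, hWΛ, Set.image_image]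
    exact (Set.image_congr fun x _ => L.act_inv_act x).trans (Set.image_id' _)
  obtain ⟨n, hn⟩ := exists_eq_rot_smul h1
  exact ⟨L * CoverLorentz.rot (2 * Real.pi * n), by rw [mul_smul, ← hn, smul_inv_smul]⟩

/-- A transformation which leaves the standard wedge invariant is, up to its winding, a boost. -/
theorem of_act_standardWedge {L : CoverLorentz} (h : L.act '' standardWedge ⊆ standardWedge) :
    L.γ.im = 0 ∧ ∃ n : ℤ, L.ω = 2 * Real.pi * n := by
  have hD := CoverLorentz.denom_pos L
  have hmem : ∀ t : ℝ, |L.act ![0, 1, t] 0| < L.act ![0, 1, t] 1 := fun t =>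
    h ⟨_, by simp [standardWedge], rfl⟩
  have hlin : ∀ t : ℝ, L.act ![0, 1, t] = L.act ![0, 1, 0] + t • L.act ![0, 0, 1] := fun t => by
    rw [← CoverLorentz.act_smul, ← CoverLorentz.act_add]
    congr 1; ext i; fin_cases i <;> simp
  set e := L.act ![0, 1, 0] with he
  set f := L.act ![0, 0, 1] with hf
  have hmem' : ∀ t : ℝ, |e 0 + t * f 0| < e 1 + t * f 1 := fun t => by
    have := hmem t; rw [hlin t] at this; simpa using this
  have f1 : f 1 = 0 := by
    by_contra hne
    have := (abs_nonneg _).trans_lt (hmem' (-e 1 / f 1))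
    rw [div_mul_cancel₀ _ hne] at this
    linarith
  have f0 : f 0 = 0 := by
    by_contra hne
    have := hmem' ((e 1 - e 0) / f 0)
    rw [div_mul_cancel₀ _ hne, f1] at this
    have h2 := le_abs_self (e 0 + (e 1 - e 0))
    linarith
  rw [hf, CoverLorentz.act_apply_zero, div_eq_zero_iff] at f0
  have him : L.γ.im = 0 := by
    rcases f0 with f0 | f0
    · simpa using f0
    · exact absurd f0 hD.ne'
  have hre : L.γ.re ^ 2 < 1 := by rw [him] at hD; linarith
  rw [hf, CoverLorentz.act_apply_one, div_eq_zero_iff] at f1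
  have hsin : Real.sin L.ω = 0 := by
    rcases f1 with f1 | f1
    · simp [CoverLorentz.auxRe, CoverLorentz.auxIm, him] at f1
      rcases f1 with f1 | f1
      · exact f1
      · linarith
    · exact absurd f1 hD.ne'
  have he1 := (abs_nonneg _).trans_lt (hmem' 0)
  rw [zero_mul, add_zero, he, CoverLorentz.act_apply_one] at he1
  have hcos : 0 < Real.cos L.ω := by
    have h3 := (div_pos_iff_of_pos_right hD).1 he1
    simp [CoverLorentz.auxRe, CoverLorentz.auxIm, him] at h3
    exact pos_of_mul_pos_left h3 (by positivity)
  refine ⟨him, ?_⟩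
  have hc1 : Real.cos L.ω = 1 := by
    nlinarith [Real.sin_sq_add_cos_sq L.ω]
  obtain ⟨n, hn⟩ := (Real.cos_eq_one_iff _).1 hc1
  exact ⟨n, by rw [← hn]; ring⟩

theorem boost_act_mem_standardWedge {L : CoverLorentz} (hγ : L.γ.im = 0) (hω : L.ω = 0) {x : V}
    (hx : x ∈ standardWedge) : L.act x ∈ standardWedge := by
  have hD := CoverLorentz.denom_pos L
  rw [mem_standardWedge] at hx ⊢
  have h1 := abs_lt.1 hx
  rw [CoverLorentz.act_apply_zero, CoverLorentz.act_apply_one, abs_div, abs_of_pos hD,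
    div_lt_div_iff_of_pos_right hD, hω]
  rw [hγ] at hD ⊢
  simp [CoverLorentz.auxRe, CoverLorentz.auxIm, hγ] at hD ⊢
  have h2 : L.γ.re < 1 ∧ -1 < L.γ.re := ⟨(abs_lt.1 hD).2, (abs_lt.1 hD).1⟩
  rw [abs_lt]
  constructor <;> nlinarith [mul_pos (pow_pos (sub_pos.2 h2.1) 2) (sub_pos.2 h1.2),
    mul_pos (pow_pos (by linarith : 0 < 1 + L.γ.re) 2) (by linarith [h1.1] : 0 < x 1 + x 0)]

/-- The boosts which preserve the standard wedge fix the standard path of wedges. -/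
theorem boost_smul_standardPath {L : CoverLorentz} (hγ : L.γ.im = 0) (hω : L.ω = 0) :
    L • standardPath = standardPath := by
  obtain ⟨a, ha, haw, -⟩ := exists_rep_standardPath
  have himg : L.act '' standardWedge = standardWedge := by
    apply Set.Subset.antisymm
    · rintro _ ⟨x, hx, rfl⟩; exact boost_act_mem_standardWedge hγ hω hx
    · intro x hx
      refine ⟨L⁻¹.act x, boost_act_mem_standardWedge ?_ ?_ hx, L.act_act_inv x⟩
      · change (-L.γ * Complex.exp (L.ω * Complex.I)).im = 0
        simp [hω, hγ]
      · change -L.ω = 0; simp [hω]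
  rw [ha]
  refine Quotient.sound ⟨?_, ?_⟩
  · change L.act '' a.wedge = a.wedge
    rw [haw, himg]
  · change ContinuousMap.HomotopicWith (actPath L a.path) a.path (IsPathInto (L.act '' a.wedge))
    rw [haw, himg]
    have hp := a.isPathInto
    rw [haw] at hp
    -- switching on the boost gradually moves the endpoint only within the wedge
    refine ContinuousMap.HomotopicWith.symm ⟨{
      toFun := fun x => (L.pathTo (x.1 * x.2)).act (a.path x.2)
      continuous_toFun := ?_, map_zero_left := ?_, map_one_left := ?_, prop' := ?_ }⟩
    · refine CoverLorentz.continuous_act ?_ ?_ (by fun_prop)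
      · exact L.continuous_pathTo_γ.comp (continuous_fst.mul continuous_snd)
      · exact L.continuous_pathTo_ω.comp (continuous_fst.mul continuous_snd)
    · intro t
      simp only [zero_mul, CoverLorentz.pathTo_zero, CoverLorentz.one_act]
    · intro t
      simp only [one_mul]; rfl
    · intro s
      refine ⟨fun t => (CoverLorentz.mdot_act _ _ _).trans (hp.1 t), ?_, ?_⟩
      · change (L.pathTo (s * 0)).act (a.path 0) = _
        rw [mul_zero, CoverLorentz.pathTo_zero, CoverLorentz.one_act, hp.2.1]
      · change (L.pathTo (s * 1)).act (a.path 1) ∈ _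
        refine boost_act_mem_standardWedge ?_ ?_ hp.2.2
        · simp [CoverLorentz.pathTo, hγ]
        · simp [CoverLorentz.pathTo, hω]

/-- The stabilizer of the standard path of wedges. -/
theorem smul_standardPath_iff {L : CoverLorentz} :
    L • standardPath = standardPath ↔ L.γ.im = 0 ∧ L.ω = 0 := by
  refine ⟨fun h => ?_, fun h => boost_smul_standardPath h.1 h.2⟩
  have hW := congrArg PathOfWedges.wedge h
  rw [wedge_smul, wedge_standardPath] at hW
  obtain ⟨him, n, hn⟩ := of_act_standardWedge hW.subset
  set B : CoverLorentz := ⟨L.γ, 0, L.norm_lt⟩ with hB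
  have hL : L = CoverLorentz.rot (2 * Real.pi * n) * B := by
    ext
    · rw [CoverLorentz.rot_mul_γ]
    · rw [CoverLorentz.rot_mul_ω, hn]; simp [hB]
  rw [hL, mul_smul, boost_smul_standardPath (L := B) him rfl] at h
  have := eq_zero_of_rot_smul h
  refine ⟨him, ?_⟩
  rw [hn, this]; simp

/-! ### Causal complements -/

/-- A vector which is spacelike to the reflected wedge lies in the closed wedge. -/
theorem abs_le_of_forall_spacelike {x : V}
    (h : ∀ w ∈ standardWedge, mdot (x + w) (x + w) < 0) : |x 0| ≤ x 1 := by
  by_contra hcon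
  push Not at hcon
  -- far out along the wedge, in the direction of the sign of `x₀`, the sum becomes timelike
  set d := |x 0| - x 1 with hd
  have hdpos : 0 < d := by linarith
  set N := (x 2 ^ 2 + 1) / d + |x 0| + |x 1| + d with hN
  have hN0 : 0 < N := by positivity
  obtain ⟨σ, hσ, hσx⟩ : ∃ σ : ℝ, (σ = 1 ∨ σ = -1) ∧ σ * x 0 = |x 0| := by
    rcases le_total 0 (x 0) with h0 | h0
    · exact ⟨1, Or.inl rfl, by rw [abs_of_nonneg h0, one_mul]⟩
    · exact ⟨-1, Or.inr rfl, by rw [abs_of_nonpos h0]; ring⟩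
  have hσ2 : σ * σ = 1 := by rcases hσ with rfl | rfl <;> norm_num
  have hw : (![σ * N, N + d / 2, 0] : V) ∈ standardWedge := by
    have : |σ| = 1 := by rcases hσ with rfl | rfl <;> simp
    simp only [standardWedge, Set.mem_ofPred_eq, Matrix.cons_val_zero, Matrix.cons_val_one, abs_mul,
      this, one_mul, abs_of_pos hN0]
    linarith
  have h1 := h _ hw
  simp only [mdot, Pi.add_apply, Matrix.cons_val_zero, Matrix.cons_val_one, Matrix.cons_val] at h1
  have e1 : (x 0 + σ * N) * (x 0 + σ * N) = (|x 0| + N) ^ 2 := by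
    have : x 0 ^ 2 = |x 0| ^ 2 := (sq_abs _).symm
    rw [← hσx] at this ⊢
    linear_combination (x 0 ^ 2 + N ^ 2 - x 0 ^ 2) * hσ2 + this
  have e2 : x 2 ^ 2 + 1 + |x 1| * d ≤ N * d := by
    have : N * d = (x 2 ^ 2 + 1) + |x 1| * d + (|x 0| + d) * d := by
      rw [hN]; field_simp; ring
    rw [this]
    have : 0 ≤ (|x 0| + d) * d := by positivity
    linarith
  rw [e1] at h1
  have e3 : |x 0| = x 1 + d := by rw [hd]; ring
  rw [e3] at h1
  nlinarith [mul_nonneg (by linarith [neg_abs_le (x 1)] : 0 ≤ |x 1| + x 1) hdpos.le]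

theorem causalCompl_standardWedge :
    causalCompl standardWedge = {x | x 1 < -|x 0|} := by
  apply Set.Subset.antisymm
  · intro x hx
    rw [causalCompl, mem_interior_iff_mem_nhds] at hx
    have hc : Continuous fun t : ℝ => x + t • (![0, 1, 0] : V) := by fun_prop
    have hx' := hc.continuousAt (x := 0) |>.preimage_mem_nhds (by simpa using hx)
    obtain ⟨ε, hε, hball⟩ := Metric.mem_nhds_iff.1 hx'
    have h1 := hball (show ε / 2 ∈ Metric.ball 0 ε by simp [abs_of_pos, hε])
    have h2 : |(-(x + (ε / 2) • (![0, 1, 0] : V))) 0| ≤ (-(x + (ε / 2) • (![0, 1, 0] : V))) 1 := by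
      refine abs_le_of_forall_spacelike fun w hw => ?_
      have := h1 w hw
      simp only [mdot, Pi.add_apply, Pi.sub_apply, Pi.neg_apply] at this ⊢
      linarith
    simp only [Pi.neg_apply, Pi.add_apply, Pi.smul_apply, Matrix.cons_val_zero,
      Matrix.cons_val_one, smul_eq_mul, mul_zero, add_zero, abs_neg, mul_one] at h2
    simp only [Set.mem_ofPred_eq]
    linarith
  · refine interior_maximal ?_ ?_
    · intro x hx y hy
      simp only [Set.mem_ofPred_eq] at hx
      rw [mem_standardWedge] at hy
      simp only [mdot, Pi.sub_apply]
      have h1 : |x 0 - y 0| < y 1 - x 1 := by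
        have := abs_sub (x 0) (y 0); linarith
      have h2 := sq_lt_sq' (by linarith [abs_nonneg (x 0 - y 0)]) h1
      rw [sq_abs] at h2
      nlinarith [sq_nonneg (x 2 - y 2)]
    · exact isOpen_lt (continuous_apply 1) (continuous_apply 0).abs.neg

theorem causalCompl_act (L : CoverLorentz) (A : Set V) :
    causalCompl (L.act '' A) = L.act '' causalCompl A := by
  have h : L.act = L.actEquiv.toHomeomorph := rfl
  rw [causalCompl, causalCompl, h, Homeomorph.image_interior]
  congr 1
  ext x
  constructor
  · intro hx
    refine ⟨L⁻¹.act x, fun y hy => ?_, L.act_act_inv x⟩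
    have h1 := hx (L.act y) ⟨y, hy, rfl⟩
    rwa [← L.mdot_act, L.act_sub, L.act_act_inv]
  · rintro ⟨x, hx, rfl⟩ _ ⟨y, hy, rfl⟩
    have h1 := hx y hy
    change mdot (L.act x - L.act y) (L.act x - L.act y) < 0
    rwa [← L.act_sub, L.mdot_act]

theorem rot_pi_act_standardWedge :
    (CoverLorentz.rot Real.pi).act '' standardWedge = {x | x 1 < -|x 0|} := by
  ext x
  constructor
  · rintro ⟨y, hy, rfl⟩
    rw [mem_standardWedge] at hy
    rw [CoverLorentz.rot_act]
    simp; linarith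
  · intro hx
    refine ⟨![x 0, -x 1, -x 2], ?_, ?_⟩
    · simp only [Set.mem_ofPred_eq] at hx
      simp [standardWedge]; linarith
    · rw [CoverLorentz.rot_act]
      ext i; fin_cases i <;> simp

/-! ### Statistics numbers -/

/-- After undoing a half turn, the second path of wedges lies over the standard wedge, where it can
only differ from the standard path by full turns. -/
theorem exists_statisticsNumber {W W' : PathOfWedges} (h : W'.wedge = causalCompl W.wedge) :
    ∃ k : ℤ, IsStatisticsNumber W W' k := by
  obtain ⟨L, hL⟩ := exists_smul_standardPath W
  have h1 : ((L * CoverLorentz.rot Real.pi)⁻¹ • W').wedge = standardWedge := by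
    rw [wedge_smul, h, ← hL, wedge_smul, wedge_standardPath, causalCompl_act,
      causalCompl_standardWedge, ← rot_pi_act_standardWedge, Set.image_image, Set.image_image]
    refine (Set.image_congr fun x _ => ?_).trans (Set.image_id' _)
    rw [← CoverLorentz.act_mul, ← CoverLorentz.act_mul, mul_assoc, inv_mul_cancel,
      CoverLorentz.one_act]
  obtain ⟨n, hn⟩ := exists_eq_rot_smul h1
  refine ⟨2 * n + 1, ⟨n, rfl⟩, L, hL, ?_⟩
  rw [inv_smul_eq_iff, ← mul_smul, mul_assoc, CoverLorentz.rot_mul_rot] at hn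
  rw [hn]
  congr 3
  push_cast; ring

/-- Two choices of `L̃` differ by a boost with vanishing `ω`, so the `ω` component of a stabilizing
element detects the difference of the statistics numbers. -/
theorem statisticsNumber_unique {W W' : PathOfWedges} {k k' : ℤ} (h : IsStatisticsNumber W W' k)
    (h' : IsStatisticsNumber W W' k') : k' = k := by
  obtain ⟨-, L, hL, hL1⟩ := h
  obtain ⟨-, L', hL', hL1'⟩ := h'
  set B := L⁻¹ * L' with hB
  have hBs : B • standardPath = standardPath := by
    rw [hB, mul_smul, hL', ← hL, inv_smul_smul]
  obtain ⟨-, hBω⟩ := smul_standardPath_iff.1 hBs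
  have hs : (CoverLorentz.rot (-(k * Real.pi)) * (B * CoverLorentz.rot (k' * Real.pi))) •
      standardPath = standardPath := by
    rw [hB, mul_assoc, mul_smul, mul_smul, hL1', ← hL1, mul_smul, inv_smul_smul,
      ← CoverLorentz.rot_inv, inv_smul_smul]
  obtain ⟨-, hω⟩ := smul_standardPath_iff.1 hs
  rw [CoverLorentz.rot_mul_ω, CoverLorentz.mul_rot_ω, hBω] at hω
  have : ((k' : ℝ) - k) * Real.pi = 0 := by linarith
  rcases mul_eq_zero.1 this with h0 | h0
  · exact_mod_cast sub_eq_zero.1 h0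
  · exact absurd h0 Real.pi_ne_zero

/-! ### Intertwiners and deformation matrices of paths of wedges -/

theorem transporter_smul (W : PathOfWedges) : transporter W • standardPath = W :=
  Classical.epsilon_spec (exists_smul_standardPath W)

/-- Two transformations which generate the same path of wedges differ by a boost which preserves
the standard wedge. -/
theorem exists_boost {W : PathOfWedges} {L L' : CoverLorentz} (h : L • standardPath = W)
    (h' : L' • standardPath = W) : ∃ B : CoverLorentz, L' = L * B ∧ B.γ.im = 0 ∧ B.ω = 0 :=
  ⟨L⁻¹ * L', by group, smul_standardPath_iff.1 (by rw [mul_smul, h', ← h, inv_smul_smul])⟩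

namespace Model

variable (P : Model)

theorem Q_eq {W : PathOfWedges} {L : CoverLorentz} (h : L • standardPath = W) :
    P.Q W = P.boostedMatrix L := by
  obtain ⟨B, hB, hγ, hω⟩ := exists_boost h (transporter_smul W)
  rw [Q, hB, boostedMatrix_mul, P.boostedMatrix_boost hγ hω, boostedMatrix]

theorem u_eq {W : PathOfWedges} {L : CoverLorentz} (h : L • standardPath = W) {p : V}
    (hp : p ∈ massShell P.mass) : P.u W p = P.boostedIntertwiner L p := by
  obtain ⟨B, hB, hγ, hω⟩ := exists_boost h (transporter_smul W)
  rw [u, hB, P.boostedIntertwiner_mul _ _ hp, P.boostedIntertwiner_boost hγ hω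
    (act_mem_massShell P.mass_pos _ hp), boostedIntertwiner]

theorem norm_u_eq_one (W : PathOfWedges) {p : V} (hp : p ∈ massShell P.mass) : ‖P.u W p‖ = 1 :=
  P.norm_boostedIntertwiner _ hp

/-- Covariance of the intertwiners. -/
theorem u_smul (L : CoverLorentz) (W : PathOfWedges) {p : V} (hp : p ∈ massShell P.mass) :
    P.u (L • W) p = Complex.exp (-(Complex.I * (P.spin * wigner P.mass L p : ℝ))) *
      P.u W (L⁻¹.act p) := by
  rw [P.u_eq (L := L * transporter W) (by rw [mul_smul, transporter_smul]) hp,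
    P.boostedIntertwiner_mul _ _ hp]
  rfl

/-- Covariance of the deformation matrices. -/
theorem mdot_Q_smul (L : CoverLorentz) (W : PathOfWedges) (p q : V) :
    mdot ((P.Q (L • W)).mulVec p) q = mdot ((P.Q W).mulVec (L⁻¹.act p)) (L⁻¹.act q) := by
  rw [P.Q_eq (L := L * transporter W) (by rw [mul_smul, transporter_smul]), boostedMatrix_mul,
    ← Matrix.mulVec_mulVec, ← Matrix.mulVec_mulVec]
  exact L.mdot_act_left _ _

theorem mdot_Q_skew (W : PathOfWedges) (x y : V) :
    mdot ((P.Q W).mulVec x) y = -mdot ((P.Q W).mulVec y) x :=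
  P.mdot_boostedMatrix_skew _ x y

/-- The intertwiners of paths of wedges with opposite wedges differ by a constant phase. -/
theorem u_of_statisticsNumber {W W' : PathOfWedges} {k : ℤ} (h : IsStatisticsNumber W W' k) {p : V}
    (hp : p ∈ massShell P.mass) : P.u W' p =
      Complex.exp (-(Complex.I * (P.spin * (k * Real.pi) : ℝ))) * P.u W p := by
  obtain ⟨hk, L, hL, hL'⟩ := h
  rw [P.u_eq hL hp, P.u_eq hL' hp, P.boostedIntertwiner_mul_rot L hk hp]

/-- The deformation matrices of opposite wedges are opposite. -/
theorem Q_of_statisticsNumber {W W' : PathOfWedges} {k : ℤ} (h : IsStatisticsNumber W W' k) :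
    P.Q W' = -P.Q W := by
  obtain ⟨hk, L, hL, hL'⟩ := h
  rw [P.Q_eq hL, P.Q_eq hL', P.boostedMatrix_mul_rot L hk]

end Model

/-! ### Lorentz invariance of the measure on the mass shell -/

/-- The point of the mass shell with rapidity `z.1` in the direction of the first axis and with
second momentum component `z.2`. -/
def rapidityChart (m : ℝ) (z : ℝ × ℝ) : V :=
  ![√(m ^ 2 + z.2 ^ 2) * Real.cosh z.1, √(m ^ 2 + z.2 ^ 2) * Real.sinh z.1, z.2]

theorem continuous_rapidityChart (m : ℝ) : Continuous (rapidityChart m) := by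
  refine continuous_pi fun i => ?_
  fin_cases i
  · change Continuous fun z : ℝ × ℝ => √(m ^ 2 + z.2 ^ 2) * Real.cosh z.1; fun_prop
  · change Continuous fun z : ℝ × ℝ => √(m ^ 2 + z.2 ^ 2) * Real.sinh z.1; fun_prop
  · exact continuous_snd

theorem onShell_sinh (m θ y : ℝ) :
    onShell m (√(m ^ 2 + y ^ 2) * Real.sinh θ, y) = rapidityChart m (θ, y) := by
  have h : m ^ 2 + (√(m ^ 2 + y ^ 2) * Real.sinh θ) ^ 2 + y ^ 2 =
      (√(m ^ 2 + y ^ 2) * Real.cosh θ) ^ 2 := by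
    rw [mul_pow, mul_pow, Real.sq_sqrt (by positivity), Real.cosh_sq]; ring
  have h2 : 0 ≤ √(m ^ 2 + y ^ 2) * Real.cosh θ :=
    mul_nonneg (Real.sqrt_nonneg _) (Real.cosh_pos _).le
  ext i; fin_cases i
  · simp only [onShell, rapidityChart, Fin.zero_eta, Matrix.cons_val_zero]
    rw [h, Real.sqrt_sq h2]
  · rfl
  · rfl

/-- In rapidity coordinates the invariant measure on the mass shell is `½ dθ dp₂`. -/
theorem shellMeasure_eq_map {m : ℝ} (hm : 0 < m) : shellMeasure m =
    (ENNReal.ofReal (1 / 2) • (volume : Measure (ℝ × ℝ))).map (rapidityChart m) := by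
  refine Measure.ext_of_lintegral _ fun f hf => ?_
  have hon := (continuous_onShell m).measurable
  have hch := (continuous_rapidityChart m).measurable
  have hρ : Measurable fun q : ℝ × ℝ =>
      ENNReal.ofReal (1 / (2 * √(m ^ 2 + q.1 ^ 2 + q.2 ^ 2))) := by fun_prop
  have hfo : Measurable fun q => f (onShell m q) := hf.comp hon
  have hfc : Measurable fun q => f (rapidityChart m q) := hf.comp hch
  rw [shellMeasure, lintegral_map hf hon, 
    lintegral_withDensity_eq_lintegral_mul _ hρ hfo,
    lintegral_map hf hch, lintegral_smul_measure, Measure.volume_eq_prod,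
    lintegral_prod_symm _ (hρ.mul hfo).aemeasurable,
    lintegral_prod_symm _ hfc.aemeasurable, smul_eq_mul,
    ← lintegral_const_mul _ hfc.lintegral_prod_left']
  refine lintegral_congr fun y => ?_
  set μ := √(m ^ 2 + y ^ 2) with hμ
  have hμ0 : 0 < μ := Real.sqrt_pos.2 (by positivity)
  have himg : (fun θ => μ * Real.sinh θ) '' Set.univ = Set.univ := by
    rw [Set.image_univ]
    refine Set.range_eq_univ.2 fun q => ?_
    obtain ⟨θ, hθ⟩ := Real.sinh_surjective (q / μ)
    exact ⟨θ, by simp only [hθ]; field_simp⟩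
  have hsub := lintegral_image_eq_lintegral_abs_deriv_mul MeasurableSet.univ
    (f := fun θ => μ * Real.sinh θ) (f' := fun θ => μ * Real.cosh θ)
    (fun θ _ => ((Real.hasDerivAt_sinh θ).const_mul μ).hasDerivWithinAt)
    (fun a _ b _ h => Real.sinh_injective (mul_left_cancel₀ hμ0.ne' h))
    (fun q => ENNReal.ofReal (1 / (2 * √(m ^ 2 + q ^ 2 + y ^ 2))) * f (onShell m (q, y)))
  rw [himg, Measure.restrict_univ] at hsub
  refine hsub.trans ?_
  have hfy : Measurable fun θ => f (rapidityChart m (θ, y)) := hfc.comp measurable_prodMk_right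
  rw [← lintegral_const_mul _ hfy]
  refine lintegral_congr fun θ => ?_
  have hc : 0 < μ * Real.cosh θ := mul_pos hμ0 (Real.cosh_pos _)
  have hs := congrFun (onShell_sinh m θ y) 0
  simp only [onShell, rapidityChart, Matrix.cons_val_zero, ← hμ] at hs
  rw [onShell_sinh, hs, ← mul_assoc, abs_of_pos hc, ← ENNReal.ofReal_mul hc.le]
  congr 2
  field_simp

theorem measurePreserving_rapidityChart {m : ℝ} (hm : 0 < m) :
    MeasurePreserving (rapidityChart m) (ENNReal.ofReal (1 / 2) • (volume : Measure (ℝ × ℝ)))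
      (shellMeasure m) :=
  ⟨(continuous_rapidityChart m).measurable, (shellMeasure_eq_map hm).symm⟩

namespace CoverLorentz

theorem measurable_act (L : CoverLorentz) : Measurable L.act := L.continuous_act_right.measurable

theorem measurePreserving_boost {m : ℝ} (hm : 0 < m) {L : CoverLorentz} (hγ : L.γ.im = 0)
    (hω : L.ω = 0) : MeasurePreserving L.act (shellMeasure m) (shellMeasure m) := by
  obtain ⟨g, hre⟩ : ∃ g, L.γ.re = g := ⟨_, rfl⟩
  have hD : 0 < 1 - g ^ 2 := by have := denom_pos L; rw [hγ, hre] at this; linarith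
  have hD' := hD.ne'
  -- the rapidity of the boost
  set η := Real.arsinh (2 * g / (1 - g ^ 2)) with hη
  have hs : Real.sinh η = 2 * g / (1 - g ^ 2) := Real.sinh_arsinh _
  have hc : Real.cosh η = (1 + g ^ 2) / (1 - g ^ 2) := by
    rw [hη, Real.cosh_arsinh, Real.sqrt_eq_iff_mul_self_eq (by positivity) (by positivity)]
    field_simp; ring
  have hshift : MeasurePreserving (fun z : ℝ × ℝ => (z.1 + η, z.2))
      (ENNReal.ofReal (1 / 2) • volume) (ENNReal.ofReal (1 / 2) • volume) := by
    refine MeasurePreserving.smul_measure ?_ _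
    exact (measurePreserving_add_right volume η).prod (MeasurePreserving.id volume)
  have hcomm : ∀ z, L.act (rapidityChart m z) = rapidityChart m (z.1 + η, z.2) := by
    intro z
    ext i; fin_cases i
    · simp only [Fin.zero_eta, act_apply_zero, rapidityChart, Matrix.cons_val_zero,
        Matrix.cons_val_one, Matrix.cons_val, Real.cosh_add, hs, hc, hγ, hre,
        zero_pow two_ne_zero, add_zero]
      field_simp
      ring
    · simp only [Fin.mk_one, act_apply_one, auxRe, auxIm, rapidityChart, Matrix.cons_val_zero,
        Matrix.cons_val_one, Matrix.cons_val, Real.sinh_add, hs, hc, hγ, hre, hω,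
        Real.cos_zero, Real.sin_zero, zero_pow two_ne_zero, add_zero]
      field_simp
      ring
    · simp only [Fin.reduceFinMk, act_apply_two, auxRe, auxIm, rapidityChart, Matrix.cons_val_zero,
        Matrix.cons_val_one, Matrix.cons_val, hγ, hre, hω, Real.cos_zero,
        Real.sin_zero, zero_pow two_ne_zero, add_zero]
      field_simp
      ring
  have hch := measurePreserving_rapidityChart hm
  refine ⟨L.measurable_act, ?_⟩
  conv_lhs => rw [← hch.map_eq]
  rw [Measure.map_map L.measurable_act hch.measurable,
    show L.act ∘ rapidityChart m = rapidityChart m ∘ fun z : ℝ × ℝ => (z.1 + η, z.2) from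
      funext hcomm, ← Measure.map_map hch.measurable hshift.measurable, hshift.map_eq, hch.map_eq]

theorem measurePreserving_rot (m ω : ℝ) :
    MeasurePreserving (rot ω).act (shellMeasure m) (shellMeasure m) := by
  set R : ℝ × ℝ → ℝ × ℝ := fun q =>
    (Real.cos ω * q.1 - Real.sin ω * q.2, Real.sin ω * q.1 + Real.cos ω * q.2) with hR
  have hRv : MeasurePreserving R volume volume := by
    have h1 := Complex.volume_preserving_equiv_real_prod
    have h2 := (rotation (Circle.exp ω)).measurePreserving
    have h3 := (h1.comp h2).comp (h1.symm Complex.measurableEquivRealProd)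
    have hRe : R = (Complex.measurableEquivRealProd ∘ rotation (Circle.exp ω)) ∘
        Complex.measurableEquivRealProd.symm := by
      funext q
      refine Prod.ext ?_ ?_
      · simp [hR, Circle.coe_exp, Complex.exp_ofReal_mul_I_re, Complex.exp_ofReal_mul_I_im]
      · simp [hR, Circle.coe_exp, Complex.exp_ofReal_mul_I_re, Complex.exp_ofReal_mul_I_im]
        ring
    rw [hRe]
    exact h3
  set ρ : ℝ × ℝ → ENNReal := fun q =>
    ENNReal.ofReal (1 / (2 * √(m ^ 2 + q.1 ^ 2 + q.2 ^ 2))) with hρ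
  have hρm : Measurable ρ := by simp only [hρ]; fun_prop
  have hinv : ∀ q : ℝ × ℝ, m ^ 2 + (R q).1 ^ 2 + (R q).2 ^ 2 = m ^ 2 + q.1 ^ 2 + q.2 ^ 2 := by
    intro q
    simp only [hR]
    linear_combination (q.1 ^ 2 + q.2 ^ 2) * Real.sin_sq_add_cos_sq ω
  have hRρ : MeasurePreserving R (volume.withDensity ρ) (volume.withDensity ρ) := by
    refine ⟨hRv.measurable, Measure.ext fun s hs => ?_⟩
    rw [Measure.map_apply hRv.measurable hs, withDensity_apply _ (hRv.measurable hs),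
      withDensity_apply _ hs, ← hRv.setLIntegral_comp_preimage hs hρm]
    simp only [hρ, hinv]
  have hon : MeasurePreserving (onShell m) (volume.withDensity ρ) (shellMeasure m) :=
    ⟨(continuous_onShell m).measurable, rfl⟩
  have hcomm : (rot ω).act ∘ onShell m = onShell m ∘ R := by
    funext q
    simp only [Function.comp_apply, rot_act]
    ext i; fin_cases i
    · change √(m ^ 2 + q.1 ^ 2 + q.2 ^ 2) = √(m ^ 2 + (R q).1 ^ 2 + (R q).2 ^ 2)
      rw [hinv]
    · rfl
    · rfl
  refine ⟨(rot ω).measurable_act, ?_⟩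
  conv_lhs => rw [← hon.map_eq]
  rw [Measure.map_map (rot ω).measurable_act hon.measurable, hcomm,
    ← Measure.map_map hon.measurable hRρ.measurable, hRρ.map_eq, hon.map_eq]

theorem comp_act (a b : CoverLorentz) : (a * b).act = a.act ∘ b.act :=
  funext fun x => act_mul a b x

/-- The measure on the mass shell is Lorentz invariant. -/
theorem measurePreserving_act {m : ℝ} (hm : 0 < m) (L : CoverLorentz) :
    MeasurePreserving L.act (shellMeasure m) (shellMeasure m) := by
  -- every Lorentz transformation is a rotation times a boost in a fixed direction and a rotation
  set B : CoverLorentz := ⟨(‖L.γ‖ : ℝ), 0, by simpa using L.norm_lt⟩ with hB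
  have hL : L = rot (L.ω + L.γ.arg) * (B * rot (-L.γ.arg)) := by
    ext
    · rw [rot_mul_γ, mul_rot_γ]
      conv_lhs => rw [← Complex.norm_mul_exp_arg_mul_I L.γ]
      simp [hB]
    · rw [rot_mul_ω, mul_rot_ω]; simp [hB]
  rw [hL, comp_act, comp_act]
  exact (measurePreserving_rot m _).comp
    ((measurePreserving_boost hm (by simp [hB]) rfl).comp (measurePreserving_rot m _))

/-- Lorentz transformations preserve the volume of Minkowski space. -/
theorem volume_preserving_act (L : CoverLorentz) :
    MeasurePreserving L.act (volume : Measure V) volume := by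
  refine ⟨L.measurable_act, ?_⟩
  have hd := L.toMatrix_restricted.proper
  have h := Real.map_matrix_volume_pi_eq_smul_volume_pi (M := L.toMatrix) (by rw [hd]; norm_num)
  rw [hd] at h
  simpa using! h

end CoverLorentz

/-! ### Configurations on the mass shell -/

theorem ae_mem_massShell {m : ℝ} (hm : 0 < m) : ∀ᵐ p ∂shellMeasure m, p ∈ massShell m := by
  have hms : MeasurableSet (massShell m) := by
    have h (i : Fin 3) : Measurable fun p : V => p i := measurable_pi_apply i
    refine (measurableSet_lt measurable_const (h 0)).inter ?_
    refine measurableSet_eq_fun ?_ measurable_const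
    unfold mdot
    exact (((h 0).mul (h 0)).sub ((h 1).mul (h 1))).sub ((h 2).mul (h 2))
  refine (ae_map_iff (p := fun p => p ∈ massShell m)
    (continuous_onShell m).measurable.aemeasurable hms).2 ?_
  exact Filter.Eventually.of_forall fun q => onShell_mem_massShell hm q

/-- All momenta of the configuration lie on the mass shell. -/
def OnMassShell (m : ℝ) {n k : ℕ} (x : Conf n k) : Prop :=
  (∀ i, x.1 i ∈ massShell m) ∧ ∀ j, x.2 j ∈ massShell m

theorem ae_onMassShell {m : ℝ} (hm : 0 < m) (n k : ℕ) :
    ∀ᵐ x ∂confMeasure m n k, OnMassShell m x := by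
  have h (n : ℕ) : ∀ᵐ x ∂(Measure.pi fun _ : Fin n => shellMeasure m), ∀ i, x i ∈ massShell m :=
    ae_all_iff.2 fun i => (Measure.tendsto_eval_ae_ae (μ := fun _ : Fin n => shellMeasure m)
      (i := i)).eventually (ae_mem_massShell hm)
  exact (Measure.quasiMeasurePreserving_fst.ae (h n)).and
    (Measure.quasiMeasurePreserving_snd.ae (h k))

/-- The Lorentz action on configurations. -/
def actConf (L : CoverLorentz) {n k : ℕ} (x : Conf n k) : Conf n k :=
  (fun i => L.act (x.1 i), fun j => L.act (x.2 j))

theorem measurePreserving_actConf {m : ℝ} (hm : 0 < m) (L : CoverLorentz) (n k : ℕ) :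
    MeasurePreserving (actConf L (n := n) (k := k)) (confMeasure m n k) (confMeasure m n k) :=
  (measurePreserving_pi _ _ fun _ => L.measurePreserving_act hm).prod
    (measurePreserving_pi _ _ fun _ => L.measurePreserving_act hm)

theorem actConf_mul (L L' : CoverLorentz) {n k : ℕ} (x : Conf n k) :
    actConf (L * L') x = actConf L (actConf L' x) := by
  simp only [actConf, CoverLorentz.act_mul]

theorem actConf_one {n k : ℕ} (x : Conf n k) : actConf 1 x = x := by
  simp only [actConf, CoverLorentz.one_act]

/-! ### The spin representation on the sectors -/

theorem mdot_comm (x y : V) : mdot x y = mdot y x := by simp only [mdot]; ring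

theorem mdot_add_right (a x y : V) : mdot a (x + y) = mdot a x + mdot a y := by
  simp only [mdot, Pi.add_apply]; ring

theorem mdot_add_left (a b x : V) : mdot (a + b) x = mdot a x + mdot b x := by
  simp only [mdot, Pi.add_apply]; ring

theorem mdot_zero_left (x : V) : mdot 0 x = 0 := by simp [mdot]

namespace Model

variable (P : Model)

/-- The unimodular multiplier of the spin action. -/
def spinFactor (a : V) (L : CoverLorentz) {n k : ℕ} (x : Conf n k) : ℂ :=
  Complex.exp (Complex.I * (mdot a (∑ i, x.1 i + ∑ j, x.2 j) : ℝ)) *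
    Complex.exp (Complex.I * (P.spin * ((n : ℝ) - k) *
      (∑ i, wigner P.mass L (x.1 i) - ∑ j, wigner P.mass L (x.2 j)) : ℝ))

theorem spinAction_eq (a : V) (L : CoverLorentz) {n k : ℕ} (ψ : Conf n k → ℂ) (x : Conf n k) :
    P.spinAction a L ψ x = P.spinFactor a L x * ψ (actConf L⁻¹ x) := rfl

theorem norm_spinFactor (a : V) (L : CoverLorentz) {n k : ℕ} (x : Conf n k) :
    ‖P.spinFactor a L x‖ = 1 := by
  rw [spinFactor, norm_mul, mul_comm Complex.I, mul_comm Complex.I, Complex.norm_exp_ofReal_mul_I,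
    Complex.norm_exp_ofReal_mul_I, one_mul]

theorem measurable_spinFactor (a : V) (L : CoverLorentz) (n k : ℕ) :
    Measurable (P.spinFactor a L (n := n) (k := k)) := by
  have h1 (i : Fin n) : Measurable fun x : Conf n k => x.1 i :=
    (measurable_pi_apply i).comp measurable_fst
  have h2 (j : Fin k) : Measurable fun x : Conf n k => x.2 j :=
    (measurable_pi_apply j).comp measurable_snd
  have hw := measurable_wigner P.mass L
  have hs : Measurable fun x : Conf n k => ∑ i, x.1 i + ∑ j, x.2 j :=
    (Finset.measurable_fun_sum _ fun i _ => h1 i).add (Finset.measurable_fun_sum _ fun i _ => h2 i)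
  have hsi (i : Fin 3) : Measurable fun x : Conf n k => (∑ i, x.1 i + ∑ j, x.2 j) i :=
    (measurable_pi_apply i).comp hs
  have hd : Measurable fun x : Conf n k => mdot a (∑ i, x.1 i + ∑ j, x.2 j) := by
    unfold mdot
    exact (((hsi 0).const_mul _).sub ((hsi 1).const_mul _)).sub ((hsi 2).const_mul _)
  have hΩ : Measurable fun x : Conf n k => P.spin * ((n : ℝ) - k) *
      (∑ i, wigner P.mass L (x.1 i) - ∑ j, wigner P.mass L (x.2 j)) :=
    ((Finset.measurable_fun_sum _ fun i _ => hw.comp (h1 i)).sub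
      (Finset.measurable_fun_sum _ fun i _ => hw.comp (h2 i))).const_mul _
  exact (Complex.measurable_exp.comp ((Complex.measurable_ofReal.comp hd).const_mul _)).mul
    (Complex.measurable_exp.comp ((Complex.measurable_ofReal.comp hΩ).const_mul _))

theorem spinFactor_permute (a : V) (L : CoverLorentz) {n k : ℕ} (x : Conf n k)
    (σ : Equiv.Perm (Fin n)) (τ : Equiv.Perm (Fin k)) :
    P.spinFactor a L (permute σ τ x) = P.spinFactor a L x := by
  simp only [spinFactor, permute, Function.comp_apply]
  rw [Equiv.sum_comp σ fun i => x.1 i, Equiv.sum_comp τ fun j => x.2 j,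
    Equiv.sum_comp σ fun i => wigner P.mass L (x.1 i),
    Equiv.sum_comp τ fun j => wigner P.mass L (x.2 j)]

/-- The multipliers form a cocycle, because the Wigner rotation angles do. -/
theorem spinFactor_mul (a a' : V) (L L' : CoverLorentz) {n k : ℕ} {x : Conf n k}
    (hx : OnMassShell P.mass x) : P.spinFactor (a + L.act a') (L * L') x =
      P.spinFactor a L x * P.spinFactor a' L' (actConf L⁻¹ x) := by
  have h1 : ∀ i, wigner P.mass (L * L') (x.1 i) =
      wigner P.mass L (x.1 i) + wigner P.mass L' (L⁻¹.act (x.1 i)) :=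
    fun i => wigner_mul P.mass_pos L L' (hx.1 i)
  have h2 : ∀ i, wigner P.mass (L * L') (x.2 i) =
      wigner P.mass L (x.2 i) + wigner P.mass L' (L⁻¹.act (x.2 i)) :=
    fun i => wigner_mul P.mass_pos L L' (hx.2 i)
  simp only [spinFactor, actConf, h1, h2, Finset.sum_add_distrib, mdot_add_left,
    CoverLorentz.mdot_act_left, CoverLorentz.act_add, CoverLorentz.act_sum]
  simp only [← Complex.exp_add]
  congr 1
  push_cast
  ring

theorem spinFactor_one {n k : ℕ} {x : Conf n k} (hx : OnMassShell P.mass x) :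
    P.spinFactor 0 1 x = 1 := by
  have h1 : ∀ i, wigner P.mass 1 (x.1 i) = 0 := fun i => wigner_one P.mass_pos (hx.1 i)
  have h2 : ∀ i, wigner P.mass 1 (x.2 i) = 0 := fun i => wigner_one P.mass_pos (hx.2 i)
  simp [spinFactor, mdot_zero_left, h1, h2]

theorem spinAction_congr (a : V) (L : CoverLorentz) {n k : ℕ} {ψ ψ' : Conf n k → ℂ}
    (h : ψ =ᵐ[confMeasure P.mass n k] ψ') :
    P.spinAction a L ψ =ᵐ[confMeasure P.mass n k] P.spinAction a L ψ' := by
  filter_upwards [(measurePreserving_actConf P.mass_pos L⁻¹ n k).quasiMeasurePreserving.ae h]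
    with x hx
  rw [spinAction_eq, spinAction_eq, hx]

theorem memLp_spinAction (a : V) (L : CoverLorentz) {n k : ℕ} {ψ : Conf n k → ℂ}
    (h : MemLp ψ 2 (confMeasure P.mass n k)) :
    MemLp (P.spinAction a L ψ) 2 (confMeasure P.mass n k) := by
  have h1 := h.comp_measurePreserving (measurePreserving_actConf P.mass_pos L⁻¹ n k)
  refine h1.of_le ((P.measurable_spinFactor a L n k).aestronglyMeasurable.mul h1.1)
    (Filter.Eventually.of_forall fun x => ?_)
  rw [spinAction_eq, norm_mul, norm_spinFactor, one_mul, Function.comp_apply]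

theorem eLpNorm_spinAction (a : V) (L : CoverLorentz) {n k : ℕ} {ψ : Conf n k → ℂ}
    (h : MemLp ψ 2 (confMeasure P.mass n k)) :
    eLpNorm (P.spinAction a L ψ) 2 (confMeasure P.mass n k) =
      eLpNorm ψ 2 (confMeasure P.mass n k) := by
  rw [← eLpNorm_comp_measurePreserving h.1 (measurePreserving_actConf P.mass_pos L⁻¹ n k)]
  refine eLpNorm_congr_norm_ae (Filter.Eventually.of_forall fun x => ?_)
  rw [spinAction_eq, norm_mul, norm_spinFactor, one_mul, Function.comp_apply]

/-- The spin action on square integrable functions. -/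
def spinLp (a : V) (L : CoverLorentz) (n k : ℕ) :
    Lp ℂ 2 (confMeasure P.mass n k) →ₗᵢ[ℂ] Lp ℂ 2 (confMeasure P.mass n k) where
  toFun Ψ := (P.memLp_spinAction a L (Lp.memLp Ψ)).toLp _
  map_add' Ψ Ψ' := by
    rw [← MemLp.toLp_add]
    refine (MemLp.toLp_eq_toLp_iff _ _).2 ?_
    refine (P.spinAction_congr a L (Lp.coeFn_add Ψ Ψ')).trans (Filter.Eventually.of_forall ?_)
    intro x
    simp only [spinAction_eq, Pi.add_apply, mul_add]
  map_smul' c Ψ := by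
    rw [RingHom.id_apply, ← MemLp.toLp_const_smul]
    refine (MemLp.toLp_eq_toLp_iff _ _).2 ?_
    refine (P.spinAction_congr a L (Lp.coeFn_smul c Ψ)).trans (Filter.Eventually.of_forall ?_)
    intro x
    simp only [spinAction_eq, Pi.smul_apply, smul_eq_mul]
    ring
  norm_map' Ψ := by
    change ‖(P.memLp_spinAction a L (Lp.memLp Ψ)).toLp _‖ = _
    rw [Lp.norm_toLp, P.eLpNorm_spinAction a L (Lp.memLp Ψ), Lp.norm_def]

theorem coeFn_spinLp (a : V) (L : CoverLorentz) {n k : ℕ}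
    (Ψ : Lp ℂ 2 (confMeasure P.mass n k)) :
    P.spinLp a L n k Ψ =ᵐ[confMeasure P.mass n k] P.spinAction a L Ψ :=
  MemLp.coeFn_toLp (P.memLp_spinAction a L (Lp.memLp Ψ))

end Model

theorem coeFn_permute {m : ℝ} {n k : ℕ} (Ψ : Sector m n k) (σ : Equiv.Perm (Fin n))
    (τ : Equiv.Perm (Fin k)) : ((Ψ : Lp ℂ 2 (confMeasure m n k)) : Conf n k → ℂ) ∘ permute σ τ
      =ᵐ[confMeasure m n k] (Ψ : Lp ℂ 2 (confMeasure m n k)) :=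
  (Lp.coeFn_compMeasurePreserving (Ψ : Lp ℂ 2 (confMeasure m n k))
    (measurePreserving_permute m σ τ)).symm.trans (by rw [Ψ.2 σ τ])

theorem sector_ext {m : ℝ} {n k : ℕ} {Ψ Ψ' : Sector m n k}
    (h : ((Ψ : Lp ℂ 2 (confMeasure m n k)) : Conf n k → ℂ) =ᵐ[confMeasure m n k]
      (Ψ' : Lp ℂ 2 (confMeasure m n k))) : Ψ = Ψ' :=
  Subtype.ext (Lp.ext h)

namespace Model

variable (P : Model)

theorem spinLp_mem_sector (a : V) (L : CoverLorentz) {n k : ℕ} (Ψ : Sector P.mass n k) :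
    P.spinLp a L n k Ψ ∈ Sector P.mass n k := by
  intro σ τ
  have hp := measurePreserving_permute P.mass σ τ
  have h1 := P.coeFn_spinLp a L (Ψ : Lp ℂ 2 (confMeasure P.mass n k))
  refine Lp.ext ?_
  refine (Lp.coeFn_compMeasurePreserving _ hp).trans ?_
  refine (hp.quasiMeasurePreserving.ae_eq_comp h1).trans ?_
  refine Filter.EventuallyEq.trans (Filter.Eventually.of_forall fun x => ?_)
    ((P.spinAction_congr a L (coeFn_permute Ψ σ τ)).trans h1.symm)
  simp only [Function.comp_apply, spinAction_eq, spinFactor_permute]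
  rfl

/-- The spin action on a sector of the Fock space. -/
def spinSectorₗᵢ (a : V) (L : CoverLorentz) (n k : ℕ) :
    Sector P.mass n k →ₗᵢ[ℂ] Sector P.mass n k where
  toLinearMap := ((P.spinLp a L n k).toLinearMap ∘ₗ (Sector P.mass n k).subtype).codRestrict
    (Sector P.mass n k) (P.spinLp_mem_sector a L)
  norm_map' Ψ := (P.spinLp a L n k).norm_map Ψ

theorem coeFn_spinSectorₗᵢ (a : V) (L : CoverLorentz) {n k : ℕ} (Ψ : Sector P.mass n k) :
    ((P.spinSectorₗᵢ a L n k Ψ : Lp ℂ 2 (confMeasure P.mass n k)) : Conf n k → ℂ)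
      =ᵐ[confMeasure P.mass n k] P.spinAction a L (Ψ : Lp ℂ 2 (confMeasure P.mass n k)) :=
  P.coeFn_spinLp a L _

theorem spinSectorₗᵢ_mul (a a' : V) (L L' : CoverLorentz) {n k : ℕ} (Ψ : Sector P.mass n k) :
    P.spinSectorₗᵢ (a + L.act a') (L * L') n k Ψ =
      P.spinSectorₗᵢ a L n k (P.spinSectorₗᵢ a' L' n k Ψ) := by
  refine sector_ext ((P.coeFn_spinSectorₗᵢ _ _ Ψ).trans (Filter.EventuallyEq.trans ?_
    ((P.spinAction_congr a L (P.coeFn_spinSectorₗᵢ a' L' Ψ)).symm.trans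
      (P.coeFn_spinSectorₗᵢ a L _).symm)))
  filter_upwards [ae_onMassShell P.mass_pos n k] with x hx
  rw [spinAction_eq, spinAction_eq, spinAction_eq, P.spinFactor_mul a a' L L' hx, mul_assoc,
    mul_inv_rev, actConf_mul]

theorem spinSectorₗᵢ_one {n k : ℕ} (Ψ : Sector P.mass n k) :
    P.spinSectorₗᵢ 0 1 n k Ψ = Ψ := by
  refine sector_ext ((P.coeFn_spinSectorₗᵢ _ _ Ψ).trans ?_)
  filter_upwards [ae_onMassShell P.mass_pos n k] with x hx
  rw [spinAction_eq, P.spinFactor_one hx, one_mul, inv_one, actConf_one]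

/-- The spin action on a sector as a unitary operator. -/
def spinSector (a : V) (L : CoverLorentz) (n k : ℕ) :
    Sector P.mass n k ≃ₗᵢ[ℂ] Sector P.mass n k :=
  LinearIsometryEquiv.ofSurjective (P.spinSectorₗᵢ a L n k) fun Ψ =>
    ⟨P.spinSectorₗᵢ (-L⁻¹.act a) L⁻¹ n k Ψ, by
      rw [← spinSectorₗᵢ_mul, mul_inv_cancel, CoverLorentz.act_neg, CoverLorentz.act_act_inv,
        add_neg_cancel, spinSectorₗᵢ_one]⟩

theorem coeFn_spinSector (a : V) (L : CoverLorentz) {n k : ℕ} (Ψ : Sector P.mass n k) :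
    ((P.spinSector a L n k Ψ : Lp ℂ 2 (confMeasure P.mass n k)) : Conf n k → ℂ)
      =ᵐ[confMeasure P.mass n k] P.spinAction a L (Ψ : Lp ℂ 2 (confMeasure P.mass n k)) :=
  P.coeFn_spinSectorₗᵢ a L Ψ

end Model

/-- The direct sum of unitary operators. -/
def lpMap {ι : Type*} {E : ι → Type*} [∀ i, NormedAddCommGroup (E i)] [∀ i, NormedSpace ℂ (E i)]
    (T : ∀ i, E i ≃ₗᵢ[ℂ] E i) : lp E 2 ≃ₗᵢ[ℂ] lp E 2 where
  toFun Ψ := ⟨fun i => T i (Ψ i), (lp.memℓp Ψ).mono' fun i => ((T i).norm_map (Ψ i)).le⟩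
  invFun Ψ := ⟨fun i => (T i).symm (Ψ i),
    (lp.memℓp Ψ).mono' fun i => ((T i).symm.norm_map (Ψ i)).le⟩
  left_inv Ψ := lp.ext (funext fun i => (T i).symm_apply_apply _)
  right_inv Ψ := lp.ext (funext fun i => (T i).apply_symm_apply _)
  map_add' Ψ Ψ' := lp.ext (funext fun i => (T i).map_add _ _)
  map_smul' c Ψ := lp.ext (funext fun i => (T i).map_smul _ _)
  norm_map' Ψ := by
    have h2 : 0 < (2 : ENNReal).toReal := by simp
    rw [lp.norm_eq_tsum_rpow h2, lp.norm_eq_tsum_rpow h2]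
    congr 1
    exact tsum_congr fun i => congrArg (· ^ _) ((T i).norm_map _)

theorem lpMap_apply {ι : Type*} {E : ι → Type*} [∀ i, NormedAddCommGroup (E i)]
    [∀ i, NormedSpace ℂ (E i)] (T : ∀ i, E i ≃ₗᵢ[ℂ] E i) (Ψ : lp E 2) (i : ι) :
    lpMap T Ψ i = T i (Ψ i) := rfl

namespace Model

variable (P : Model)

/-- The spin representation on the Fock space. -/
def spinFock (a : V) (L : CoverLorentz) : Fock P.mass ≃ₗᵢ[ℂ] Fock P.mass :=
  lpMap fun i => P.spinSector a L i.1 i.2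

theorem isSpinRepresentation_spinFock : P.IsSpinRepresentation P.spinFock where
  mul a a' L L' Ψ := lp.ext (funext fun i => P.spinSectorₗᵢ_mul a a' L L' (Ψ i))
  formula a L Ψ n k := P.coeFn_spinSector a L (Ψ (n, k))

theorem spinFock_mem_finiteParticle (a : V) (L : CoverLorentz) {Ψ : Fock P.mass}
    (h : Ψ ∈ FiniteParticle P.mass) : P.spinFock a L Ψ ∈ FiniteParticle P.mass :=
  Set.Finite.subset h fun i hi h0 => hi (by rw [spinFock, lpMap_apply, h0, map_zero])

end Model

/-! ### Covariance of the deformed fields -/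

theorem coeFn_chargeConj {m : ℝ} {n k : ℕ} (Ψ : Sector m k n) :
    ((chargeConj m n k Ψ : Lp ℂ 2 (confMeasure m n k)) : Conf n k → ℂ)
      =ᵐ[confMeasure m n k] ((Ψ : Lp ℂ 2 (confMeasure m k n)) : Conf k n → ℂ) ∘ Prod.swap :=
  Lp.coeFn_compMeasurePreserving (Ψ : Lp ℂ 2 (confMeasure m k n))
    (measurePreserving_swap_conf m n k)

namespace Model

variable (P : Model)

/-- The deformed annihilation operator of particles on functions. -/
def annihilateFun (W : PathOfWedges) (φ : V → ℂ) (n k : ℕ) (ψ : Conf (n + 1) k → ℂ)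
    (x : Conf n k) : ℂ :=
  ((√(n + 1) : ℝ) : ℂ) * ∫ p, conj (φ p) * P.kernel W n k p x * ψ (Fin.cons p x.1, x.2)
    ∂shellMeasure P.mass

theorem coeFn_annihilate (W : PathOfWedges) (φ : OneParticle P.mass) {n k : ℕ}
    (Ψ : Sector P.mass (n + 1) k) {φ₁ : V → ℂ} (hφ : φ =ᵐ[shellMeasure P.mass] φ₁)
    {ψ : Conf (n + 1) k → ℂ} (hψ : ((Ψ : Lp ℂ 2 (confMeasure P.mass (n + 1) k)) :
      Conf (n + 1) k → ℂ) =ᵐ[confMeasure P.mass (n + 1) k] ψ) :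
    ((P.annihilate W φ n k Ψ : Lp ℂ 2 (confMeasure P.mass n k)) : Conf n k → ℂ)
      =ᵐ[confMeasure P.mass n k] P.annihilateFun W φ₁ n k ψ := by
  have hi := measurePreserving_insertParticle P.mass n k
  set Ξ := Lp.compMeasurePreserving insertParticle hi (Ψ : Lp ℂ 2 (confMeasure P.mass (n + 1) k))
  have hΞ : Ξ =ᵐ[(confMeasure P.mass n k).prod (shellMeasure P.mass)] ψ ∘ insertParticle :=
    (Lp.coeFn_compMeasurePreserving _ hi).trans (hi.quasiMeasurePreserving.ae_eq_comp hψ)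
  have hc := (coeFn_contract φ (P.kernel W n k) (P.measurable_kernel W n k)
    (P.norm_kernel_le W n k) Ξ).trans (contractFun_congr hΞ)
  refine (Lp.coeFn_smul ((√(n + 1) : ℝ) : ℂ) (contract φ (P.kernel W n k)
    (P.measurable_kernel W n k) (P.norm_kernel_le W n k) Ξ)).trans ?_
  filter_upwards [hc] with x hx
  rw [Pi.smul_apply, hx, smul_eq_mul, annihilateFun, contractFun]
  congr 1
  refine integral_congr_ae ?_
  filter_upwards [hφ] with p hp
  rw [hp]
  rfl

theorem spinSector_chargeConj (a : V) (L : CoverLorentz) {n k : ℕ} (Ψ : Sector P.mass k n) :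
    P.spinSector a L n k (chargeConj P.mass n k Ψ) =
      chargeConj P.mass n k (P.spinSector a L k n Ψ) := by
  refine sector_ext ((P.coeFn_spinSector a L _).trans
    ((P.spinAction_congr a L (coeFn_chargeConj Ψ)).trans (Filter.EventuallyEq.trans ?_
      (((measurePreserving_swap_conf P.mass n k).quasiMeasurePreserving.ae_eq_comp
        (P.coeFn_spinSector a L Ψ)).symm.trans (coeFn_chargeConj _).symm))))
  refine Filter.Eventually.of_forall fun x => ?_
  simp only [Function.comp_apply, spinAction, Prod.fst_swap, Prod.snd_swap]
  rw [add_comm (∑ j, x.2 j)]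
  congr 4
  push_cast
  ring

/-- The Poincaré action on wave functions of one spinless particle. -/
def scalarAction (a : V) (L : CoverLorentz) (φ : V → ℂ) (p : V) : ℂ :=
  Complex.exp (Complex.I * (mdot a p : ℝ)) * φ (L⁻¹.act p)

theorem conj_exp_I_mul (t : ℝ) : conj (Complex.exp (Complex.I * (t : ℝ))) =
    Complex.exp (-(Complex.I * (t : ℝ))) := by
  rw [← Complex.exp_conj]; simp

/-- Covariance of the deformation kernels: the Wigner rotations in the intertwiners turn the
multiplier with `n + 1` particles into the one with `n` particles. -/
theorem kernel_smul (a : V) (L : CoverLorentz) (W : PathOfWedges) {n k : ℕ} {p : V}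
    (hp : p ∈ massShell P.mass) {x : Conf n k} (hx : OnMassShell P.mass x) :
    conj (Complex.exp (Complex.I * (mdot a p : ℝ))) * P.kernel (L • W) n k p x *
      P.spinFactor a L (n := n + 1) (k := k) (Fin.cons p x.1, x.2) =
    P.spinFactor a L x * P.kernel W n k (L⁻¹.act p) (actConf L⁻¹ x) := by
  have h1 : ∀ i, P.u (L • W) (x.1 i) = Complex.exp (-(Complex.I * (P.spin *
      wigner P.mass L (x.1 i) : ℝ))) * P.u W (L⁻¹.act (x.1 i)) := fun i => P.u_smul L W (hx.1 i)
  have h2 : ∀ i, P.u (L • W) (x.2 i) = Complex.exp (-(Complex.I * (P.spin *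
      wigner P.mass L (x.2 i) : ℝ))) * P.u W (L⁻¹.act (x.2 i)) := fun i => P.u_smul L W (hx.2 i)
  have h3 : ∀ t : ℝ, conj (Complex.exp (-(Complex.I * (t : ℝ)))) = Complex.exp (Complex.I * t) :=
    fun t => by rw [← Complex.exp_conj]; simp
  simp only [kernel, P.u_smul L W hp, h1, h2, mdot_Q_smul, map_mul, h3, mul_zpow,
    Finset.prod_mul_distrib, ← Complex.exp_sum, ← Complex.exp_int_mul, conj_exp_I_mul,
    spinFactor, Fin.sum_univ_succ, Fin.cons_zero, Fin.cons_succ, actConf]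
  have e : Complex.exp (-(Complex.I * (mdot a p : ℝ))) *
      Complex.exp ((((n : ℤ) - k + 1 : ℤ) : ℂ) * -(Complex.I * (P.spin * wigner P.mass L p : ℝ))) *
      Complex.exp (∑ i, -(Complex.I * (P.spin * wigner P.mass L (x.1 i) : ℝ))) *
      Complex.exp (∑ i, Complex.I * ((P.spin * wigner P.mass L (x.2 i) : ℝ) : ℂ)) *
      (Complex.exp (Complex.I * (mdot a (p + ∑ i, x.1 i + ∑ j, x.2 j) : ℝ)) *
        Complex.exp (Complex.I * (P.spin * (((n + 1 : ℕ) : ℝ) - k) *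
          (wigner P.mass L p + ∑ i, wigner P.mass L (x.1 i) -
            ∑ j, wigner P.mass L (x.2 j)) : ℝ))) =
      Complex.exp (Complex.I * (mdot a (∑ i, x.1 i + ∑ j, x.2 j) : ℝ)) *
        Complex.exp (Complex.I * (P.spin * ((n : ℝ) - k) *
          (∑ i, wigner P.mass L (x.1 i) - ∑ j, wigner P.mass L (x.2 j)) : ℝ)) := by
    simp only [← Complex.exp_add]
    congr 1
    simp only [mdot_add_right, Finset.sum_neg_distrib, ← Finset.mul_sum]
    push_cast
    simp only [← Finset.mul_sum]
    ring
  rw [← e]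
  ring

/-- Covariance of the annihilation operators of particles. -/
theorem spinSector_annihilate (a : V) (L : CoverLorentz) (W : PathOfWedges)
    {φ φ' : OneParticle P.mass}
    (hφ : φ' =ᵐ[shellMeasure P.mass] scalarAction a L φ) {n k : ℕ}
    (Ψ : Sector P.mass (n + 1) k) :
    P.spinSector a L n k (P.annihilate W φ n k Ψ) =
      P.annihilate (L • W) φ' n k (P.spinSector a L (n + 1) k Ψ) := by
  refine sector_ext ((P.coeFn_spinSector a L _).trans ((P.spinAction_congr a L
    (P.coeFn_annihilate W φ Ψ Filter.EventuallyEq.rfl Filter.EventuallyEq.rfl)).trans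
    (Filter.EventuallyEq.trans ?_ (P.coeFn_annihilate (L • W) φ' _ hφ
      (P.coeFn_spinSector a L Ψ)).symm)))
  filter_upwards [ae_onMassShell P.mass_pos n k] with x hx
  rw [spinAction_eq, annihilateFun, annihilateFun, mul_left_comm]
  congr 1
  have hL := CoverLorentz.measurePreserving_act P.mass_pos L⁻¹
  have hme : MeasurableEmbedding L⁻¹.act :=
    (CoverLorentz.actEquiv L⁻¹).toHomeomorph.measurableEmbedding
  rw [← hL.integral_comp hme, ← integral_const_mul]
  refine integral_congr_ae ?_
  filter_upwards [ae_mem_massShell P.mass_pos] with p hp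
  have h := P.kernel_smul a L W hp hx
  rw [spinAction_eq, scalarAction, map_mul]
  have hc : actConf (n := n + 1) (k := k) L⁻¹ (Fin.cons p x.1, x.2) =
      (Fin.cons (L⁻¹.act p) (actConf L⁻¹ x).1, (actConf L⁻¹ x).2) := by
    refine Prod.ext (funext fun i => ?_) rfl
    refine Fin.cases rfl (fun i => rfl) i
  rw [hc]
  linear_combination (-(conj (φ (L⁻¹.act p)) * (Ψ : Lp ℂ 2 (confMeasure P.mass (n + 1) k))
    (Fin.cons (L⁻¹.act p) (actConf L⁻¹ x).1, (actConf L⁻¹ x).2))) * h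

theorem spinSector_annihilateAnti (a : V) (L : CoverLorentz) (W : PathOfWedges)
    {φ φ' : OneParticle P.mass}
    (hφ : φ' =ᵐ[shellMeasure P.mass] scalarAction a L φ) {n k : ℕ}
    (Ψ : Sector P.mass n (k + 1)) :
    P.spinSector a L n k (P.annihilateAnti W φ n k Ψ) =
      P.annihilateAnti (L • W) φ' n k (P.spinSector a L n (k + 1) Ψ) := by
  simp only [annihilateAnti, ContinuousLinearMap.comp_apply]
  rw [spinSector_chargeConj, P.spinSector_annihilate a L W hφ, spinSector_chargeConj]

end Model

/-- An intertwining relation passes to the adjoints. -/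
theorem adjoint_intertwine {H K : Type*} [NormedAddCommGroup H] [NormedAddCommGroup K]
    [InnerProductSpace ℂ H] [InnerProductSpace ℂ K] [CompleteSpace H] [CompleteSpace K]
    (U : H ≃ₗᵢ[ℂ] H) (U' : K ≃ₗᵢ[ℂ] K) (A B : H →L[ℂ] K) (h : ∀ x, U' (A x) = B (U x)) (y : K) :
    U (ContinuousLinearMap.adjoint A y) = ContinuousLinearMap.adjoint B (U' y) := by
  refine ext_inner_right ℂ fun z => ?_
  obtain ⟨x, rfl⟩ := U.surjective z
  rw [U.inner_map_map, ContinuousLinearMap.adjoint_inner_left,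
    ContinuousLinearMap.adjoint_inner_left, ← h, U'.inner_map_map]

namespace Model

variable (P : Model)

theorem spinSector_create (a : V) (L : CoverLorentz) (W : PathOfWedges)
    {φ φ' : OneParticle P.mass}
    (hφ : φ' =ᵐ[shellMeasure P.mass] scalarAction a L φ) {n k : ℕ} (Ψ : Sector P.mass n k) :
    P.spinSector a L (n + 1) k (P.create W φ n k Ψ) =
      P.create (L • W) φ' n k (P.spinSector a L n k Ψ) :=
  adjoint_intertwine _ _ _ _ (P.spinSector_annihilate a L W hφ) Ψ

theorem spinSector_createAnti (a : V) (L : CoverLorentz) (W : PathOfWedges)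
    {φ φ' : OneParticle P.mass}
    (hφ : φ' =ᵐ[shellMeasure P.mass] scalarAction a L φ) {n k : ℕ} (Ψ : Sector P.mass n k) :
    P.spinSector a L n (k + 1) (P.createAnti W φ n k Ψ) =
      P.createAnti (L • W) φ' n k (P.spinSector a L n k Ψ) :=
  adjoint_intertwine _ _ _ _ (P.spinSector_annihilateAnti a L W hφ) Ψ

end Model

theorem fPlus_poincareTest (a : V) (L : CoverLorentz) (f : SchwartzTest) (p : V) :
    fPlus (poincareTest a L f) p = Model.scalarAction a L (fPlus f) p := by
  have hme : MeasurableEmbedding L.act :=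
    (CoverLorentz.actEquiv L).toHomeomorph.measurableEmbedding
  rw [Model.scalarAction, fPlus, fPlus, ← integral_add_right_eq_self _ a,
    ← L.volume_preserving_act.integral_comp hme, ← integral_const_mul]
  congr 1
  ext x
  rw [poincareTest_apply, add_sub_cancel_right, CoverLorentz.act_inv_act, mdot_add_right,
    mdot_comm p (L.act x), CoverLorentz.mdot_act_left, mdot_comm x, mdot_comm p a]
  push_cast
  rw [mul_add, Complex.exp_add]
  ring

namespace Model

variable (P : Model)

theorem coeFn_plus (f : SchwartzTest) : P.plus f =ᵐ[shellMeasure P.mass] fPlus f :=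
  MemLp.coeFn_toLp (fPlus_memLp P.mass_pos f)

theorem plus_poincareTest (a : V) (L : CoverLorentz) (f : SchwartzTest) :
    P.plus (poincareTest a L f) =ᵐ[shellMeasure P.mass] scalarAction a L (P.plus f) := by
  refine (P.coeFn_plus _).trans ?_
  filter_upwards [(CoverLorentz.measurePreserving_act P.mass_pos
    L⁻¹).quasiMeasurePreserving.ae (P.coeFn_plus f)] with p hp
  rw [fPlus_poincareTest, scalarAction, scalarAction, hp]

theorem spinFock_field (a : V) (L : CoverLorentz) (W : PathOfWedges) (f : SchwartzTest)
    (Ψ Ψ' : FiniteParticle P.mass) (h : (Ψ' : Fock P.mass) = P.spinFock a L Ψ) :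
    P.spinFock a L (P.field W f Ψ) = P.field (L • W) (poincareTest a L f) Ψ' := by
  refine lp.ext (funext fun i => ?_)
  obtain ⟨n, k⟩ := i
  have hc : ∀ n k, (Ψ' : Fock P.mass) (n, k) =
      P.spinSector a L n k ((Ψ : Fock P.mass) (n, k)) := fun n k => by rw [h]; rfl
  have hb := P.spinSector_annihilateAnti a L W (P.plus_poincareTest a L (conjTest f))
    ((Ψ : Fock P.mass) (n, k + 1))
  rw [← hc] at hb
  cases n with
  | zero =>
    refine ((P.spinSector a L 0 k).map_add 0 _).trans ?_
    rw [map_zero]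
    exact congrArg (0 + ·) hb
  | succ n =>
    have ha := P.spinSector_create a L W (P.plus_poincareTest a L f) ((Ψ : Fock P.mass) (n, k))
    rw [← hc] at ha
    exact ((P.spinSector a L (n + 1) k).map_add _ _).trans (congrArg₂ (· + ·) ha hb)

theorem spinFock_fieldStar (a : V) (L : CoverLorentz) (W : PathOfWedges) (f : SchwartzTest)
    (Ψ Ψ' : FiniteParticle P.mass) (h : (Ψ' : Fock P.mass) = P.spinFock a L Ψ) :
    P.spinFock a L (P.fieldStar W f Ψ) = P.fieldStar (L • W) (poincareTest a L f) Ψ' := by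
  refine lp.ext (funext fun i => ?_)
  obtain ⟨n, k⟩ := i
  have hc : ∀ n k, (Ψ' : Fock P.mass) (n, k) =
      P.spinSector a L n k ((Ψ : Fock P.mass) (n, k)) := fun n k => by rw [h]; rfl
  have hb := P.spinSector_annihilate a L W (P.plus_poincareTest a L (conjTest f))
    ((Ψ : Fock P.mass) (n + 1, k))
  rw [← hc] at hb
  cases k with
  | zero =>
    refine ((P.spinSector a L n 0).map_add 0 _).trans ?_
    rw [map_zero]
    exact congrArg (0 + ·) hb
  | succ k =>
    have ha := P.spinSector_createAnti a L W (P.plus_poincareTest a L f) ((Ψ : Fock P.mass) (n, k))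
    rw [← hc] at ha
    exact ((P.spinSector a L n (k + 1)).map_add _ _).trans (congrArg₂ (· + ·) ha hb)

end Model

/-! ### The creation operators as functions of the momenta -/

theorem MeasureTheory.MeasurePreserving.integral_comp_aesm {α β : Type*} [MeasurableSpace α]
    [MeasurableSpace β] {μ : Measure α} {ν : Measure β} {g : α → β} (hg : MeasurePreserving g μ ν)
    {f : β → ℂ} (hf : AEStronglyMeasurable f ν) : ∫ x, f (g x) ∂μ = ∫ y, f y ∂ν := by
  rw [← hg.map_eq] at hf ⊢
  exact (integral_map hg.measurable.aemeasurable hf).symm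

/-- Square integrability of almost all slices. -/
theorem ae_memLp_slice {α β : Type*} [MeasurableSpace α] [MeasurableSpace β] {μ : Measure α}
    {ν : Measure β} [SFinite μ] [SFinite ν] {Ψ : α × β → ℂ} (h : MemLp Ψ 2 (μ.prod ν)) :
    ∀ᵐ x ∂μ, MemLp (fun y => Ψ (x, y)) 2 ν := by
  filter_upwards [((memLp_two_iff_integrable_sq_norm h.1).1 h).prod_right_ae, h.1.prodMk_left]
    with x h1 h2
  exact (memLp_two_iff_integrable_sq_norm h2).2 h1

theorem measurable_uncurry_swap {α β γ : Type*} [MeasurableSpace α] [MeasurableSpace β]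
    [MeasurableSpace γ] {K : α → β → γ} (hK : Measurable (Function.uncurry K)) :
    Measurable fun w : β × α => K w.2 w.1 := hK.comp measurable_swap

theorem memLp_tensor {α β : Type*} [MeasurableSpace α] [MeasurableSpace β] {μ : Measure α}
    {ν : Measure β} [SFinite μ] [SFinite ν] {f : α → ℂ} {g : β → ℂ} (hf : MemLp f 2 μ)
    (hg : MemLp g 2 ν) : MemLp (fun z : α × β => f z.1 * g z.2) 2 (μ.prod ν) := by
  have hm : AEStronglyMeasurable (fun z : α × β => f z.1 * g z.2) (μ.prod ν) :=
    hf.1.comp_fst.mul hg.1.comp_snd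
  refine (memLp_two_iff_integrable_sq_norm hm).2 ?_
  refine (((memLp_two_iff_integrable_sq_norm hf.1).1 hf).mul_prod
    ((memLp_two_iff_integrable_sq_norm hg.1).1 hg)).congr (Filter.Eventually.of_forall fun z => ?_)
  simp only [norm_mul, mul_pow]

/-- The configuration without the particle number `i`, and the momentum of this particle. -/
def splitAt {n k : ℕ} (i : Fin (n + 1)) (z : Conf (n + 1) k) : Conf n k × V :=
  ((fun j => z.1 (i.succAbove j), z.2), z.1 i)

theorem measurePreserving_splitAt (m : ℝ) {n k : ℕ} (i : Fin (n + 1)) :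
    MeasurePreserving (splitAt (n := n) (k := k) i) (confMeasure m (n + 1) k)
      ((confMeasure m n k).prod (shellMeasure m)) := by
  have h1 := measurePreserving_piFinSuccAbove (α := fun _ : Fin (n + 1) => V)
      (fun _ => shellMeasure m) i
  have h2 : MeasurePreserving (Prod.swap : V × Conf n k → Conf n k × V)
      ((shellMeasure m).prod (confMeasure m n k)) ((confMeasure m n k).prod (shellMeasure m)) :=
    Measure.measurePreserving_swap
  have h3 := measurePreserving_prodAssoc (shellMeasure m)
    (Measure.pi fun _ : Fin n => shellMeasure m) (Measure.pi fun _ : Fin k => shellMeasure m)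
  exact h2.comp (h3.comp (h1.prod (MeasurePreserving.id _)))

theorem measurePreserving_removeAt (m : ℝ) {n k : ℕ} (i : Fin (n + 1)) :
    Measure.QuasiMeasurePreserving (fun z : Conf (n + 1) k => (splitAt i z).1)
      (confMeasure m (n + 1) k) (confMeasure m n k) :=
  Measure.quasiMeasurePreserving_fst.comp (measurePreserving_splitAt m i).quasiMeasurePreserving

theorem splitAt_zero_insertParticle {n k : ℕ} (w : Conf n k × V) :
    splitAt 0 (insertParticle w) = w := by
  simp [splitAt, insertParticle]

theorem splitAt_eq {n k : ℕ} (i : Fin (n + 1)) (z : Conf (n + 1) k) :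
    splitAt i z = splitAt 0 (permute i.cycleRange.symm 1 z) := by
  simp [splitAt, permute, Function.comp_def]

theorem exists_perm_succAbove {n : ℕ} (σ : Equiv.Perm (Fin (n + 1))) (i : Fin (n + 1)) :
    ∃ σ' : Equiv.Perm (Fin n), ∀ j, (σ i).succAbove (σ' j) = σ (i.succAbove j) := by
  refine ⟨(finSuccAboveEquiv i).trans ((σ.subtypeEquiv (fun a => by simp)).trans
    (finSuccAboveEquiv (σ i)).symm), fun j => ?_⟩
  have h := (finSuccAboveEquiv (σ i)).apply_symm_apply
    ⟨σ (i.succAbove j), fun h => Fin.succAbove_ne i j (σ.injective h)⟩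
  exact congrArg Subtype.val h

namespace Model

variable (P : Model)

/-- The term of the deformed creation operator in which particle number `i` is created. -/
def createFun (W : PathOfWedges) (φ : V → ℂ) {n k : ℕ} (ψ : Conf n k → ℂ) (i : Fin (n + 1))
    (z : Conf (n + 1) k) : ℂ :=
  φ (z.1 i) * conj (P.kernel W n k (z.1 i) (splitAt i z).1) * ψ (splitAt i z).1

theorem memLp_createProd (W : PathOfWedges) {φ : V → ℂ} (hφ : MemLp φ 2 (shellMeasure P.mass))
    {n k : ℕ} {ψ : Conf n k → ℂ} (hψ : MemLp ψ 2 (confMeasure P.mass n k)) :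
    MemLp (fun w : Conf n k × V => φ w.2 * conj (P.kernel W n k w.2 w.1) * ψ w.1) 2
      ((confMeasure P.mass n k).prod (shellMeasure P.mass)) := by
  have hK : Measurable fun w : Conf n k × V => P.kernel W n k w.2 w.1 :=
    measurable_uncurry_swap (P.measurable_kernel W n k)
  have h1 : AEStronglyMeasurable (fun w : Conf n k × V => φ w.2)
      ((confMeasure P.mass n k).prod (shellMeasure P.mass)) := hφ.1.comp_snd
  have h2 : AEStronglyMeasurable (fun w : Conf n k × V => conj (P.kernel W n k w.2 w.1))
      ((confMeasure P.mass n k).prod (shellMeasure P.mass)) :=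
    (Complex.continuous_conj.measurable.comp hK).aestronglyMeasurable
  have h3 : AEStronglyMeasurable (fun w : Conf n k × V => ψ w.1)
      ((confMeasure P.mass n k).prod (shellMeasure P.mass)) := hψ.1.comp_fst
  refine (memLp_tensor hψ hφ).of_le ((h1.mul h2).mul h3) (Filter.Eventually.of_forall fun w => ?_)
  rw [norm_mul, norm_mul, norm_mul, RCLike.norm_conj, mul_comm ‖ψ w.1‖]
  refine mul_le_mul_of_nonneg_right ?_ (norm_nonneg _)
  exact mul_le_of_le_one_right (norm_nonneg _) (P.norm_kernel_le W n k _ _)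

theorem memLp_createFun (W : PathOfWedges) {φ : V → ℂ} (hφ : MemLp φ 2 (shellMeasure P.mass))
    {n k : ℕ} {ψ : Conf n k → ℂ} (hψ : MemLp ψ 2 (confMeasure P.mass n k)) (i : Fin (n + 1)) :
    MemLp (P.createFun W φ ψ i) 2 (confMeasure P.mass (n + 1) k) :=
  (P.memLp_createProd W hφ hψ).comp_measurePreserving (measurePreserving_splitAt P.mass i)

theorem createFun_eq (W : PathOfWedges) (φ : V → ℂ) {n k : ℕ} (ψ : Conf n k → ℂ)
    (i : Fin (n + 1)) (z : Conf (n + 1) k) :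
    P.createFun W φ ψ i z = P.createFun W φ ψ 0 (permute i.cycleRange.symm 1 z) := by
  have h := splitAt_eq i z
  have h2 : z.1 i = (permute i.cycleRange.symm 1 z).1 0 := congrArg Prod.snd h
  rw [createFun, createFun, h, h2]

theorem createFun_permute (W : PathOfWedges) (φ : V → ℂ) {n k : ℕ} (Ψ : Sector P.mass n k)
    (σ : Equiv.Perm (Fin (n + 1))) (τ : Equiv.Perm (Fin k)) (i : Fin (n + 1)) :
    (fun z => P.createFun W φ (Ψ : Lp ℂ 2 (confMeasure P.mass n k)) i (permute σ τ z))
      =ᵐ[confMeasure P.mass (n + 1) k]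
        P.createFun W φ (Ψ : Lp ℂ 2 (confMeasure P.mass n k)) (σ i) := by
  obtain ⟨σ', hσ'⟩ := exists_perm_succAbove σ i
  filter_upwards [(measurePreserving_removeAt P.mass (σ i)).ae (coeFn_permute Ψ σ' τ)] with z hz
  have h : (splitAt i (permute σ τ z)).1 = permute σ' τ (splitAt (σ i) z).1 := by
    simp [splitAt, permute, Function.comp_def, hσ']
  rw [createFun, createFun, h, P.kernel_permute]
  rw [Function.comp_apply] at hz
  rw [hz]
  rfl

/-- Each term of the sum in `coeFn_create` contributes equally to the matrix elements of the
adjoint of the annihilation operator. -/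
theorem inner_createFun (W : PathOfWedges) (φ : OneParticle P.mass) {n k : ℕ}
    (Ψ : Sector P.mass n k) (χ : Sector P.mass (n + 1) k) (i : Fin (n + 1)) :
    ((√(n + 1) : ℝ) : ℂ) * ∫ z, P.createFun W φ (Ψ : Lp ℂ 2 (confMeasure P.mass n k)) i z *
      conj ((χ : Lp ℂ 2 (confMeasure P.mass (n + 1) k)) z) ∂confMeasure P.mass (n + 1) k =
    inner ℂ (P.annihilate W φ n k χ) Ψ := by
  have hφ := Lp.memLp φ
  have hΨ := Lp.memLp (Ψ : Lp ℂ 2 (confMeasure P.mass n k))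
  have hχ := Lp.memLp (χ : Lp ℂ 2 (confMeasure P.mass (n + 1) k))
  have hχc : AEStronglyMeasurable (fun z => conj ((χ : Lp ℂ 2 (confMeasure P.mass (n + 1) k)) z))
      (confMeasure P.mass (n + 1) k) := Complex.continuous_conj.comp_aestronglyMeasurable hχ.1
  have hF := (P.memLp_createFun W hφ hΨ 0).1.mul hχc
  -- by the symmetry of `χ`, all the terms give the same
  have h1 : ∫ z, P.createFun W φ (Ψ : Lp ℂ 2 (confMeasure P.mass n k)) i z *
      conj ((χ : Lp ℂ 2 (confMeasure P.mass (n + 1) k)) z) ∂confMeasure P.mass (n + 1) k =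
      ∫ z, P.createFun W φ (Ψ : Lp ℂ 2 (confMeasure P.mass n k)) 0 z *
      conj ((χ : Lp ℂ 2 (confMeasure P.mass (n + 1) k)) z) ∂confMeasure P.mass (n + 1) k := by
    refine Eq.trans ?_ ((measurePreserving_permute P.mass i.cycleRange.symm
      1).integral_comp_aesm hF)
    refine integral_congr_ae ?_
    filter_upwards [coeFn_permute χ i.cycleRange.symm 1] with z hz
    rw [Function.comp_apply] at hz
    rw [createFun_eq, ← hz]
  have hi := measurePreserving_insertParticle P.mass n k
  have hprod := (P.memLp_createProd W hφ hΨ)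
  have hχi : MemLp (fun w => conj ((χ : Lp ℂ 2 (confMeasure P.mass (n + 1) k))
      (insertParticle w))) 2 ((confMeasure P.mass n k).prod (shellMeasure P.mass)) :=
    (hχ.comp_measurePreserving hi).star
  have hint := hprod.integrable_mul hχi
  have h2 := (hi.integral_comp_aesm hF).symm.trans (integral_congr_ae
    (Filter.Eventually.of_forall fun w => ?_) |>.trans (integral_prod _ hint))
  swap
  · simp only [Pi.mul_apply, createFun, splitAt_zero_insertParticle]
    rfl
  rw [h1]
  refine (congrArg _ h2).trans ?_
  change _ = inner ℂ ((P.annihilate W φ n k χ : Lp ℂ 2 (confMeasure P.mass n k)))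
    (Ψ : Lp ℂ 2 (confMeasure P.mass n k))
  rw [L2.inner_def, ← integral_const_mul]
  refine integral_congr_ae ?_
  filter_upwards [P.coeFn_annihilate W φ χ Filter.EventuallyEq.rfl Filter.EventuallyEq.rfl]
    with x hx
  rw [hx, RCLike.inner_apply, annihilateFun, map_mul, Complex.conj_ofReal, mul_left_comm]
  congr 1
  rw [← integral_conj, ← integral_const_mul]
  refine integral_congr_ae (Filter.Eventually.of_forall fun p => ?_)
  simp only [Pi.mul_apply, map_mul, Complex.conj_conj, insertParticle]
  ring

/-- The deformed creation operators as functions of the momenta: the adjoint of the annihilation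
operator symmetrizes over the particle which is created. -/
theorem coeFn_create (W : PathOfWedges) (φ : OneParticle P.mass) {n k : ℕ}
    (Ψ : Sector P.mass n k) :
    ((P.create W φ n k Ψ : Lp ℂ 2 (confMeasure P.mass (n + 1) k)) : Conf (n + 1) k → ℂ)
      =ᵐ[confMeasure P.mass (n + 1) k] fun z => ((√(n + 1) : ℝ) : ℂ)⁻¹ *
        ∑ i, P.createFun W φ (Ψ : Lp ℂ 2 (confMeasure P.mass n k)) i z := by
  have hφ := Lp.memLp φ
  have hΨ := Lp.memLp (Ψ : Lp ℂ 2 (confMeasure P.mass n k))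
  have hmem : MemLp (fun z => ∑ i, P.createFun W φ (Ψ : Lp ℂ 2 (confMeasure P.mass n k)) i z) 2
      (confMeasure P.mass (n + 1) k) :=
    memLp_finsetSum _ fun i _ => P.memLp_createFun W hφ hΨ i
  have hmem' := hmem.const_mul ((√(n + 1) : ℝ) : ℂ)⁻¹
  have hsym : hmem'.toLp _ ∈ Sector P.mass (n + 1) k := by
    intro σ τ
    have hp := measurePreserving_permute P.mass σ τ
    refine Lp.ext ((Lp.coeFn_compMeasurePreserving _ hp).trans
      ((hp.quasiMeasurePreserving.ae_eq_comp hmem'.coeFn_toLp).trans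
      (Filter.EventuallyEq.trans ?_ hmem'.coeFn_toLp.symm)))
    filter_upwards [ae_all_iff.2 (P.createFun_permute W φ Ψ σ τ)] with z hz
    simp only [Function.comp_apply, hz]
    rw [Equiv.sum_comp σ fun i => P.createFun W φ (Ψ : Lp ℂ 2 (confMeasure P.mass n k)) i z]
  have heq : P.create W φ n k Ψ = ⟨hmem'.toLp _, hsym⟩ := by
    refine ext_inner_left ℂ fun χ => ?_
    rw [create, ContinuousLinearMap.adjoint_inner_right]
    change _ = inner ℂ (χ : Lp ℂ 2 (confMeasure P.mass (n + 1) k)) (hmem'.toLp _)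
    rw [L2.inner_def]
    have hχ := Lp.memLp (χ : Lp ℂ 2 (confMeasure P.mass (n + 1) k))
    have hs : ∀ i, Integrable (fun z => P.createFun W φ (Ψ : Lp ℂ 2 (confMeasure P.mass n k)) i z *
        conj ((χ : Lp ℂ 2 (confMeasure P.mass (n + 1) k)) z)) (confMeasure P.mass (n + 1) k) :=
      fun i => (P.memLp_createFun W hφ hΨ i).integrable_mul hχ.star
    have h1 : ∫ z, inner ℂ ((χ : Lp ℂ 2 (confMeasure P.mass (n + 1) k)) z) (hmem'.toLp _ z)
        ∂confMeasure P.mass (n + 1) k = ((√(n + 1) : ℝ) : ℂ)⁻¹ * ∑ i,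
        ∫ z, P.createFun W φ (Ψ : Lp ℂ 2 (confMeasure P.mass n k)) i z *
        conj ((χ : Lp ℂ 2 (confMeasure P.mass (n + 1) k)) z) ∂confMeasure P.mass (n + 1) k := by
      rw [← integral_finsetSum _ fun i _ => hs i, ← integral_const_mul]
      refine integral_congr_ae ?_
      filter_upwards [hmem'.coeFn_toLp] with z hz
      rw [hz, RCLike.inner_apply, mul_assoc, Finset.sum_mul]
    rw [h1]
    have h0 : (((√(n + 1) : ℝ) : ℂ)) ≠ 0 := by
      rw [Complex.ofReal_ne_zero]; positivity
    have hsq : ((√(n + 1) : ℝ) : ℂ) * ((√(n + 1) : ℝ) : ℂ) = n + 1 := by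
      rw [← Complex.ofReal_mul, Real.mul_self_sqrt (by positivity)]; push_cast; rfl
    have h2 := fun i => P.inner_createFun W φ Ψ χ i
    have h3 := Finset.sum_congr (rfl : (Finset.univ : Finset (Fin (n + 1))) = _) fun i _ => h2 i
    rw [← Finset.mul_sum, Finset.sum_const, Finset.card_univ, Fintype.card_fin, nsmul_eq_mul] at h3
    have h4 : (((n + 1 : ℕ) : ℂ)) = n + 1 := by push_cast; rfl
    rw [h4, ← hsq] at h3
    rw [mul_assoc] at h3
    rw [mul_left_cancel₀ h0 h3]
    field_simp
  rw [heq]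
  exact hmem'.coeFn_toLp

end Model

/-! ### Exchange relations of creation and annihilation operators for opposite wedges -/

theorem insertParticle_apply {n k : ℕ} (x : Conf n k) (p : V) :
    insertParticle (x, p) = (Fin.cons p x.1, x.2) := rfl

/-- Adding a particle of momentum `p` in front of the other antiparticles. -/
def insertAnti {n k : ℕ} (z : Conf n k × V) : Conf n (k + 1) := (z.1.1, Fin.cons z.2 z.1.2)

theorem measurePreserving_insertAnti (m : ℝ) (n k : ℕ) :
    MeasurePreserving (insertAnti (n := n) (k := k))
      ((confMeasure m n k).prod (shellMeasure m)) (confMeasure m n (k + 1)) :=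
  ((measurePreserving_swap_conf m (k + 1) n).comp (measurePreserving_insertParticle m k n)).comp
    ((measurePreserving_swap_conf m n k).prod (MeasurePreserving.id _))

/-- Fubini's theorem for contractions with two one-particle vectors: the order of the
contractions does not matter, for almost all values of the other variables. -/
theorem integral_swap_ae {Y : Type*} [MeasurableSpace Y] {ν : Measure Y} [SFinite ν]
    {μ : Measure V} [SFinite μ] {φ φ' : V → ℂ} (hφ : MemLp φ 2 μ) (hφ' : MemLp φ' 2 μ)
    {Ξ : Y × (V × V) → ℂ} (hΞ : MemLp Ξ 2 (ν.prod (μ.prod μ))) {B : Y → V × V → ℂ}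
    (hB : ∀ y, Measurable (B y)) (hb : ∀ y z, ‖B y z‖ ≤ 1) {G : Y → V → V → ℂ}
    (hG : ∀ᵐ y ∂ν, ∀ᵐ z ∂μ.prod μ, conj (φ z.1) * conj (φ' z.2) * B y z * Ξ (y, z) = G y z.2 z.1) :
    ∀ᵐ y ∂ν, ∫ p, ∫ p', conj (φ p) * conj (φ' p') * B y (p, p') * Ξ (y, (p, p')) ∂μ ∂μ =
      ∫ p', ∫ p, G y p' p ∂μ ∂μ := by
  filter_upwards [ae_memLp_slice hΞ, hG] with y hy hGy
  have ht : MemLp (fun z : V × V => conj (φ z.1) * conj (φ' z.2) * B y z) 2 (μ.prod μ) := by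
    have h := memLp_tensor hφ.star hφ'.star
    refine h.of_le (h.1.mul (hB y).aestronglyMeasurable) (Filter.Eventually.of_forall fun z => ?_)
    rw [norm_mul]
    exact mul_le_of_le_one_right (norm_nonneg _) (hb y z)
  have hint : Integrable (Function.uncurry fun p p' =>
      conj (φ p) * conj (φ' p') * B y (p, p') * Ξ (y, (p, p'))) (μ.prod μ) :=
    ht.integrable_mul hy
  rw [integral_integral_swap hint]
  have hsw := Measure.ae_ae_of_ae_prod
    ((Measure.measurePreserving_swap (μ := μ) (ν := μ)).quasiMeasurePreserving.ae hGy)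
  refine integral_congr_ae ?_
  filter_upwards [hsw] with p' hp'
  exact integral_congr_ae hp'

namespace Model

variable (P : Model)

/-- The factor of the deformation kernel due to a particle of momentum `p'`. -/
def pairFactor (W : PathOfWedges) (p p' : V) : ℂ :=
  P.u W p * P.u W p' * P.R (mdot ((P.Q W).mulVec p) p' : ℝ)

/-- The factor of the deformation kernel due to an antiparticle of momentum `p'`. -/
def antiFactor (W : PathOfWedges) (p p' : V) : ℂ :=
  (P.u W p)⁻¹ * conj (P.u W p') * P.R (mdot ((P.Q W).mulVec p) p' : ℝ)

theorem u_ne_zero (W : PathOfWedges) {p : V} (hp : p ∈ massShell P.mass) : P.u W p ≠ 0 := by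
  rw [← norm_ne_zero_iff, P.norm_u_eq_one W hp]; exact one_ne_zero

theorem conj_u_mul (W : PathOfWedges) {p : V} (hp : p ∈ massShell P.mass) :
    conj (P.u W p) * P.u W p = 1 := by
  rw [mul_comm, Complex.mul_conj, Complex.normSq_eq_norm_sq, P.norm_u_eq_one W hp]; simp

theorem kernel_eq_mul_pairFactor (W : PathOfWedges) {n k : ℕ} {p : V} (hp : p ∈ massShell P.mass)
    (z : Conf (n + 1) k) (i : Fin (n + 1)) :
    P.kernel W (n + 1) k p z = P.kernel W n k p (splitAt i z).1 * P.pairFactor W p (z.1 i) := by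
  have h : ((n + 1 : ℕ) : ℤ) - k + 1 = ((n : ℤ) - k + 1) + 1 := by push_cast; ring
  rw [kernel, kernel, pairFactor, Fin.prod_univ_succAbove _ i, h, zpow_add_one₀ (P.u_ne_zero W hp)]
  simp only [splitAt]
  ring

theorem kernel_eq_mul_antiFactor (W : PathOfWedges) {n k : ℕ} {p : V} (hp : p ∈ massShell P.mass)
    (x : Fin n → V) (y : Fin (k + 1) → V) (i : Fin (k + 1)) :
    P.kernel W n (k + 1) p (x, y) =
      P.kernel W n k p (x, fun j => y (i.succAbove j)) * P.antiFactor W p (y i) := by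
  have h : (n : ℤ) - ((k + 1 : ℕ) : ℤ) + 1 = ((n : ℤ) - k + 1) - 1 := by push_cast; ring
  rw [kernel, kernel, antiFactor, Fin.prod_univ_succAbove _ i, h, zpow_sub_one₀ (P.u_ne_zero W hp)]
  ring

theorem kernel_cons (W : PathOfWedges) {n k : ℕ} {p : V} (hp : p ∈ massShell P.mass)
    (x : Fin n → V) (y : Fin k → V) (p' : V) :
    P.kernel W (n + 1) k p (Fin.cons p' x, y) = P.kernel W n k p (x, y) * P.pairFactor W p p' :=
  P.kernel_eq_mul_pairFactor W hp (Fin.cons p' x, y) 0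

theorem kernel_cons_anti (W : PathOfWedges) {n k : ℕ} {p : V} (hp : p ∈ massShell P.mass)
    (x : Fin n → V) (y : Fin k → V) (p' : V) :
    P.kernel W n (k + 1) p (x, Fin.cons p' y) = P.kernel W n k p (x, y) * P.antiFactor W p p' :=
  P.kernel_eq_mul_antiFactor W hp x (Fin.cons p' y) 0

theorem conj_pairFactor_mul (W : PathOfWedges) {p p' : V} (hp : p ∈ massShell P.mass)
    (hp' : p' ∈ massShell P.mass) : conj (P.pairFactor W p p') * P.pairFactor W p p' = 1 := by
  simp only [pairFactor, map_mul]
  linear_combination (conj (P.u W p') * P.u W p' * (conj (P.R (mdot ((P.Q W).mulVec p) p' : ℝ)) *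
    P.R (mdot ((P.Q W).mulVec p) p' : ℝ))) * P.conj_u_mul W hp +
    (conj (P.R (mdot ((P.Q W).mulVec p) p' : ℝ)) *
    P.R (mdot ((P.Q W).mulVec p) p' : ℝ)) * P.conj_u_mul W hp' +
    P.isDeformationFunction.unimodular (mdot ((P.Q W).mulVec p) p')

theorem antiFactor_eq (W : PathOfWedges) {p : V} (hp : p ∈ massShell P.mass) (p' : V) :
    P.antiFactor W p p' = conj (P.u W p) * conj (P.u W p') *
      P.R (mdot ((P.Q W).mulVec p) p' : ℝ) := by
  rw [antiFactor, inv_eq_of_mul_eq_one_left (P.conj_u_mul W hp)]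

theorem conj_antiFactor_mul (W : PathOfWedges) {p p' : V} (hp : p ∈ massShell P.mass)
    (hp' : p' ∈ massShell P.mass) : conj (P.antiFactor W p p') * P.antiFactor W p p' = 1 := by
  simp only [P.antiFactor_eq W hp, map_mul, Complex.conj_conj]
  linear_combination (conj (P.u W p') * P.u W p' * (conj (P.R (mdot ((P.Q W).mulVec p) p' : ℝ)) *
    P.R (mdot ((P.Q W).mulVec p) p' : ℝ))) * P.conj_u_mul W hp +
    (conj (P.R (mdot ((P.Q W).mulVec p) p' : ℝ)) *
    P.R (mdot ((P.Q W).mulVec p) p' : ℝ)) * P.conj_u_mul W hp' +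
    P.isDeformationFunction.unimodular (mdot ((P.Q W).mulVec p) p')

/-- Two paths of wedges whose intertwiners differ by the phase `c` on the mass shell, and whose
deformation matrices are opposite to each other. -/
structure Opposite (W W' : PathOfWedges) (c : ℂ) : Prop where
  conj_mul : conj c * c = 1
  u_eq : ∀ p ∈ massShell P.mass, P.u W' p = c * P.u W p
  Q_eq : P.Q W' = -P.Q W

variable {P} {W W' : PathOfWedges} {c : ℂ}

namespace Opposite

theorem symm (h : P.Opposite W W' c) : P.Opposite W' W (conj c) where
  conj_mul := by rw [Complex.conj_conj, mul_comm, h.conj_mul]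
  u_eq p hp := by rw [h.u_eq p hp, ← mul_assoc, h.conj_mul, one_mul]
  Q_eq := by rw [h.Q_eq, neg_neg]

theorem mdot_Q (h : P.Opposite W W' c) (p p' : V) :
    mdot ((P.Q W').mulVec p') p = mdot ((P.Q W).mulVec p) p' := by
  rw [h.Q_eq, Matrix.neg_mulVec, P.mdot_Q_skew W p p']
  simp only [mdot, Pi.neg_apply]
  ring

/-- Exchanging the two momenta and passing to the opposite wedge cancel in the deformation
function, because the deformation matrices are skew; only the phases of the intertwiners are left. -/
theorem pairFactor (h : P.Opposite W W' c) {p p' : V} (hp : p ∈ massShell P.mass)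
    (hp' : p' ∈ massShell P.mass) : P.pairFactor W' p' p = c ^ 2 * P.pairFactor W p p' := by
  rw [Model.pairFactor, Model.pairFactor, h.mdot_Q, h.u_eq p hp, h.u_eq p' hp']
  ring

theorem antiFactor (h : P.Opposite W W' c) {p p' : V} (hp : p ∈ massShell P.mass)
    (hp' : p' ∈ massShell P.mass) : P.antiFactor W' p' p = conj c ^ 2 * P.antiFactor W p p' := by
  rw [P.antiFactor_eq W hp, P.antiFactor_eq W' hp', h.mdot_Q, h.u_eq p hp, h.u_eq p' hp',
    map_mul, map_mul]
  ring

end Opposite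

theorem measurable_kernel_comp (W : PathOfWedges) {n k : ℕ} {f : V × V → V}
    {g : V × V → Conf n k} (hf : Measurable f) (hg : Measurable g) :
    Measurable fun z => P.kernel W n k (f z) (g z) := by
  have h := (P.measurable_kernel W n k).comp (hf.prodMk hg)
  exact h

theorem measurable_insertParticle {n k : ℕ} :
    Measurable (insertParticle (n := n) (k := k)) :=
  (measurePreserving_insertParticle 1 n k).measurable

theorem ae_prod_mem_massShell : ∀ᵐ z ∂(shellMeasure P.mass).prod (shellMeasure P.mass),
    z.1 ∈ massShell P.mass ∧ z.2 ∈ massShell P.mass :=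
  (Measure.quasiMeasurePreserving_fst.ae (ae_mem_massShell P.mass_pos)).and
    (Measure.quasiMeasurePreserving_snd.ae (ae_mem_massShell P.mass_pos))

/-- Exchange of two annihilation operators of particles. By Fubini's theorem and the symmetry of the
wave function, the two products differ by the ratio of the factors `P.pairFactor`. -/
theorem Opposite.annihilate_annihilate (h : P.Opposite W W' c) (φ φ' : OneParticle P.mass)
    {n k : ℕ} (Ψ : Sector P.mass (n + 1 + 1) k) :
    P.annihilate W φ n k (P.annihilate W' φ' (n + 1) k Ψ) =
      c ^ 2 • P.annihilate W' φ' n k (P.annihilate W φ (n + 1) k Ψ) := by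
  have hL := P.coeFn_annihilate W φ (P.annihilate W' φ' (n + 1) k Ψ) Filter.EventuallyEq.rfl
    (P.coeFn_annihilate W' φ' Ψ Filter.EventuallyEq.rfl Filter.EventuallyEq.rfl)
  have hR := P.coeFn_annihilate W' φ' (P.annihilate W φ (n + 1) k Ψ) Filter.EventuallyEq.rfl
    (P.coeFn_annihilate W φ Ψ Filter.EventuallyEq.rfl Filter.EventuallyEq.rfl)
  have hins : MeasurePreserving (fun z : Conf n k × (V × V) =>
      insertParticle (insertParticle (z.1, z.2.1), z.2.2))
      ((confMeasure P.mass n k).prod ((shellMeasure P.mass).prod (shellMeasure P.mass)))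
      (confMeasure P.mass (n + 1 + 1) k) :=
    (measurePreserving_insertParticle P.mass (n + 1) k).comp
      (((measurePreserving_insertParticle P.mass n k).prod (MeasurePreserving.id _)).comp
        (measurePreserving_prodAssoc _ _ _).symm)
  have hΞ := (Lp.memLp (Ψ : Lp ℂ 2 (confMeasure P.mass (n + 1 + 1) k))).comp_measurePreserving hins
  have hsymm := Measure.ae_ae_of_ae_prod (hins.quasiMeasurePreserving.ae
    (coeFn_permute Ψ (Equiv.swap 0 1) 1))
  have hkey := integral_swap_ae (Lp.memLp φ) (Lp.memLp φ') hΞ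
    (B := fun x z => P.kernel W n k z.1 x * P.kernel W' (n + 1) k z.2 (insertParticle (x, z.1)))
    (fun x => (measurable_kernel_comp W measurable_fst measurable_const).mul
      (measurable_kernel_comp W' measurable_snd
        (measurable_insertParticle.comp (measurable_const.prodMk measurable_fst))))
    (fun x z => by
      rw [norm_mul]
      exact mul_le_one₀ (P.norm_kernel_le _ _ _ _ _) (norm_nonneg _) (P.norm_kernel_le _ _ _ _ _))
    (G := fun x p' p => c ^ 2 * (conj (φ' p') * P.kernel W' n k p' x * (conj (φ p) *
      P.kernel W (n + 1) k p (insertParticle (x, p')) *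
      (Ψ : Lp ℂ 2 (confMeasure P.mass (n + 1 + 1) k))
        (insertParticle (insertParticle (x, p'), p))))) (by
      filter_upwards [hsymm] with x hx
      filter_upwards [hx, ae_prod_mem_massShell] with z hz ⟨hz1, hz2⟩
      have hperm : permute (Equiv.swap 0 1) 1 (insertParticle (insertParticle (x, z.1), z.2)) =
          insertParticle (insertParticle (x, z.2), z.1) := by
        refine Prod.ext (funext fun i => ?_) rfl
        refine Fin.cases ?_ (fun i => Fin.cases ?_ (fun i => ?_) i) i
        · simp [permute, insertParticle]
        · simp [permute, insertParticle]
        · have h0 : (i.succ.succ : Fin (n + 1 + 1)) ≠ 0 := Fin.succ_ne_zero _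
          have h1 : (i.succ.succ : Fin (n + 1 + 1)) ≠ 1 := by
            intro hc; rw [← Fin.succ_zero_eq_one] at hc
            exact Fin.succ_ne_zero _ (Fin.succ_injective _ hc)
          simp [permute, insertParticle, Equiv.swap_apply_of_ne_of_ne h0 h1]
      rw [Function.comp_apply, hperm] at hz
      rw [hz, insertParticle_apply, insertParticle_apply, P.kernel_cons W' hz2,
        P.kernel_cons W hz1, h.pairFactor hz1 hz2]
      simp only [Function.comp_apply]
      rw [insertParticle_apply x z.1]
      ring)
  refine sector_ext (hL.trans (Filter.EventuallyEq.trans ?_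
    ((Lp.coeFn_smul (c ^ 2) _).trans (hR.const_smul (c ^ 2))).symm))
  filter_upwards [hkey] with x hx
  simp only [annihilateFun, Pi.smul_apply, smul_eq_mul]
  simp only [integral_const_mul] at hx
  have e1 : ∀ p, conj (φ p) * P.kernel W n k p x * (((√((n + 1 : ℕ) + 1) : ℝ) : ℂ) *
      ∫ p', conj (φ' p') * P.kernel W' (n + 1) k p' (Fin.cons p x.1, x.2) *
        (Ψ : Lp ℂ 2 (confMeasure P.mass (n + 1 + 1) k)) (Fin.cons p' (Fin.cons p x.1), x.2)
        ∂shellMeasure P.mass) = ((√((n + 1 : ℕ) + 1) : ℝ) : ℂ) *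
      ∫ p', conj (φ p) * conj (φ' p') * (P.kernel W n k p x *
        P.kernel W' (n + 1) k p' (Fin.cons p x.1, x.2)) *
        (Ψ : Lp ℂ 2 (confMeasure P.mass (n + 1 + 1) k)) (Fin.cons p' (Fin.cons p x.1), x.2)
        ∂shellMeasure P.mass := fun p => by
    rw [mul_left_comm, ← integral_const_mul]
    congr 2
    ext p'
    ring
  have e2 : ∀ p', conj (φ' p') * P.kernel W' n k p' x * (((√((n + 1 : ℕ) + 1) : ℝ) : ℂ) *
      ∫ p, conj (φ p) * P.kernel W (n + 1) k p (Fin.cons p' x.1, x.2) *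
        (Ψ : Lp ℂ 2 (confMeasure P.mass (n + 1 + 1) k)) (Fin.cons p (Fin.cons p' x.1), x.2)
        ∂shellMeasure P.mass) = ((√((n + 1 : ℕ) + 1) : ℝ) : ℂ) * (conj (φ' p') *
      P.kernel W' n k p' x * ∫ p, conj (φ p) * P.kernel W (n + 1) k p (Fin.cons p' x.1, x.2) *
        (Ψ : Lp ℂ 2 (confMeasure P.mass (n + 1 + 1) k)) (Fin.cons p (Fin.cons p' x.1), x.2)
        ∂shellMeasure P.mass) := fun p' => by ring
  simp only [e1, e2, integral_const_mul]
  rw [mul_left_comm (c ^ 2), mul_left_comm (c ^ 2)]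
  congr 2

end Model

theorem measurable_uncurry_comp {α β γ δ : Type*} [MeasurableSpace α] [MeasurableSpace β]
    [MeasurableSpace γ] [MeasurableSpace δ] {K : α → β → γ} (hK : Measurable (Function.uncurry K))
    {g : δ → β} (hg : Measurable g) : Measurable (Function.uncurry fun p z => K p (g z)) :=
  hK.comp (measurable_fst.prodMk (hg.comp measurable_snd))

namespace Model

variable {P : Model} {W W' : PathOfWedges} {c : ℂ}

/-- The deformed annihilation operator of antiparticles on functions. -/
def annihilateAntiFun (P : Model) (W : PathOfWedges) (φ : V → ℂ) (n k : ℕ)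
    (ψ : Conf n (k + 1) → ℂ) (x : Conf n k) : ℂ :=
  ((√(k + 1) : ℝ) : ℂ) * ∫ p, conj (φ p) * P.kernel W k n p x.swap * ψ (x.1, Fin.cons p x.2)
    ∂shellMeasure P.mass

theorem coeFn_annihilateAnti (W : PathOfWedges) (φ : OneParticle P.mass) {n k : ℕ}
    (Ψ : Sector P.mass n (k + 1)) {φ₁ : V → ℂ} (hφ : φ =ᵐ[shellMeasure P.mass] φ₁)
    {ψ : Conf n (k + 1) → ℂ} (hψ : ((Ψ : Lp ℂ 2 (confMeasure P.mass n (k + 1))) :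
      Conf n (k + 1) → ℂ) =ᵐ[confMeasure P.mass n (k + 1)] ψ) :
    ((P.annihilateAnti W φ n k Ψ : Lp ℂ 2 (confMeasure P.mass n k)) : Conf n k → ℂ)
      =ᵐ[confMeasure P.mass n k] P.annihilateAntiFun W φ₁ n k ψ := by
  have h1 := (coeFn_chargeConj Ψ).trans ((measurePreserving_swap_conf P.mass (k + 1)
    n).quasiMeasurePreserving.ae_eq_comp hψ)
  have h2 := P.coeFn_annihilate W φ (chargeConj P.mass (k + 1) n Ψ) hφ h1
  exact (coeFn_chargeConj _).trans ((measurePreserving_swap_conf P.mass n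
    k).quasiMeasurePreserving.ae_eq_comp h2)

/-- Exchange of the annihilation operators of a particle and of an antiparticle. -/
theorem Opposite.annihilate_annihilateAnti (h : P.Opposite W W' c) (φ φ' : OneParticle P.mass)
    {n k : ℕ} (Ψ : Sector P.mass (n + 1) (k + 1)) :
    P.annihilate W φ n k (P.annihilateAnti W' φ' (n + 1) k Ψ) =
      conj c ^ 2 • P.annihilateAnti W' φ' n k (P.annihilate W φ n (k + 1) Ψ) := by
  have hL := P.coeFn_annihilate W φ (P.annihilateAnti W' φ' (n + 1) k Ψ) Filter.EventuallyEq.rfl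
    (coeFn_annihilateAnti W' φ' Ψ Filter.EventuallyEq.rfl Filter.EventuallyEq.rfl)
  have hR := coeFn_annihilateAnti W' φ' (P.annihilate W φ n (k + 1) Ψ) Filter.EventuallyEq.rfl
    (P.coeFn_annihilate W φ Ψ Filter.EventuallyEq.rfl Filter.EventuallyEq.rfl)
  have hins : MeasurePreserving (fun z : Conf n k × (V × V) =>
      insertAnti (insertParticle (z.1, z.2.1), z.2.2))
      ((confMeasure P.mass n k).prod ((shellMeasure P.mass).prod (shellMeasure P.mass)))
      (confMeasure P.mass (n + 1) (k + 1)) :=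
    (measurePreserving_insertAnti P.mass (n + 1) k).comp
      (((measurePreserving_insertParticle P.mass n k).prod (MeasurePreserving.id _)).comp
        (measurePreserving_prodAssoc _ _ _).symm)
  have hΞ := (Lp.memLp (Ψ : Lp ℂ 2 (confMeasure P.mass (n + 1) (k + 1)))).comp_measurePreserving
    hins
  have hkey := integral_swap_ae (Lp.memLp φ) (Lp.memLp φ') hΞ
    (B := fun x z => P.kernel W n k z.1 x *
      P.kernel W' k (n + 1) z.2 (insertParticle (x, z.1)).swap)
    (fun x => (measurable_kernel_comp W measurable_fst measurable_const).mul
      (measurable_kernel_comp W' measurable_snd (measurable_swap.comp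
        (measurable_insertParticle.comp (measurable_const.prodMk measurable_fst)))))
    (fun x z => by
      rw [norm_mul]
      exact mul_le_one₀ (P.norm_kernel_le _ _ _ _ _) (norm_nonneg _) (P.norm_kernel_le _ _ _ _ _))
    (G := fun x p' p => conj c ^ 2 * (conj (φ' p') * P.kernel W' k n p' x.swap * (conj (φ p) *
      P.kernel W n (k + 1) p (x.1, Fin.cons p' x.2) *
      (Ψ : Lp ℂ 2 (confMeasure P.mass (n + 1) (k + 1)))
        (Fin.cons p x.1, Fin.cons p' x.2)))) (by
      refine Filter.Eventually.of_forall fun x => ?_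
      filter_upwards [ae_prod_mem_massShell] with z ⟨hz1, hz2⟩
      rw [insertParticle_apply, Prod.swap_prod_mk, P.kernel_cons_anti W' hz2,
        P.kernel_cons_anti W hz1, h.antiFactor hz1 hz2]
      simp only [Function.comp_apply, insertAnti, insertParticle, Prod.swap]
      ring)
  refine sector_ext (hL.trans (Filter.EventuallyEq.trans ?_
    ((Lp.coeFn_smul (conj c ^ 2) _).trans (hR.const_smul (conj c ^ 2))).symm))
  filter_upwards [hkey] with x hx
  simp only [annihilateFun, annihilateAntiFun, Pi.smul_apply, smul_eq_mul]
  simp only [integral_const_mul] at hx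
  have e1 : ∀ p, conj (φ p) * P.kernel W n k p x * (((√(k + 1) : ℝ) : ℂ) *
      ∫ p', conj (φ' p') * P.kernel W' k (n + 1) p' (Prod.swap (Fin.cons p x.1, x.2)) *
        (Ψ : Lp ℂ 2 (confMeasure P.mass (n + 1) (k + 1))) (Fin.cons p x.1, Fin.cons p' x.2)
        ∂shellMeasure P.mass) = ((√(k + 1) : ℝ) : ℂ) *
      ∫ p', conj (φ p) * conj (φ' p') * (P.kernel W n k p x *
        P.kernel W' k (n + 1) p' (Prod.swap (Fin.cons p x.1, x.2))) *
        (Ψ : Lp ℂ 2 (confMeasure P.mass (n + 1) (k + 1))) (Fin.cons p x.1, Fin.cons p' x.2)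
        ∂shellMeasure P.mass := fun p => by
    rw [mul_left_comm, ← integral_const_mul]
    congr 2
    ext p'
    ring
  have e2 : ∀ p', conj (φ' p') * P.kernel W' k n p' x.swap * (((√(n + 1) : ℝ) : ℂ) *
      ∫ p, conj (φ p) * P.kernel W n (k + 1) p (x.1, Fin.cons p' x.2) *
        (Ψ : Lp ℂ 2 (confMeasure P.mass (n + 1) (k + 1))) (Fin.cons p x.1, Fin.cons p' x.2)
        ∂shellMeasure P.mass) = ((√(n + 1) : ℝ) : ℂ) * (conj (φ' p') *
      P.kernel W' k n p' x.swap * ∫ p, conj (φ p) *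
        P.kernel W n (k + 1) p (x.1, Fin.cons p' x.2) *
        (Ψ : Lp ℂ 2 (confMeasure P.mass (n + 1) (k + 1))) (Fin.cons p x.1, Fin.cons p' x.2)
        ∂shellMeasure P.mass) := fun p' => by ring
  simp only [e1, e2, integral_const_mul]
  rw [mul_left_comm (conj c ^ 2), mul_left_comm (conj c ^ 2), mul_left_comm]
  congr 2

theorem createFun_congr (W : PathOfWedges) (φ : V → ℂ) {n k : ℕ} {ψ ψ' : Conf n k → ℂ}
    (h : ψ =ᵐ[confMeasure P.mass n k] ψ') (i : Fin (n + 1)) :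
    P.createFun W φ ψ i =ᵐ[confMeasure P.mass (n + 1) k] P.createFun W φ ψ' i := by
  filter_upwards [(measurePreserving_removeAt P.mass i).ae h] with z hz
  rw [createFun, createFun, hz]

theorem sqrt_succ_ne_zero (n : ℕ) : ((√((n : ℝ) + 1) : ℝ) : ℂ) ≠ 0 := by
  rw [Complex.ofReal_ne_zero]; positivity

/-- Exchange of the annihilation operator of an antiparticle and the creation operator of a
particle. -/
theorem Opposite.annihilateAnti_create (h : P.Opposite W W' c) (φ φ' : OneParticle P.mass)
    {n k : ℕ} (Ψ : Sector P.mass n (k + 1)) :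
    P.annihilateAnti W' φ' (n + 1) k (P.create W φ n (k + 1) Ψ) =
      conj c ^ 2 • P.create W φ n k (P.annihilateAnti W' φ' n k Ψ) := by
  have hφ := Lp.memLp φ
  have hΨ := Lp.memLp (Ψ : Lp ℂ 2 (confMeasure P.mass n (k + 1)))
  have hL := coeFn_annihilateAnti W' φ' (P.create W φ n (k + 1) Ψ) Filter.EventuallyEq.rfl
    (P.coeFn_create W φ Ψ)
  have hR := P.coeFn_create W φ (P.annihilateAnti W' φ' n k Ψ)
  have hR' := ae_all_iff.2 fun i => createFun_congr W φ (coeFn_annihilateAnti W' φ' Ψ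
    Filter.EventuallyEq.rfl Filter.EventuallyEq.rfl) i
  have hint := ae_all_iff.2 fun i => contractFun_integrable (Lp.memLp φ')
    (K := fun p (z : Conf (n + 1) k) => P.kernel W' k (n + 1) p z.swap)
    (measurable_uncurry_comp (P.measurable_kernel W' k (n + 1)) measurable_swap)
    (fun p z => P.norm_kernel_le _ _ _ _ _)
    ((P.memLp_createFun W hφ hΨ i).comp_measurePreserving
      (measurePreserving_insertAnti P.mass (n + 1) k))
  refine sector_ext (hL.trans (Filter.EventuallyEq.trans ?_
    ((Lp.coeFn_smul (conj c ^ 2) _).trans (hR.const_smul (conj c ^ 2))).symm))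
  filter_upwards [hR', hint, ae_onMassShell P.mass_pos (n + 1) k] with z hz hzi hzs
  simp only [annihilateAntiFun, Pi.smul_apply, smul_eq_mul, hz]
  have e1 : ∫ p, conj (φ' p) * P.kernel W' k (n + 1) p z.swap * (((√(n + 1) : ℝ) : ℂ)⁻¹ *
      ∑ i, P.createFun W φ (Ψ : Lp ℂ 2 (confMeasure P.mass n (k + 1))) i (z.1, Fin.cons p z.2))
      ∂shellMeasure P.mass = ((√(n + 1) : ℝ) : ℂ)⁻¹ * ∑ i, ∫ p, conj (φ' p) *
      P.kernel W' k (n + 1) p z.swap *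
      P.createFun W φ (Ψ : Lp ℂ 2 (confMeasure P.mass n (k + 1))) i (z.1, Fin.cons p z.2)
      ∂shellMeasure P.mass := by
    have hzi' : ∀ i, Integrable (fun p => conj (φ' p) * P.kernel W' k (n + 1) p z.swap *
        P.createFun W φ (Ψ : Lp ℂ 2 (confMeasure P.mass n (k + 1))) i (z.1, Fin.cons p z.2))
        (shellMeasure P.mass) := hzi
    rw [← integral_finsetSum _ fun i _ => hzi' i, ← integral_const_mul]
    congr 1
    ext p
    rw [mul_left_comm, Finset.mul_sum]
  rw [e1, mul_left_comm, mul_left_comm (conj c ^ 2)]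
  congr 1
  rw [Finset.mul_sum, Finset.mul_sum]
  refine Finset.sum_congr rfl fun i _ => ?_
  simp only [createFun, annihilateAntiFun]
  simp only [← mul_assoc, ← integral_const_mul]
  refine integral_congr_ae ?_
  filter_upwards [ae_mem_massShell P.mass_pos] with p hp
  have h1 : P.kernel W' k (n + 1) p z.swap =
      P.kernel W' k n p (splitAt i z).1.swap * P.antiFactor W' p (z.1 i) :=
    P.kernel_eq_mul_antiFactor W' hp z.2 z.1 i
  have h2 : (splitAt (k := k + 1) i (z.1, Fin.cons p z.2)).1 =
      ((splitAt i z).1.1, Fin.cons p (splitAt i z).1.2) := rfl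
  have h3 : P.kernel W n (k + 1) (z.1 i) ((splitAt i z).1.1, Fin.cons p (splitAt i z).1.2) =
      P.kernel W n k (z.1 i) (splitAt i z).1 * P.antiFactor W (z.1 i) p :=
    P.kernel_cons_anti W (hzs.1 i) _ _ p
  rw [h1, h2, h3, h.antiFactor (hzs.1 i) hp, map_mul]
  linear_combination (((√(k + 1) : ℝ) : ℂ) * conj c ^ 2 * conj (φ' p) *
    P.kernel W' k n p (splitAt i z).1.swap *
    φ (z.1 i) * conj (P.kernel W n k (z.1 i) (splitAt i z).1) *
    (Ψ : Lp ℂ 2 (confMeasure P.mass n (k + 1))) ((splitAt i z).1.1, Fin.cons p (splitAt i z).1.2)) *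
    P.conj_antiFactor_mul W (hzs.1 i) hp

/-- The multiplication operator left over when an annihilation operator `a_W̃'(φ')` is moved past a
creation operator `a_W̃*(φ)`, as a function of the momenta. -/
def contraction (P : Model) (W W' : PathOfWedges) (φ φ' : V → ℂ) {n k : ℕ} (x : Conf n k) : ℂ :=
  ∫ p, conj (φ' p) * φ p * (P.kernel W' n k p x * conj (P.kernel W n k p x)) ∂shellMeasure P.mass

/-- The created particle is either the one which is annihilated, which gives the contraction, or one
of those which remain. -/
theorem coeFn_annihilate_create (φ φ' : OneParticle P.mass) {n k : ℕ} (Ψ : Sector P.mass n k) :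
    ((P.annihilate W' φ' n k (P.create W φ n k Ψ) : Lp ℂ 2 (confMeasure P.mass n k)) :
      Conf n k → ℂ) =ᵐ[confMeasure P.mass n k] fun x =>
      P.contraction W W' φ φ' x * (Ψ : Lp ℂ 2 (confMeasure P.mass n k)) x +
      ∑ j : Fin n, ∫ p, conj (φ' p) * P.kernel W' n k p x *
        P.createFun W φ (Ψ : Lp ℂ 2 (confMeasure P.mass n k)) j.succ (Fin.cons p x.1, x.2)
        ∂shellMeasure P.mass := by
  have hφ := Lp.memLp φ
  have hΨ := Lp.memLp (Ψ : Lp ℂ 2 (confMeasure P.mass n k))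
  have hL := P.coeFn_annihilate W' φ' (P.create W φ n k Ψ) Filter.EventuallyEq.rfl
    (P.coeFn_create W φ Ψ)
  have hint := ae_all_iff.2 fun i => contractFun_integrable (Lp.memLp φ')
    (P.measurable_kernel W' n k) (P.norm_kernel_le W' n k)
    ((P.memLp_createFun W hφ hΨ i).comp_measurePreserving
      (measurePreserving_insertParticle P.mass n k))
  refine hL.trans ?_
  filter_upwards [hint] with x hx
  have e1 : P.annihilateFun W' φ' n k (fun z => ((√(n + 1) : ℝ) : ℂ)⁻¹ *
      ∑ i, P.createFun W φ (Ψ : Lp ℂ 2 (confMeasure P.mass n k)) i z) x =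
      ∑ i, ∫ p, conj (φ' p) * P.kernel W' n k p x *
      P.createFun W φ (Ψ : Lp ℂ 2 (confMeasure P.mass n k)) i (Fin.cons p x.1, x.2)
      ∂shellMeasure P.mass := by
    have hx' : ∀ i, Integrable (fun p => conj (φ' p) * P.kernel W' n k p x *
        P.createFun W φ (Ψ : Lp ℂ 2 (confMeasure P.mass n k)) i (Fin.cons p x.1, x.2))
        (shellMeasure P.mass) := hx
    rw [annihilateFun, ← integral_finsetSum _ fun i _ => hx' i, ← integral_const_mul]
    congr 1
    ext p
    rw [mul_left_comm _ (((√(n + 1) : ℝ) : ℂ)⁻¹), mul_inv_cancel_left₀ (sqrt_succ_ne_zero n),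
      Finset.mul_sum]
  rw [e1, Fin.sum_univ_succ, contraction, ← integral_mul_const]
  congr 2
  ext p
  have h0 : (splitAt (n := n) (k := k) 0 (Fin.cons p x.1, x.2)).1 = x := by
    simp [splitAt]
  simp only [createFun, h0, Fin.cons_zero]
  ring

/-- Exchange of annihilation and creation operators of particles, on vectors with particles. -/
theorem Opposite.annihilate_create_succ (h : P.Opposite W W' c) (φ φ' : OneParticle P.mass)
    {n k : ℕ} (Ψ : Sector P.mass (n + 1) k) :
    ((P.annihilate W' φ' (n + 1) k (P.create W φ (n + 1) k Ψ) -
      c ^ 2 • P.create W φ n k (P.annihilate W' φ' n k Ψ) : Sector P.mass (n + 1) k) :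
      Lp ℂ 2 (confMeasure P.mass (n + 1) k)) =ᵐ[confMeasure P.mass (n + 1) k] fun x =>
      P.contraction W W' φ φ' x * (Ψ : Lp ℂ 2 (confMeasure P.mass (n + 1) k)) x := by
  have hR := P.coeFn_create W φ (P.annihilate W' φ' n k Ψ)
  have hR' := ae_all_iff.2 fun i => createFun_congr W φ (P.coeFn_annihilate W' φ' Ψ
    Filter.EventuallyEq.rfl Filter.EventuallyEq.rfl) i
  refine (Lp.coeFn_sub _ _).trans (((coeFn_annihilate_create φ φ' Ψ).sub
    ((Lp.coeFn_smul (c ^ 2) _).trans (hR.const_smul (c ^ 2)))).trans ?_)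
  filter_upwards [hR', ae_onMassShell P.mass_pos (n + 1) k] with z hz hzs
  simp only [Pi.sub_apply, Pi.smul_apply, smul_eq_mul, hz]
  rw [add_sub_assoc, add_eq_left, sub_eq_zero, Finset.mul_sum, Finset.mul_sum]
  refine Finset.sum_congr rfl fun i _ => ?_
  have e : c ^ 2 * (((√(n + 1) : ℝ) : ℂ)⁻¹ * P.createFun W φ (P.annihilateFun W' φ' n k
      (Ψ : Lp ℂ 2 (confMeasure P.mass (n + 1) k))) i z) =
      (c ^ 2 * φ (z.1 i) * conj (P.kernel W n k (z.1 i) (splitAt i z).1)) *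
      ∫ p, conj (φ' p) * P.kernel W' n k p (splitAt i z).1 *
        (Ψ : Lp ℂ 2 (confMeasure P.mass (n + 1) k))
          (Fin.cons p (splitAt i z).1.1, (splitAt i z).1.2) ∂shellMeasure P.mass := by
    have h0 := sqrt_succ_ne_zero n
    rw [createFun, annihilateFun]
    field_simp
  rw [e, ← integral_const_mul]
  refine integral_congr_ae ?_
  filter_upwards [ae_mem_massShell P.mass_pos] with p hp
  have h1 := P.kernel_eq_mul_pairFactor W' hp z i
  have h2 : (splitAt (n := n + 1) (k := k) i.succ (Fin.cons p z.1, z.2)).1 =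
      (Fin.cons p (splitAt i z).1.1, (splitAt i z).1.2) := by
    refine Prod.ext (funext fun j => ?_) rfl
    refine Fin.cases ?_ (fun j => ?_) j
    · simp [splitAt]
    · simp [splitAt]
  have h3 : P.kernel W (n + 1) k (z.1 i) (Fin.cons p (splitAt i z).1.1, (splitAt i z).1.2) =
      P.kernel W n k (z.1 i) (splitAt i z).1 * P.pairFactor W (z.1 i) p :=
    P.kernel_cons W (hzs.1 i) _ _ p
  simp only [createFun]
  rw [h2, Fin.cons_succ, h1, h3, h.pairFactor (hzs.1 i) hp, map_mul]
  linear_combination (c ^ 2 * conj (φ' p) * P.kernel W' n k p (splitAt i z).1 *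
    φ (z.1 i) * conj (P.kernel W n k (z.1 i) (splitAt i z).1) *
    (Ψ : Lp ℂ 2 (confMeasure P.mass (n + 1) k)) (Fin.cons p (splitAt i z).1.1, (splitAt i z).1.2)) *
    P.conj_pairFactor_mul W (hzs.1 i) hp

/-- Annihilation of a created particle, on vectors without particles. -/
theorem annihilate_create_zero (φ φ' : OneParticle P.mass) {k : ℕ} (Ψ : Sector P.mass 0 k) :
    ((P.annihilate W' φ' 0 k (P.create W φ 0 k Ψ) : Lp ℂ 2 (confMeasure P.mass 0 k)) :
      Conf 0 k → ℂ) =ᵐ[confMeasure P.mass 0 k] fun x =>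
      P.contraction W W' φ φ' x * (Ψ : Lp ℂ 2 (confMeasure P.mass 0 k)) x := by
  refine (coeFn_annihilate_create φ φ' Ψ).trans (Filter.Eventually.of_forall fun x => ?_)
  simp

end Model

/-! ### Charge conjugation and adjoints -/

theorem chargeConj_chargeConj {m : ℝ} {n k : ℕ} (Ψ : Sector m n k) :
    chargeConj m n k (chargeConj m k n Ψ) = Ψ :=
  sector_ext ((coeFn_chargeConj _).trans ((measurePreserving_swap_conf m n
    k).quasiMeasurePreserving.ae_eq_comp (coeFn_chargeConj Ψ)))

theorem inner_chargeConj {m : ℝ} {n k : ℕ} (Ψ Ψ' : Sector m k n) :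
    inner ℂ (chargeConj m n k Ψ) (chargeConj m n k Ψ') = inner ℂ Ψ Ψ' :=
  (Lp.compMeasurePreservingₗᵢ ℂ Prod.swap (measurePreserving_swap_conf m n k)).inner_map_map
    (Ψ : Lp ℂ 2 (confMeasure m k n)) (Ψ' : Lp ℂ 2 (confMeasure m k n))

theorem eq_smul_of_eq_smul {E : Type*} [AddCommGroup E] [Module ℂ E] {w z : ℂ} (h : w * z = 1)
    {x y : E} (e : x = z • y) : y = w • x := by
  rw [e, smul_smul, h, one_smul]

theorem eq_add_of_sub_smul_eq {E : Type*} [AddCommGroup E] [Module ℂ E] {w z : ℂ} (h : w * z = 1)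
    {x y u v : E} (e : x - w • y = w • (u - z • v)) : x = w • u - v + w • y := by
  rw [smul_sub, smul_smul, h, one_smul] at e
  rw [← e, sub_add_cancel]

/-- A commutation relation passes to the adjoints. -/
theorem adjoint_exchange {E F F' G : Type*} [NormedAddCommGroup E] [NormedAddCommGroup F]
    [NormedAddCommGroup F'] [NormedAddCommGroup G] [InnerProductSpace ℂ E] [InnerProductSpace ℂ F]
    [InnerProductSpace ℂ F'] [InnerProductSpace ℂ G] [CompleteSpace E] [CompleteSpace F]
    [CompleteSpace F'] [CompleteSpace G] {A : F →L[ℂ] G} {B : E →L[ℂ] F} {A' : E →L[ℂ] F'}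
    {B' : F' →L[ℂ] G} {z : ℂ} (h : ∀ x, A (B x) = z • B' (A' x)) (y : G) :
    ContinuousLinearMap.adjoint B (ContinuousLinearMap.adjoint A y) =
      conj z • ContinuousLinearMap.adjoint A' (ContinuousLinearMap.adjoint B' y) := by
  refine ext_inner_right ℂ fun x => ?_
  rw [ContinuousLinearMap.adjoint_inner_left, ContinuousLinearMap.adjoint_inner_left, h,
    inner_smul_left, inner_smul_right, ContinuousLinearMap.adjoint_inner_left,
    ContinuousLinearMap.adjoint_inner_left, Complex.conj_conj]

namespace Model

variable {P : Model} {W W' : PathOfWedges} {c : ℂ}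

theorem annihilateAnti_apply (W : PathOfWedges) (φ : OneParticle P.mass) {n k : ℕ}
    (Ψ : Sector P.mass n (k + 1)) : P.annihilateAnti W φ n k Ψ =
      chargeConj P.mass n k (P.annihilate W φ k n (chargeConj P.mass (k + 1) n Ψ)) := rfl

theorem createAnti_apply (W : PathOfWedges) (φ : OneParticle P.mass) {n k : ℕ}
    (Ψ : Sector P.mass n k) : P.createAnti W φ n k Ψ =
      chargeConj P.mass n (k + 1) (P.create W φ k n (chargeConj P.mass k n Ψ)) := by
  refine ext_inner_right ℂ fun χ => ?_
  rw [createAnti, ContinuousLinearMap.adjoint_inner_left,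
    ← inner_chargeConj (chargeConj P.mass n (k + 1) _) χ, chargeConj_chargeConj, create,
    ContinuousLinearMap.adjoint_inner_left, ← inner_chargeConj Ψ, annihilateAnti_apply,
    chargeConj_chargeConj]

namespace Opposite

theorem sq_mul (h : P.Opposite W W' c) : c ^ 2 * conj c ^ 2 = 1 := by
  rw [← mul_pow, mul_comm, h.conj_mul, one_pow]

theorem create_create (h : P.Opposite W W' c) (φ φ' : OneParticle P.mass) {n k : ℕ}
    (Ψ : Sector P.mass n k) : P.create W φ (n + 1) k (P.create W' φ' n k Ψ) =
      c ^ 2 • P.create W' φ' (n + 1) k (P.create W φ n k Ψ) := by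
  have : P.create W' φ' (n + 1) k (P.create W φ n k Ψ) =
      conj (c ^ 2) • P.create W φ (n + 1) k (P.create W' φ' n k Ψ) :=
    adjoint_exchange (h.annihilate_annihilate φ φ') Ψ
  rw [this, smul_smul, map_pow, h.sq_mul, one_smul]

theorem create_createAnti (h : P.Opposite W W' c) (φ φ' : OneParticle P.mass) {n k : ℕ}
    (Ψ : Sector P.mass n k) : P.create W φ n (k + 1) (P.createAnti W' φ' n k Ψ) =
      conj c ^ 2 • P.createAnti W' φ' (n + 1) k (P.create W φ n k Ψ) := by
  have : P.createAnti W' φ' (n + 1) k (P.create W φ n k Ψ) =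
      conj (conj c ^ 2) • P.create W φ n (k + 1) (P.createAnti W' φ' n k Ψ) :=
    adjoint_exchange (h.annihilate_annihilateAnti φ φ') Ψ
  rw [this, smul_smul, map_pow, Complex.conj_conj, mul_comm, h.sq_mul, one_smul]

theorem annihilateAnti_annihilateAnti (h : P.Opposite W W' c) (φ φ' : OneParticle P.mass)
    {n k : ℕ} (Ψ : Sector P.mass n (k + 1 + 1)) :
    P.annihilateAnti W φ n k (P.annihilateAnti W' φ' n (k + 1) Ψ) =
      c ^ 2 • P.annihilateAnti W' φ' n k (P.annihilateAnti W φ n (k + 1) Ψ) := by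
  simp only [annihilateAnti_apply, chargeConj_chargeConj]
  rw [h.annihilate_annihilate, map_smul]

theorem create_annihilateAnti (h : P.Opposite W W' c) (φ φ' : OneParticle P.mass)
    {n k : ℕ} (Ψ : Sector P.mass n (k + 1)) :
    P.create W φ n k (P.annihilateAnti W' φ' n k Ψ) =
      c ^ 2 • P.annihilateAnti W' φ' (n + 1) k (P.create W φ n (k + 1) Ψ) := by
  rw [h.annihilateAnti_create, smul_smul, h.sq_mul, one_smul]

end Opposite

theorem coeFn_chargeConj_mul {n k : ℕ} {Ψ Ψ' : Sector P.mass n k} {M : Conf k n → ℂ}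
    (h : ((Ψ' : Lp ℂ 2 (confMeasure P.mass n k)) : Conf n k → ℂ) =ᵐ[confMeasure P.mass n k]
      fun x => M x.swap * (Ψ : Lp ℂ 2 (confMeasure P.mass n k)) x) :
    ((chargeConj P.mass k n Ψ' : Lp ℂ 2 (confMeasure P.mass k n)) : Conf k n → ℂ)
      =ᵐ[confMeasure P.mass k n]
      fun x => M x * (chargeConj P.mass k n Ψ : Lp ℂ 2 (confMeasure P.mass k n)) x := by
  filter_upwards [coeFn_chargeConj Ψ, coeFn_chargeConj Ψ',
    (measurePreserving_swap_conf P.mass k n).quasiMeasurePreserving.ae h] with x h1 h2 h3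
  rw [h1, h2, Function.comp_apply, Function.comp_apply, h3, Prod.swap_swap]

theorem annihilateAnti_createAnti_zero (φ φ' : OneParticle P.mass) {n : ℕ}
    (Ψ : Sector P.mass n 0) : ((P.annihilateAnti W' φ' n 0 (P.createAnti W φ n 0 Ψ) :
      Lp ℂ 2 (confMeasure P.mass n 0)) : Conf n 0 → ℂ) =ᵐ[confMeasure P.mass n 0] fun x =>
      P.contraction W W' φ φ' x.swap * (Ψ : Lp ℂ 2 (confMeasure P.mass n 0)) x := by
  have h1 := coeFn_chargeConj_mul (P := P) (M := fun x => P.contraction W W' φ φ' x.swap)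
    (annihilate_create_zero (W := W) (W' := W') φ φ' (chargeConj P.mass 0 n Ψ))
  rw [chargeConj_chargeConj] at h1
  rw [annihilateAnti_apply, createAnti_apply, chargeConj_chargeConj]
  exact h1

theorem Opposite.annihilateAnti_createAnti_succ (h : P.Opposite W W' c)
    (φ φ' : OneParticle P.mass) {n k : ℕ} (Ψ : Sector P.mass n (k + 1)) :
    ((P.annihilateAnti W' φ' n (k + 1) (P.createAnti W φ n (k + 1) Ψ) -
      c ^ 2 • P.createAnti W φ n k (P.annihilateAnti W' φ' n k Ψ) : Sector P.mass n (k + 1)) :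
      Lp ℂ 2 (confMeasure P.mass n (k + 1))) =ᵐ[confMeasure P.mass n (k + 1)] fun x =>
      P.contraction W W' φ φ' x.swap * (Ψ : Lp ℂ 2 (confMeasure P.mass n (k + 1))) x := by
  have h1 := coeFn_chargeConj_mul (P := P) (M := fun x => P.contraction W W' φ φ' x.swap)
    (h.annihilate_create_succ φ φ' (chargeConj P.mass (k + 1) n Ψ))
  rw [chargeConj_chargeConj] at h1
  rw [annihilateAnti_apply, createAnti_apply, chargeConj_chargeConj, createAnti_apply,
    annihilateAnti_apply, chargeConj_chargeConj, ← map_smul, ← map_sub]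
  exact h1

theorem sector_eq_smul {n k : ℕ} {A B : Sector P.mass n k} {M M' ψ : Conf n k → ℂ} {z : ℂ}
    (hA : ((A : Lp ℂ 2 (confMeasure P.mass n k)) : Conf n k → ℂ) =ᵐ[confMeasure P.mass n k]
      fun x => M x * ψ x)
    (hB : ((B : Lp ℂ 2 (confMeasure P.mass n k)) : Conf n k → ℂ) =ᵐ[confMeasure P.mass n k]
      fun x => M' x * ψ x) (h : ∀ x, OnMassShell P.mass x → M x = z * M' x) : A = z • B := by
  refine sector_ext (hA.trans (Filter.EventuallyEq.trans ?_
    ((Lp.coeFn_smul z _).trans (hB.const_smul z)).symm))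
  filter_upwards [ae_onMassShell P.mass_pos n k] with x hx
  rw [Pi.smul_apply, smul_eq_mul, h x hx, mul_assoc]

/-! ### Exchange relations on the vectors of finite particle number -/

section Components

variable (P : Model) (W : PathOfWedges) (φ : OneParticle P.mass) (Ψ : FiniteParticle P.mass)
  (n k : ℕ)

theorem components_a : components P.mass (P.a W φ Ψ) (n, k) =
    P.annihilate W φ n k (components P.mass Ψ (n + 1, k)) := rfl

theorem components_b : components P.mass (P.b W φ Ψ) (n, k) =
    P.annihilateAnti W φ n k (components P.mass Ψ (n, k + 1)) := rfl

theorem components_aStar_zero : components P.mass (P.aStar W φ Ψ) (0, k) = 0 := rfl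

theorem components_aStar_succ : components P.mass (P.aStar W φ Ψ) (n + 1, k) =
    P.create W φ n k (components P.mass Ψ (n, k)) := rfl

theorem components_bStar_zero : components P.mass (P.bStar W φ Ψ) (n, 0) = 0 := by
  cases n <;> rfl

theorem components_bStar_succ : components P.mass (P.bStar W φ Ψ) (n, k + 1) =
    P.createAnti W φ n k (components P.mass Ψ (n, k)) := by
  cases n <;> rfl

theorem components_smul_apply (z : ℂ) :
    components P.mass (z • Ψ) (n, k) = z • components P.mass Ψ (n, k) := rfl

end Components

theorem finiteParticle_ext {Ψ Ψ' : FiniteParticle P.mass}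
    (h : ∀ n k, components P.mass Ψ (n, k) = components P.mass Ψ' (n, k)) : Ψ = Ψ' :=
  components_injective P.mass (funext fun i => h i.1 i.2)

namespace Opposite

variable (h : P.Opposite W W' c) (φ φ' : OneParticle P.mass) (Ψ : FiniteParticle P.mass)
include h

theorem aStar_aStar : P.aStar W φ (P.aStar W' φ' Ψ) = c ^ 2 • P.aStar W' φ' (P.aStar W φ Ψ) := by
  refine finiteParticle_ext fun n k => ?_
  rw [components_smul_apply]
  rcases n with _ | _ | n
  · simp only [components_aStar_zero, smul_zero]
  · simp only [components_aStar_succ, components_aStar_zero, map_zero, smul_zero]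
  · exact h.create_create φ φ' _

theorem b_b : P.b W φ (P.b W' φ' Ψ) = c ^ 2 • P.b W' φ' (P.b W φ Ψ) :=
  finiteParticle_ext fun n k => by
    rw [components_smul_apply, components_b, components_b, components_b, components_b]
    exact h.annihilateAnti_annihilateAnti φ φ' _

theorem aStar_b : P.aStar W φ (P.b W' φ' Ψ) = c ^ 2 • P.b W' φ' (P.aStar W φ Ψ) := by
  refine finiteParticle_ext fun n k => ?_
  rw [components_smul_apply]
  rcases n with _ | n
  · simp only [components_b, components_aStar_zero, map_zero, smul_zero]
  · exact h.create_annihilateAnti φ φ' _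

theorem b_aStar : P.b W φ (P.aStar W' φ' Ψ) = c ^ 2 • P.aStar W' φ' (P.b W φ Ψ) := by
  rw [h.symm.aStar_b, smul_smul, h.sq_mul, one_smul]

theorem aStar_bStar :
    P.aStar W φ (P.bStar W' φ' Ψ) = conj c ^ 2 • P.bStar W' φ' (P.aStar W φ Ψ) := by
  refine finiteParticle_ext fun n k => ?_
  rw [components_smul_apply]
  rcases n with _ | n
  · rcases k with _ | k
    · simp only [components_aStar_zero, components_bStar_zero, smul_zero]
    · simp only [components_aStar_zero, components_bStar_succ, map_zero, smul_zero]
  · rcases k with _ | k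
    · simp only [components_aStar_succ, components_bStar_zero, map_zero, smul_zero]
    · simp only [components_aStar_succ, components_bStar_succ]
      exact h.create_createAnti φ φ' _

theorem a_b : P.a W φ (P.b W' φ' Ψ) = conj c ^ 2 • P.b W' φ' (P.a W φ Ψ) :=
  finiteParticle_ext fun n k => by
    rw [components_smul_apply, components_a, components_b, components_b, components_a]
    exact h.annihilate_annihilateAnti φ φ' _

theorem b_a : P.b W φ (P.a W' φ' Ψ) = conj c ^ 2 • P.a W' φ' (P.b W φ Ψ) :=
  eq_smul_of_eq_smul (by rw [Complex.conj_conj, mul_comm, h.sq_mul]) (h.symm.a_b φ' φ Ψ)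

/-- The deformed fields of opposite wedges commute up to a phase. -/
theorem field_field (f g : SchwartzTest) :
    P.field W f (P.field W' g Ψ) = c ^ 2 • P.field W' g (P.field W f Ψ) := by
  simp only [field, LinearMap.add_apply, map_add, smul_add, h.aStar_aStar, h.b_b, h.aStar_b,
    h.b_aStar]
  abel

theorem a_aStar (n k : ℕ) :
    ((components P.mass (P.a W' φ' (P.aStar W φ Ψ) - c ^ 2 • P.aStar W φ (P.a W' φ' Ψ)) (n, k) :
      Sector P.mass n k) : Lp ℂ 2 (confMeasure P.mass n k)) =ᵐ[confMeasure P.mass n k] fun x =>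
      P.contraction W W' φ φ' x *
        ((components P.mass Ψ (n, k) : Sector P.mass n k) : Lp ℂ 2 (confMeasure P.mass n k)) x := by
  have e : components P.mass (P.a W' φ' (P.aStar W φ Ψ) - c ^ 2 • P.aStar W φ (P.a W' φ' Ψ))
      (n, k) = P.annihilate W' φ' n k (P.create W φ n k (components P.mass Ψ (n, k))) -
      c ^ 2 • components P.mass (P.aStar W φ (P.a W' φ' Ψ)) (n, k) := rfl
  rw [e]
  rcases n with _ | n
  · rw [components_aStar_zero, smul_zero, sub_zero]
    exact annihilate_create_zero φ φ' _
  · exact h.annihilate_create_succ φ φ' _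

theorem b_bStar (n k : ℕ) :
    ((components P.mass (P.b W' φ' (P.bStar W φ Ψ) - c ^ 2 • P.bStar W φ (P.b W' φ' Ψ)) (n, k) :
      Sector P.mass n k) : Lp ℂ 2 (confMeasure P.mass n k)) =ᵐ[confMeasure P.mass n k] fun x =>
      P.contraction W W' φ φ' x.swap *
        ((components P.mass Ψ (n, k) : Sector P.mass n k) : Lp ℂ 2 (confMeasure P.mass n k)) x := by
  have e : components P.mass (P.b W' φ' (P.bStar W φ Ψ) - c ^ 2 • P.bStar W φ (P.b W' φ' Ψ))
      (n, k) = P.annihilateAnti W' φ' n k (components P.mass (P.bStar W φ Ψ) (n, k + 1)) -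
      c ^ 2 • components P.mass (P.bStar W φ (P.b W' φ' Ψ)) (n, k) := rfl
  rw [e, components_bStar_succ]
  rcases k with _ | k
  · rw [components_bStar_zero, smul_zero, sub_zero]
    exact annihilateAnti_createAnti_zero φ φ' _
  · rw [components_bStar_succ, components_b]
    exact h.annihilateAnti_createAnti_succ φ φ' _

/-- The fields and the charge conjugate fields of opposite wedges commute up to a phase if the
contractions of particles and antiparticles compensate each other. -/
theorem field_fieldStar {f g : SchwartzTest}
    (hc : ∀ (n k : ℕ) (x : Conf n k), OnMassShell P.mass x →
      P.contraction W' W (P.plus g) (P.plus (conjTest f)) x.swap =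
        conj c ^ 2 * P.contraction W W' (P.plus f) (P.plus (conjTest g)) x) :
    P.field W f (P.fieldStar W' g Ψ) = conj c ^ 2 • P.fieldStar W' g (P.field W f Ψ) := by
  have key : P.b W (P.plus (conjTest f)) (P.bStar W' (P.plus g) Ψ) -
      conj c ^ 2 • P.bStar W' (P.plus g) (P.b W (P.plus (conjTest f)) Ψ) =
      conj c ^ 2 • (P.a W' (P.plus (conjTest g)) (P.aStar W (P.plus f) Ψ) -
        c ^ 2 • P.aStar W (P.plus f) (P.a W' (P.plus (conjTest g)) Ψ)) := by
    refine finiteParticle_ext fun n k => ?_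
    rw [components_smul_apply]
    exact sector_eq_smul (h.symm.b_bStar (P.plus g) (P.plus (conjTest f)) Ψ n k)
      (h.a_aStar (P.plus f) (P.plus (conjTest g)) Ψ n k) (hc n k)
  have key' := eq_add_of_sub_smul_eq (by rw [mul_comm, h.sq_mul]) key
  simp only [field, fieldStar, LinearMap.add_apply, map_add, smul_add, h.aStar_bStar, h.b_a, key']
  abel

end Opposite

/-! ### The contraction terms for opposite wedges -/

theorem contraction_congr (W W' : PathOfWedges) {φ φ₁ φ' φ₁' : V → ℂ}
    (h : φ =ᵐ[shellMeasure P.mass] φ₁) (h' : φ' =ᵐ[shellMeasure P.mass] φ₁') {n k : ℕ}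
    (x : Conf n k) : P.contraction W W' φ φ' x = P.contraction W W' φ₁ φ₁' x := by
  refine integral_congr_ae ?_
  filter_upwards [h, h'] with p hp hp'
  rw [hp, hp']

/-- In the contraction kernel of opposite wedges the intertwiners cancel up to a constant, and the
deformation functions combine to squares. -/
theorem Opposite.kernel_eq (h : P.Opposite W W' c) {n k : ℕ} {p : V} (hp : p ∈ massShell P.mass)
    {x : Conf n k} (hx : OnMassShell P.mass x) :
    P.kernel W' n k p x * conj (P.kernel W n k p x) = c ^ (2 * ((n : ℤ) - k) + 1) *
      ((∏ i, conj (P.R (mdot ((P.Q W).mulVec p) (x.1 i) : ℝ)) ^ 2) *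
        ∏ j, conj (P.R (mdot ((P.Q W).mulVec p) (x.2 j) : ℝ)) ^ 2) := by
  have hc0 : c ≠ 0 := right_ne_zero_of_mul_eq_one h.conj_mul
  have hcc : conj c = c⁻¹ := eq_inv_of_mul_eq_one_left h.conj_mul
  have hR : ∀ q, P.R (mdot ((P.Q W').mulVec p) q : ℝ) =
      conj (P.R (mdot ((P.Q W).mulVec p) q : ℝ)) := fun q => by
    rw [← P.isDeformationFunction.neg, h.Q_eq, Matrix.neg_mulVec]
    congr 2
    simp only [mdot, Pi.neg_apply]
    ring
  have h1 : ∀ i, P.u W' (x.1 i) * conj (P.R (mdot ((P.Q W).mulVec p) (x.1 i) : ℝ)) *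
      conj (P.u W (x.1 i) * P.R (mdot ((P.Q W).mulVec p) (x.1 i) : ℝ)) =
      c * conj (P.R (mdot ((P.Q W).mulVec p) (x.1 i) : ℝ)) ^ 2 := fun i => by
    rw [h.u_eq _ (hx.1 i), map_mul]
    linear_combination (c * conj (P.R (mdot ((P.Q W).mulVec p) (x.1 i) : ℝ)) ^ 2) *
      P.conj_u_mul W (hx.1 i)
  have h2 : ∀ i, conj (P.u W' (x.2 i)) * conj (P.R (mdot ((P.Q W).mulVec p) (x.2 i) : ℝ)) *
      conj (conj (P.u W (x.2 i)) * P.R (mdot ((P.Q W).mulVec p) (x.2 i) : ℝ)) =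
      c⁻¹ * conj (P.R (mdot ((P.Q W).mulVec p) (x.2 i) : ℝ)) ^ 2 := fun i => by
    rw [h.u_eq _ (hx.2 i), map_mul, map_mul, hcc, Complex.conj_conj]
    linear_combination (c⁻¹ * conj (P.R (mdot ((P.Q W).mulVec p) (x.2 i) : ℝ)) ^ 2) *
      P.conj_u_mul W (hx.2 i)
  have h3 : P.u W' p ^ ((n : ℤ) - k + 1) * conj (P.u W p ^ ((n : ℤ) - k + 1)) =
      c ^ ((n : ℤ) - k + 1) := by
    rw [map_zpow₀, ← mul_zpow, h.u_eq p hp, mul_assoc, mul_comm (P.u W p), P.conj_u_mul W hp,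
      mul_one]
  have h4 : c ^ (2 * ((n : ℤ) - k) + 1) = c ^ ((n : ℤ) - k + 1) * c ^ n * c⁻¹ ^ k := by
    rw [inv_pow, ← zpow_natCast, ← zpow_natCast, ← zpow_neg, ← zpow_add₀ hc0, ← zpow_add₀ hc0]
    congr 1
    ring
  rw [kernel, kernel, map_mul, map_mul, map_prod, map_prod]
  simp only [hR]
  calc _ = (P.u W' p ^ ((n : ℤ) - k + 1) * conj (P.u W p ^ ((n : ℤ) - k + 1))) *
        ((∏ i, P.u W' (x.1 i) * conj (P.R (mdot ((P.Q W).mulVec p) (x.1 i) : ℝ))) *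
          ∏ i, conj (P.u W (x.1 i) * P.R (mdot ((P.Q W).mulVec p) (x.1 i) : ℝ))) *
        ((∏ i, conj (P.u W' (x.2 i)) * conj (P.R (mdot ((P.Q W).mulVec p) (x.2 i) : ℝ))) *
          ∏ i, conj (conj (P.u W (x.2 i)) * P.R (mdot ((P.Q W).mulVec p) (x.2 i) : ℝ))) := by ring
    _ = _ := by
      rw [← Finset.prod_mul_distrib, ← Finset.prod_mul_distrib, h3, Finset.prod_congr rfl
        fun i _ => h1 i, Finset.prod_congr rfl fun i _ => h2 i, Finset.prod_mul_distrib,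
        Finset.prod_mul_distrib, h4]
      simp only [Finset.prod_const, Finset.card_univ, Fintype.card_fin]
      ring

theorem Opposite.contraction_eq (h : P.Opposite W W' c) (φ φ' : V → ℂ) {n k : ℕ}
    {x : Conf n k} (hx : OnMassShell P.mass x) :
    P.contraction W W' φ φ' x = c ^ (2 * ((n : ℤ) - k) + 1) * ∫ p, conj (φ' p) * φ p *
      ((∏ i, conj (P.R (mdot ((P.Q W).mulVec p) (x.1 i) : ℝ)) ^ 2) *
        ∏ j, conj (P.R (mdot ((P.Q W).mulVec p) (x.2 j) : ℝ)) ^ 2) ∂shellMeasure P.mass := by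
  rw [contraction, ← integral_const_mul]
  refine integral_congr_ae ?_
  filter_upwards [ae_mem_massShell P.mass_pos] with p hp
  rw [h.kernel_eq hp hx]
  ring

theorem Opposite.contraction_eq' (h : P.Opposite W W' c) (φ φ' : V → ℂ) {n k : ℕ}
    {x : Conf n k} (hx : OnMassShell P.mass x) :
    P.contraction W' W φ φ' x.swap = conj c ^ 2 * (c ^ (2 * ((n : ℤ) - k) + 1) *
      ∫ p, conj (φ' p) * φ p * ((∏ i, P.R (mdot ((P.Q W).mulVec p) (x.1 i) : ℝ) ^ 2) *
        ∏ j, P.R (mdot ((P.Q W).mulVec p) (x.2 j) : ℝ) ^ 2) ∂shellMeasure P.mass) := by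
  have hc0 : c ≠ 0 := right_ne_zero_of_mul_eq_one h.conj_mul
  have hcc : conj c = c⁻¹ := eq_inv_of_mul_eq_one_left h.conj_mul
  have hR : ∀ p q, conj (P.R (mdot ((P.Q W').mulVec p) q : ℝ)) =
      P.R (mdot ((P.Q W).mulVec p) q : ℝ) := fun p q => by
    rw [← P.isDeformationFunction.neg, h.Q_eq, Matrix.neg_mulVec]
    congr 2
    simp only [mdot, Pi.neg_apply]
    ring
  rw [h.symm.contraction_eq φ φ' (x := x.swap) ⟨hx.2, hx.1⟩, ← mul_assoc]
  simp only [hR, Prod.fst_swap, Prod.snd_swap]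
  congr 1
  · rw [hcc, inv_zpow, ← zpow_neg, inv_pow, ← zpow_natCast, ← zpow_neg, ← zpow_add₀ hc0]
    congr 1
    push_cast
    ring
  · congr 1
    ext p
    ring

end Model

theorem conj_fPlus_conjTest (f : SchwartzTest) (p : V) :
    conj (fPlus (conjTest f) p) = fPlus f (-p) := by
  rw [fPlus, fPlus, ← integral_conj]
  congr 1
  ext x
  rw [map_mul, conjTest_apply, Complex.conj_conj, ← Complex.exp_conj]
  have : mdot (-p) x = -mdot p x := by simp only [mdot, Pi.neg_apply]; ring
  rw [this]
  simp

/-! ### Shifting the rapidity contour -/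

/-- A function which is analytic on the strip `0 < Im ζ < π`, continuous on its closure, and
decays in the direction of the real axis has the same integrals over both boundary lines. -/
theorem integral_eq_integral_add_pi {Φ : ℂ → ℂ}
    (hc : ContinuousOn Φ {ζ | 0 ≤ ζ.im ∧ ζ.im ≤ Real.pi})
    (hd : DifferentiableOn ℂ Φ {ζ | 0 < ζ.im ∧ ζ.im < Real.pi}) {ε C : ℝ} (hε : 0 < ε)
    (hb : ∀ ζ : ℂ, 0 ≤ ζ.im → ζ.im ≤ Real.pi → ‖Φ ζ‖ ≤ C * Real.exp (-ε * ζ.re ^ 2)) :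
    ∫ θ : ℝ, Φ θ = ∫ θ : ℝ, Φ (θ + Real.pi * Complex.I) := by
  have hgauss := (integrable_exp_neg_mul_sq hε).const_mul C
  have hint : ∀ s : ℝ, 0 ≤ s → s ≤ Real.pi → Integrable fun θ : ℝ => Φ (θ + s * Complex.I) := by
    intro s h0 h1
    refine hgauss.mono' (Continuous.aestronglyMeasurable ?_)
      (Filter.Eventually.of_forall fun θ => ?_)
    · exact hc.comp_continuous (by fun_prop) fun θ => by simp [h0, h1]
    · have := hb (θ + s * Complex.I) (by simpa using h0) (by simpa using h1)
      simpa using this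
  have hrect : ∀ T : ℝ, 0 ≤ T →
      ((∫ θ in (-T)..T, Φ θ) - ∫ θ in (-T)..T, Φ (θ + Real.pi * Complex.I)) =
      -(Complex.I * ∫ s in (0 : ℝ)..Real.pi, Φ (T + s * Complex.I)) +
        Complex.I * ∫ s in (0 : ℝ)..Real.pi, Φ (-T + s * Complex.I) := by
    intro T hT
    have h := Complex.integral_boundary_rect_eq_zero_of_continuousOn_of_differentiableOn Φ
      (⟨-T, 0⟩ : ℂ) (⟨T, Real.pi⟩ : ℂ) (hc.mono fun ζ hζ => by
        have := hζ.2
        simp only [Set.mem_preimage, Set.uIcc_of_le Real.pi_pos.le] at this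
        exact this) (hd.mono fun ζ hζ => by
        have := hζ.2
        simp only [Set.mem_preimage, min_eq_left Real.pi_pos.le,
          max_eq_right Real.pi_pos.le] at this
        exact this)
    simp only [Complex.ofReal_zero, zero_mul, add_zero, smul_eq_mul, Complex.ofReal_neg] at h
    linear_combination h
  have hside : ∀ T : ℝ, ‖∫ s in (0 : ℝ)..Real.pi, Φ (T + s * Complex.I)‖ ≤
      C * Real.exp (-ε * T ^ 2) * Real.pi := by
    intro T
    have h := intervalIntegral.norm_integral_le_of_norm_le_const (a := 0) (b := Real.pi)
      (f := fun s : ℝ => Φ (T + s * Complex.I)) (C := C * Real.exp (-ε * T ^ 2)) fun s hs => by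
        rw [Set.uIoc_of_le Real.pi_pos.le] at hs
        have := hb (T + s * Complex.I) (by simpa using hs.1.le) (by simpa using hs.2)
        simpa using this
    rwa [sub_zero, abs_of_pos Real.pi_pos] at h
  have hdecay : Filter.Tendsto (fun T : ℝ => C * Real.exp (-ε * T ^ 2) * Real.pi) Filter.atTop
      (nhds 0) := by
    have h1 : Filter.Tendsto (fun T : ℝ => -ε * T ^ 2) Filter.atTop Filter.atBot := by
      have := (Filter.tendsto_pow_atTop (α := ℝ) two_ne_zero).const_mul_atTop hε
      refine (Filter.tendsto_neg_atTop_atBot.comp this).congr fun T => ?_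
      simp
    have h2 := ((Real.tendsto_exp_atBot.comp h1).const_mul C).mul_const Real.pi
    simpa using h2
  have hs1 : Filter.Tendsto (fun T : ℝ => ∫ s in (0 : ℝ)..Real.pi, Φ (T + s * Complex.I))
      Filter.atTop (nhds 0) := squeeze_zero_norm hside hdecay
  have hs2 : Filter.Tendsto (fun T : ℝ => ∫ s in (0 : ℝ)..Real.pi, Φ (-T + s * Complex.I))
      Filter.atTop (nhds 0) := by
    refine squeeze_zero_norm (fun T => ?_) hdecay
    have := hside (-T)
    simpa using this
  have hl := intervalIntegral_tendsto_integral (hint 0 le_rfl Real.pi_pos.le)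
    Filter.tendsto_neg_atTop_atBot Filter.tendsto_id
  have hr := intervalIntegral_tendsto_integral (hint Real.pi Real.pi_pos.le le_rfl)
    Filter.tendsto_neg_atTop_atBot Filter.tendsto_id
  have hlim := hl.sub hr
  have hzero := (hs1.const_mul Complex.I).neg.add (hs2.const_mul Complex.I)
  simp only [Complex.ofReal_zero, zero_mul, add_zero, mul_zero, neg_zero] at hlim hzero
  refine sub_eq_zero.1 (tendsto_nhds_unique hlim (hzero.congr' ?_))
  filter_upwards [Filter.eventually_ge_atTop 0] with T hT
  exact (hrect T hT).symm

/-- Fubini's theorem for a weighted integral over products of Fourier transforms. -/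
theorem integral_mul_fPlus_mul_fPlus (f g : SchwartzTest) {α : ℝ → ℂ} (hα : Integrable α)
    {q : ℝ → V} (hq : Continuous q) :
    ∫ θ, α θ * (fPlus f (q θ) * fPlus g (-q θ)) =
      ∫ w : V × V, f w.1 * g w.2 *
        ∫ θ, α θ * Complex.exp (Complex.I * (mdot (q θ) (w.1 - w.2) : ℝ)) := by
  have h1 : ∀ θ, α θ * (fPlus f (q θ) * fPlus g (-q θ)) = ∫ w : V × V, α θ * (f w.1 * g w.2) *
      Complex.exp (Complex.I * (mdot (q θ) (w.1 - w.2) : ℝ)) := by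
    intro θ
    rw [fPlus, fPlus, ← integral_prod_mul, ← integral_const_mul]
    refine integral_congr_ae (Filter.Eventually.of_forall fun w => ?_)
    have : mdot (q θ) (w.1 - w.2) = mdot (q θ) w.1 + mdot (-q θ) w.2 := by
      simp only [mdot, Pi.sub_apply, Pi.neg_apply]; ring
    simp only [this]
    push_cast
    rw [mul_add, Complex.exp_add]
    ring
  have hfg : Integrable (fun w : V × V => f w.1 * g w.2) := f.integrable.mul_prod g.integrable
  have hcont : Continuous fun z : ℝ × (V × V) =>
      Complex.exp (Complex.I * (mdot (q z.1) (z.2.1 - z.2.2) : ℝ)) := by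
    have hi (i : Fin 3) : Continuous fun z : ℝ × (V × V) => q z.1 i :=
      (continuous_apply i).comp (hq.comp continuous_fst)
    have hj (i : Fin 3) : Continuous fun z : ℝ × (V × V) => (z.2.1 - z.2.2) i :=
      (continuous_apply i).comp (by fun_prop)
    have hm : Continuous fun z : ℝ × (V × V) => mdot (q z.1) (z.2.1 - z.2.2) := by
      unfold mdot
      exact (((hi 0).mul (hj 0)).sub ((hi 1).mul (hj 1))).sub ((hi 2).mul (hj 2))
    exact Complex.continuous_exp.comp (continuous_const.mul (Complex.continuous_ofReal.comp hm))
  have hI : Integrable (Function.uncurry fun (θ : ℝ) (w : V × V) => α θ * (f w.1 * g w.2) *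
      Complex.exp (Complex.I * (mdot (q θ) (w.1 - w.2) : ℝ))) := by
    have h2 := (hα.mul_prod hfg).bdd_mul (c := 1) hcont.aestronglyMeasurable
      (Filter.Eventually.of_forall fun z => by
        rw [mul_comm, Complex.norm_exp_ofReal_mul_I])
    refine h2.congr (Filter.Eventually.of_forall fun z => ?_)
    simp only [Function.uncurry]
    ring
  simp only [h1]
  rw [integral_integral_swap hI]
  congr 1
  ext w
  rw [← integral_const_mul]
  congr 1
  ext θ
  ring

namespace Model

variable (P : Model)

/-- The analytic continuation in the rapidity `ζ` of the regularized integrand: a Gaussian, the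
exponential `e^{-ip·z}` and the squares of the deformation functions. Here `μ` stands for
`√(m² + y²)`, so that `p = (μ cosh ζ, μ sinh ζ, y)`. -/
def stripFun {ι : Type*} [Fintype ι] (ε μ y : ℝ) (z : V) (x : ι → V) (ζ : ℂ) : ℂ :=
  Complex.exp (-(ε * ζ ^ 2)) *
    Complex.exp (-(Complex.I * (μ * (Complex.cosh ζ * z 0 - Complex.sinh ζ * z 1) - y * z 2))) *
    ∏ i, P.R (P.kappa * μ * (Complex.sinh ζ * x i 0 - Complex.cosh ζ * x i 1)) ^ 2

theorem im_sinh (ζ : ℂ) : (Complex.sinh ζ).im = Real.cosh ζ.re * Real.sin ζ.im := by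
  conv_lhs => rw [← Complex.re_add_im ζ]
  rw [Complex.sinh_add, Complex.cosh_mul_I, Complex.sinh_mul_I]
  simp [Complex.sinh_ofReal_re, Complex.cosh_ofReal_re, Complex.sin_ofReal_re]

theorem im_cosh (ζ : ℂ) : (Complex.cosh ζ).im = Real.sinh ζ.re * Real.sin ζ.im := by
  conv_lhs => rw [← Complex.re_add_im ζ]
  rw [Complex.cosh_add, Complex.cosh_mul_I, Complex.sinh_mul_I]
  simp [Complex.sinh_ofReal_re, Complex.cosh_ofReal_re, Complex.sin_ofReal_re]

theorem abs_sinh_lt_cosh (t : ℝ) : |Real.sinh t| < Real.cosh t := by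
  refine abs_lt_of_sq_lt_sq ?_ (Real.cosh_pos t).le
  rw [Real.cosh_sq]
  linarith

theorem im_argR (μ : ℝ) (x : V) (ζ : ℂ) :
    (P.kappa * μ * (Complex.sinh ζ * x 0 - Complex.cosh ζ * x 1) : ℂ).im =
      P.kappa * μ * (Real.sin ζ.im * (Real.cosh ζ.re * x 0 - Real.sinh ζ.re * x 1)) := by
  rw [← Complex.ofReal_mul, Complex.im_ofReal_mul, Complex.sub_im, Complex.im_mul_ofReal,
    Complex.im_mul_ofReal, im_sinh, im_cosh]
  ring

theorem cosh_mul_sub_pos {t a b : ℝ} (h : |b| < a) : 0 < Real.cosh t * a - Real.sinh t * b := by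
  have h1 := abs_sinh_lt_cosh t
  have h2 : Real.sinh t * b ≤ |Real.sinh t| * |b| := by rw [← abs_mul]; exact le_abs_self _
  nlinarith [abs_nonneg b, abs_nonneg (Real.sinh t)]

theorem continuousOn_stripFun {ι : Type*} [Fintype ι] (ε y : ℝ) {μ : ℝ} (hμ : 0 < μ) (z : V)
    {x : ι → V} (hx : ∀ i, |x i 1| < x i 0) :
    ContinuousOn (P.stripFun ε μ y z x) {ζ | 0 ≤ ζ.im ∧ ζ.im ≤ Real.pi} := by
  refine ContinuousOn.mul (Continuous.continuousOn (by fun_prop)) ?_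
  refine continuousOn_finsetProd _ fun i _ => ContinuousOn.pow ?_ 2
  refine P.isDeformationFunction.continuousOn.comp (Continuous.continuousOn (by fun_prop))
    fun ζ hζ => ?_
  change 0 ≤ (P.kappa * μ * (Complex.sinh ζ * x i 0 - Complex.cosh ζ * x i 1) : ℂ).im
  rw [im_argR]
  have h1 := cosh_mul_sub_pos (t := ζ.re) (hx i)
  have h2 := Real.sin_nonneg_of_nonneg_of_le_pi hζ.1 hζ.2
  have := P.kappa_pos
  positivity

theorem differentiableOn_stripFun {ι : Type*} [Fintype ι] (ε y : ℝ) {μ : ℝ} (hμ : 0 < μ) (z : V)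
    {x : ι → V} (hx : ∀ i, |x i 1| < x i 0) :
    DifferentiableOn ℂ (P.stripFun ε μ y z x) {ζ | 0 < ζ.im ∧ ζ.im < Real.pi} := by
  have h0 : Differentiable ℂ fun ζ : ℂ => Complex.exp (-(ε * ζ ^ 2)) *
    Complex.exp (-(Complex.I * (μ * (Complex.cosh ζ * z 0 - Complex.sinh ζ * z 1) - y * z 2))) := by
    fun_prop
  refine h0.differentiableOn.mul ?_
  refine DifferentiableOn.fun_finsetProd fun i _ => DifferentiableOn.pow ?_ 2
  have h3 : Differentiable ℂ fun ζ : ℂ =>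
      (P.kappa * μ * (Complex.sinh ζ * x i 0 - Complex.cosh ζ * x i 1) : ℂ) := by fun_prop
  refine P.isDeformationFunction.analytic.comp h3.differentiableOn fun ζ hζ => ?_
  change 0 < (P.kappa * μ * (Complex.sinh ζ * x i 0 - Complex.cosh ζ * x i 1) : ℂ).im
  rw [im_argR]
  have h1 := cosh_mul_sub_pos (t := ζ.re) (hx i)
  have h2 := Real.sin_pos_of_pos_of_lt_pi hζ.1 hζ.2
  have := P.kappa_pos
  positivity

/-- For `z` in the closure of the standard wedge the exponential is bounded in the strip, and for
momenta `x` inside the forward cone the deformation functions are evaluated in the upper half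
plane. -/
theorem norm_stripFun_le {ι : Type*} [Fintype ι] {ε : ℝ} (hε : 0 < ε) (y : ℝ) {μ : ℝ} (hμ : 0 < μ)
    {z : V} (hz : |z 0| ≤ z 1) {x : ι → V} (hx : ∀ i, |x i 1| < x i 0) {B : ℝ}
    (hB : ∀ w : ℂ, 0 ≤ w.im → ‖P.R w‖ ≤ B) {ζ : ℂ} (h0 : 0 ≤ ζ.im) (h1 : ζ.im ≤ Real.pi) :
    ‖P.stripFun ε μ y z x ζ‖ ≤
      Real.exp (ε * Real.pi ^ 2) * (B ^ 2) ^ Fintype.card ι * Real.exp (-ε * ζ.re ^ 2) := by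
  have hs := Real.sin_nonneg_of_nonneg_of_le_pi h0 h1
  have e1 : ‖Complex.exp (-(ε * ζ ^ 2))‖ ≤
      Real.exp (ε * Real.pi ^ 2) * Real.exp (-ε * ζ.re ^ 2) := by
    rw [Complex.norm_exp, ← Real.exp_add]
    refine Real.exp_le_exp.2 ?_
    have : (-((ε : ℂ) * ζ ^ 2)).re = -ε * ζ.re ^ 2 + ε * ζ.im ^ 2 := by
      rw [Complex.neg_re, Complex.re_ofReal_mul, pow_two, Complex.mul_re]; ring
    rw [this]
    nlinarith [mul_le_mul_of_nonneg_left (pow_le_pow_left₀ h0 h1 2) hε.le]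
  have e2 : ‖Complex.exp (-(Complex.I * (μ * (Complex.cosh ζ * z 0 - Complex.sinh ζ * z 1) -
      y * z 2)))‖ ≤ 1 := by
    rw [Complex.norm_exp]
    refine Real.exp_le_one_iff.2 ?_
    have : (-(Complex.I * (μ * (Complex.cosh ζ * z 0 - Complex.sinh ζ * z 1) - y * z 2))).re =
        -(μ * (Real.sin ζ.im * (Real.cosh ζ.re * z 1 - Real.sinh ζ.re * z 0))) := by
      rw [Complex.neg_re, Complex.I_mul_re, Complex.sub_im, Complex.im_ofReal_mul, Complex.sub_im,
        Complex.im_mul_ofReal, Complex.im_mul_ofReal, im_sinh, im_cosh, ← Complex.ofReal_mul,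
        Complex.ofReal_im]
      ring
    rw [this, neg_nonpos]
    have h2 := abs_sinh_lt_cosh ζ.re
    have h3 : Real.sinh ζ.re * z 0 ≤ |Real.sinh ζ.re| * |z 0| := by
      rw [← abs_mul]; exact le_abs_self _
    have h4 : 0 ≤ Real.cosh ζ.re * z 1 - Real.sinh ζ.re * z 0 := by
      nlinarith [abs_nonneg (z 0), abs_nonneg (Real.sinh ζ.re)]
    positivity
  have e3 : ‖∏ i, P.R (P.kappa * μ * (Complex.sinh ζ * x i 0 - Complex.cosh ζ * x i 1)) ^ 2‖ ≤
      (B ^ 2) ^ Fintype.card ι := by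
    rw [norm_prod]
    refine (Finset.prod_le_prod (fun i _ => norm_nonneg _) (g := fun _ => B ^ 2)
      fun i _ => ?_).trans (by simp)
    rw [norm_pow]
    refine pow_le_pow_left₀ (norm_nonneg _) (hB _ ?_) 2
    rw [im_argR]
    have h1 := cosh_mul_sub_pos (t := ζ.re) (hx i)
    have := P.kappa_pos
    positivity
  have hB2 : 0 ≤ (B ^ 2) ^ Fintype.card ι := by positivity
  calc ‖P.stripFun ε μ y z x ζ‖ ≤ (Real.exp (ε * Real.pi ^ 2) * Real.exp (-ε * ζ.re ^ 2)) * 1 *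
        (B ^ 2) ^ Fintype.card ι := by
        rw [stripFun, norm_mul, norm_mul]
        gcongr
    _ = _ := by ring

theorem integral_stripFun {ι : Type*} [Fintype ι] {ε : ℝ} (hε : 0 < ε) (y : ℝ) {μ : ℝ} (hμ : 0 < μ)
    {z : V} (hz : |z 0| ≤ z 1) {x : ι → V} (hx : ∀ i, |x i 1| < x i 0) :
    ∫ θ : ℝ, P.stripFun ε μ y z x θ =
      ∫ θ : ℝ, P.stripFun ε μ y z x (θ + Real.pi * Complex.I) := by
  obtain ⟨B, hB⟩ := P.isDeformationFunction.bounded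
  exact integral_eq_integral_add_pi (P.continuousOn_stripFun ε y hμ z hx)
    (P.differentiableOn_stripFun ε y hμ z hx) hε
    fun ζ h0 h1 => P.norm_stripFun_le hε y hμ hz hx hB h0 h1

/-- The product of the squares of the deformation functions, for the standard wedge. -/
def prodR {ι : Type*} [Fintype ι] (x : ι → V) (p : V) : ℂ :=
  ∏ i, P.R (mdot (P.Q₀.mulVec p) (x i) : ℝ) ^ 2

theorem continuous_prodR {ι : Type*} [Fintype ι] (x : ι → V) : Continuous (P.prodR x) := by
  refine continuous_finsetProd _ fun i _ => Continuous.pow (P.continuous_R.comp ?_) 2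
  simp only [mdot_Q₀]
  fun_prop

theorem norm_prodR {ι : Type*} [Fintype ι] (x : ι → V) (p : V) : ‖P.prodR x p‖ = 1 := by
  simp [prodR, norm_prod, P.norm_R]

theorem stripFun_ofReal {ι : Type*} [Fintype ι] (ε y : ℝ) (z : V) (x : ι → V) (θ : ℝ) :
    P.stripFun ε √(P.mass ^ 2 + y ^ 2) y z x θ =
      Complex.exp (-(ε * θ ^ 2)) * P.prodR x (rapidityChart P.mass (θ, y)) *
        Complex.exp (Complex.I * (mdot (-rapidityChart P.mass (θ, y)) z : ℝ)) := by
  have h1 : ∀ i, (P.kappa * (√(P.mass ^ 2 + y ^ 2) : ℝ) *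
      (Complex.sinh θ * x i 0 - Complex.cosh θ * x i 1) : ℂ) =
      (mdot (P.Q₀.mulVec (rapidityChart P.mass (θ, y))) (x i) : ℝ) := fun i => by
    rw [mdot_Q₀]
    simp only [rapidityChart, Matrix.cons_val_zero, Matrix.cons_val_one]
    push_cast
    ring
  rw [stripFun, prodR, mul_right_comm]
  simp only [h1]
  congr 2
  simp only [mdot, Pi.neg_apply, rapidityChart, Matrix.cons_val_zero, Matrix.cons_val_one,
    Matrix.cons_val]
  push_cast
  ring

/-- At the rapidity `θ + iπ` the momentum is the negative of the one with rapidity `θ` and second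
component `-y`, and the deformation functions are conjugated by `R(-a) = conj (R a)`. -/
theorem stripFun_add_pi {ι : Type*} [Fintype ι] (ε y : ℝ) (z : V) (x : ι → V) (θ : ℝ) :
    P.stripFun ε √(P.mass ^ 2 + y ^ 2) y z x (θ + Real.pi * Complex.I) =
      Complex.exp (-(ε * (θ + Real.pi * Complex.I) ^ 2)) *
        conj (P.prodR x (rapidityChart P.mass (θ, -y))) *
        Complex.exp (Complex.I * (mdot (rapidityChart P.mass (θ, -y)) z : ℝ)) := by
  have hsinh : Complex.sinh (θ + Real.pi * Complex.I) = -Complex.sinh θ := by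
    rw [Complex.sinh_add, Complex.cosh_mul_I, Complex.sinh_mul_I]; simp
  have hcosh : Complex.cosh (θ + Real.pi * Complex.I) = -Complex.cosh θ := by
    rw [Complex.cosh_add, Complex.cosh_mul_I, Complex.sinh_mul_I]; simp
  have h1 : ∀ i, P.R (P.kappa * (√(P.mass ^ 2 + y ^ 2) : ℝ) *
      (-Complex.sinh θ * x i 0 - -Complex.cosh θ * x i 1) : ℂ) =
      conj (P.R (mdot (P.Q₀.mulVec (rapidityChart P.mass (θ, -y))) (x i) : ℝ)) := fun i => by
    rw [← P.isDeformationFunction.neg, mdot_Q₀]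
    congr 1
    simp only [rapidityChart, Matrix.cons_val_zero, Matrix.cons_val_one, neg_sq]
    push_cast
    ring
  rw [stripFun, prodR, mul_right_comm, map_prod]
  simp only [hsinh, hcosh, h1, map_pow]
  congr 2
  simp only [mdot, rapidityChart, Matrix.cons_val_zero, Matrix.cons_val_one,
    Matrix.cons_val, neg_sq]
  push_cast
  ring

end Model

namespace Model

variable (P : Model)

theorem continuous_rapidityChart_left (m y : ℝ) : Continuous fun θ => rapidityChart m (θ, y) :=
  (continuous_rapidityChart m).comp (by fun_prop)

theorem integrable_exp_neg_mul_sq_ofReal {ε : ℝ} (hε : 0 < ε) {G : ℝ → ℂ} (hG : Continuous G)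
    (hG1 : ∀ θ, ‖G θ‖ = 1) : Integrable fun θ : ℝ => Complex.exp (-(ε * θ ^ 2)) * G θ := by
  refine (integrable_exp_neg_mul_sq hε).mono' (Continuous.aestronglyMeasurable (by fun_prop))
    (Filter.Eventually.of_forall fun θ => ?_)
  rw [norm_mul, hG1, mul_one, Complex.norm_exp]
  refine le_of_eq ?_
  congr 1
  rw [← Complex.ofReal_pow, ← Complex.ofReal_mul, Complex.neg_re, Complex.ofReal_re]
  ring

theorem exp_neg_mul_add_pi_sq (ε θ : ℝ) : Complex.exp (-(ε * (θ + Real.pi * Complex.I) ^ 2)) =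
    Complex.exp (-(ε * θ ^ 2)) * (Complex.exp (ε * Real.pi ^ 2) *
      Complex.exp ((-(2 * ε * Real.pi * θ) : ℝ) * Complex.I)) := by
  rw [← Complex.exp_add, ← Complex.exp_add]
  congr 1
  push_cast
  linear_combination (-(ε : ℂ) * Real.pi ^ 2) * Complex.I_sq

/-- The contour shift for one value of the second momentum component. The Gaussian makes the integral
over the rapidity converge absolutely before the test functions are integrated, so that the
integrals can be interchanged. -/
theorem integral_rapidity_shift {f g : SchwartzTest}
    (hz : ∀ v w, f v ≠ 0 → g w ≠ 0 → |(v - w) 0| ≤ (v - w) 1) {ι : Type*} [Fintype ι] {x : ι → V}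
    (hx : ∀ i, x i ∈ massShell P.mass) {ε : ℝ} (hε : 0 < ε) (y : ℝ) :
    ∫ θ : ℝ, Complex.exp (-(ε * θ ^ 2)) * (P.prodR x (rapidityChart P.mass (θ, y)) *
      (fPlus f (-rapidityChart P.mass (θ, y)) * fPlus g (rapidityChart P.mass (θ, y)))) =
    ∫ θ : ℝ, Complex.exp (-(ε * (θ + Real.pi * Complex.I) ^ 2)) *
      (conj (P.prodR x (rapidityChart P.mass (θ, -y))) *
      (fPlus f (rapidityChart P.mass (θ, -y)) * fPlus g (-rapidityChart P.mass (θ, -y)))) := by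
  have hμ : 0 < √(P.mass ^ 2 + y ^ 2) := Real.sqrt_pos.2 (by have := P.mass_pos; positivity)
  have hc0 := continuous_rapidityChart_left P.mass y
  have hc1 := continuous_rapidityChart_left P.mass (-y)
  have hα0 : Integrable fun θ : ℝ => Complex.exp (-(ε * θ ^ 2)) *
      P.prodR x (rapidityChart P.mass (θ, y)) :=
    integrable_exp_neg_mul_sq_ofReal hε ((P.continuous_prodR x).comp hc0) fun θ => P.norm_prodR x _
  have hα1 : Integrable fun θ : ℝ => Complex.exp (-(ε * (θ + Real.pi * Complex.I) ^ 2)) *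
      conj (P.prodR x (rapidityChart P.mass (θ, -y))) := by
    have h := (integrable_exp_neg_mul_sq_ofReal hε (G := fun θ =>
      Complex.exp ((-(2 * ε * Real.pi * θ) : ℝ) * Complex.I) *
        conj (P.prodR x (rapidityChart P.mass (θ, -y))))
      ((Continuous.mul (by fun_prop) (Complex.continuous_conj.comp
        ((P.continuous_prodR x).comp hc1)))) fun θ => by
        rw [norm_mul, RCLike.norm_conj, P.norm_prodR, Complex.norm_exp_ofReal_mul_I,
          mul_one]).const_mul (Complex.exp (ε * Real.pi ^ 2))
    refine h.congr (Filter.Eventually.of_forall fun θ => ?_)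
    simp only [exp_neg_mul_add_pi_sq]
    ring
  have e0 := integral_mul_fPlus_mul_fPlus f g hα0
    (q := fun θ => -rapidityChart P.mass (θ, y)) hc0.neg
  have e1 := integral_mul_fPlus_mul_fPlus f g hα1 hc1
  simp only [neg_neg, mul_assoc] at e0 e1
  rw [e0, e1]
  congr 1
  ext w
  by_cases hf : f w.1 = 0
  · rw [hf, zero_mul, zero_mul]
  by_cases hg : g w.2 = 0
  · rw [hg, zero_mul, zero_mul, mul_zero]
  have hs := P.integral_stripFun hε y hμ (hz _ _ hf hg)
    (x := x) fun i => abs_lt_of_mem_massShell P.mass_pos (hx i)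
  simp only [stripFun_ofReal, stripFun_add_pi, mul_assoc] at hs
  rw [hs]

theorem memLp_fPlus_neg (f : SchwartzTest) :
    MemLp (fun p => fPlus f (-p)) 2 (shellMeasure P.mass) := by
  have h := (fPlus_memLp P.mass_pos (conjTest f)).star
  refine h.ae_eq (Filter.Eventually.of_forall fun p => ?_)
  exact conj_fPlus_conjTest f p

theorem integrable_bdd_mul_fPlus (f g : SchwartzTest) {G : V → ℂ} (hG : Continuous G)
    (hG1 : ∀ p, ‖G p‖ = 1) :
    Integrable (fun p => G p * (fPlus f (-p) * fPlus g p)) (shellMeasure P.mass) :=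
  ((P.memLp_fPlus_neg f).integrable_mul (fPlus_memLp P.mass_pos g)).bdd_mul (c := 1)
    hG.aestronglyMeasurable (Filter.Eventually.of_forall fun p => (hG1 p).le)

theorem integrable_comp_rapidityChart {h : V → ℂ} (hh : Integrable h (shellMeasure P.mass)) :
    Integrable (fun z => h (rapidityChart P.mass z)) := by
  have := (measurePreserving_rapidityChart P.mass_pos).integrable_comp_of_integrable hh
  exact (integrable_smul_measure (by simp) (by simp)).1 this

theorem integral_comp_rapidityChart {h : V → ℂ} (hh : Integrable h (shellMeasure P.mass)) :
    ∫ p, h p ∂shellMeasure P.mass = (1 / 2 : ℝ) • ∫ z, h (rapidityChart P.mass z) := by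
  rw [← (measurePreserving_rapidityChart P.mass_pos).integral_comp_aesm hh.1,
    integral_smul_measure]
  norm_num

theorem measurePreserving_neg_snd :
    MeasurePreserving (fun z : ℝ × ℝ => (z.1, -z.2)) volume volume :=
  (MeasurePreserving.id volume).prod (Measure.measurePreserving_neg volume)

/-- Shifting the contour of the rapidity integration exchanges the contraction of particles with
the one of antiparticles, for the standard wedge. -/
theorem integral_prodR_eq {f g : SchwartzTest}
    (hz : ∀ v w, f v ≠ 0 → g w ≠ 0 → |(v - w) 0| ≤ (v - w) 1) {ι : Type*} [Fintype ι] {x : ι → V}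
    (hx : ∀ i, x i ∈ massShell P.mass) :
    ∫ p, P.prodR x p * (fPlus f (-p) * fPlus g p) ∂shellMeasure P.mass =
      ∫ p, conj (P.prodR x p) * (fPlus f p * fPlus g (-p)) ∂shellMeasure P.mass := by
  have hI0 := P.integrable_bdd_mul_fPlus f g (P.continuous_prodR x) (P.norm_prodR x)
  have hI1 : Integrable (fun p => conj (P.prodR x p) * (fPlus f p * fPlus g (-p)))
      (shellMeasure P.mass) := by
    refine (P.integrable_bdd_mul_fPlus g f (G := fun p => conj (P.prodR x p))
      (Complex.continuous_conj.comp (P.continuous_prodR x)) fun p => by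
        rw [RCLike.norm_conj, P.norm_prodR]).congr (Filter.Eventually.of_forall fun p => ?_)
    simp only [mul_comm (fPlus g (-p))]
  rw [P.integral_comp_rapidityChart hI0, P.integral_comp_rapidityChart hI1]
  congr 1
  have hJ0 := P.integrable_comp_rapidityChart hI0
  have hJ1' := P.integrable_comp_rapidityChart hI1
  rw [← measurePreserving_neg_snd.integral_comp_aesm hJ1'.1]
  have hJ1 := measurePreserving_neg_snd.integrable_comp_of_integrable hJ1'
  set F0 : ℝ × ℝ → ℂ := fun z => P.prodR x (rapidityChart P.mass z) *
    (fPlus f (-rapidityChart P.mass z) * fPlus g (rapidityChart P.mass z)) with hF0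
  set F1 : ℝ × ℝ → ℂ := fun z => conj (P.prodR x (rapidityChart P.mass (z.1, -z.2))) *
    (fPlus f (rapidityChart P.mass (z.1, -z.2)) * fPlus g (-rapidityChart P.mass (z.1, -z.2)))
    with hF1
  replace hJ1 : Integrable F1 := hJ1
  have hc0 : ∀ ε : ℝ, Continuous fun z : ℝ × ℝ => Complex.exp (-(ε * (z.1 : ℂ) ^ 2)) :=
    fun ε => by fun_prop
  have hc1 : ∀ ε : ℝ, Continuous fun z : ℝ × ℝ =>
      Complex.exp (-(ε * ((z.1 : ℂ) + Real.pi * Complex.I) ^ 2)) := fun ε => by fun_prop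
  have hn0 : ∀ ε : ℝ, 0 < ε → ∀ z : ℝ × ℝ, ‖Complex.exp (-(ε * (z.1 : ℂ) ^ 2))‖ ≤ 1 := by
    intro ε hε z
    rw [Complex.norm_exp, Real.exp_le_one_iff, ← Complex.ofReal_pow, ← Complex.ofReal_mul,
      Complex.neg_re, Complex.ofReal_re, neg_nonpos]
    positivity
  have hn1 : ∀ ε : ℝ, 0 < ε → ε ≤ 1 → ∀ z : ℝ × ℝ,
      ‖Complex.exp (-(ε * ((z.1 : ℂ) + Real.pi * Complex.I) ^ 2))‖ ≤ Real.exp (Real.pi ^ 2) := by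
    intro ε hε hε1 z
    rw [exp_neg_mul_add_pi_sq, norm_mul, norm_mul, Complex.norm_exp_ofReal_mul_I, mul_one]
    refine (mul_le_of_le_one_left (norm_nonneg _) (hn0 ε hε z)).trans ?_
    rw [← Complex.ofReal_pow, ← Complex.ofReal_mul, Complex.norm_exp_ofReal, Real.exp_le_exp]
    exact mul_le_of_le_one_left (by positivity) hε1
  have hreg : ∀ ε : ℝ, 0 < ε → ε ≤ 1 → ∫ z : ℝ × ℝ, Complex.exp (-(ε * (z.1 : ℂ) ^ 2)) * F0 z =
      ∫ z : ℝ × ℝ, Complex.exp (-(ε * ((z.1 : ℂ) + Real.pi * Complex.I) ^ 2)) * F1 z := by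
    intro ε hε hε1
    have i0 := hJ0.bdd_mul (hc0 ε).aestronglyMeasurable (Filter.Eventually.of_forall (hn0 ε hε))
    have i1 := hJ1.bdd_mul (hc1 ε).aestronglyMeasurable
      (Filter.Eventually.of_forall (hn1 ε hε hε1))
    rw [Measure.volume_eq_prod] at i0 i1 ⊢
    rw [integral_prod_symm _ i0, integral_prod_symm _ i1]
    congr 1
    ext y
    exact P.integral_rapidity_shift hz hx hε y
  -- removal of the regularization
  have hε : ∀ n : ℕ, (0 : ℝ) < 1 / ((n : ℝ) + 1) := fun n => by positivity
  have hε1 : ∀ n : ℕ, (1 : ℝ) / ((n : ℝ) + 1) ≤ 1 := fun n => by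
    rw [div_le_one (by positivity)]; linarith [(Nat.cast_nonneg n : (0 : ℝ) ≤ n)]
  have hlim : Filter.Tendsto (fun n : ℕ => (((1 / ((n : ℝ) + 1) : ℝ)) : ℂ)) Filter.atTop
      (nhds 0) := by
    have h := (Complex.continuous_ofReal.tendsto 0).comp (tendsto_one_div_add_atTop_nhds_zero_nat
      (𝕜 := ℝ))
    rw [Complex.ofReal_zero] at h
    exact h
  have l0 := tendsto_integral_of_dominated_convergence (μ := (volume : Measure (ℝ × ℝ)))
    (F := fun (n : ℕ) z => Complex.exp (-(((1 / ((n : ℝ) + 1) : ℝ) : ℂ) * (z.1 : ℂ) ^ 2)) * F0 z)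
    (f := F0) (fun z => ‖F0 z‖) (fun n => (hc0 _).aestronglyMeasurable.mul hJ0.1) hJ0.norm
    (fun n => Filter.Eventually.of_forall fun z => by
      rw [norm_mul]
      exact mul_le_of_le_one_left (norm_nonneg _) (hn0 _ (hε n) z))
    (Filter.Eventually.of_forall fun z => by
      have h := ((Complex.continuous_exp.tendsto _).comp
        (hlim.mul_const ((z.1 : ℂ) ^ 2)).neg).mul_const (F0 z)
      simpa using! h)
  have l1 := tendsto_integral_of_dominated_convergence (μ := (volume : Measure (ℝ × ℝ)))
    (F := fun (n : ℕ) z => Complex.exp (-(((1 / ((n : ℝ) + 1) : ℝ) : ℂ) *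
      ((z.1 : ℂ) + Real.pi * Complex.I) ^ 2)) * F1 z)
    (f := F1) (fun z => Real.exp (Real.pi ^ 2) * ‖F1 z‖)
    (fun n => (hc1 _).aestronglyMeasurable.mul hJ1.1) (hJ1.norm.const_mul _)
    (fun n => Filter.Eventually.of_forall fun z => by
      rw [norm_mul]
      exact mul_le_mul_of_nonneg_right (hn1 _ (hε n) (hε1 n) z) (norm_nonneg _))
    (Filter.Eventually.of_forall fun z => by
      have h := ((Complex.continuous_exp.tendsto _).comp
        (hlim.mul_const (((z.1 : ℂ) + Real.pi * Complex.I) ^ 2)).neg).mul_const (F1 z)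
      simpa using! h)
  refine tendsto_nhds_unique (l0.congr fun n => ?_) l1
  exact hreg _ (hε n) (hε1 n)

/-! ### Contractions of test functions with separated supports -/

/-- The supports of test functions which make two translated opposite wedges spacelike separated
lie in the order of the wedges. -/
theorem abs_le_of_subset_causalCompl {W W' : PathOfWedges} {L : CoverLorentz}
    (hL : L • standardPath = W) (hW : W'.wedge = causalCompl W.wedge) {A B : Set V}
    (h : A + W.wedge ⊆ causalCompl (B + W'.wedge)) {v w : V} (hv : v ∈ A) (hw : w ∈ B) :
    |(L⁻¹.act v - L⁻¹.act w) 0| ≤ (L⁻¹.act v - L⁻¹.act w) 1 := by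
  refine abs_le_of_forall_spacelike fun s hs => ?_
  have hWw : W.wedge = L.act '' standardWedge := by
    rw [← hL, wedge_smul, wedge_standardPath]
  have hs' : |s 0| < s 1 := hs
  have h1 : v + L.act ((1 / 2 : ℝ) • s) ∈ A + W.wedge := by
    refine Set.add_mem_add hv ?_
    rw [hWw]
    refine ⟨_, ?_, rfl⟩
    change |(1 / 2 : ℝ) * s 0| < 1 / 2 * s 1
    rw [abs_mul, abs_of_pos (by norm_num : (0 : ℝ) < 1 / 2)]
    linarith
  have h2 : w + L.act (-((1 / 2 : ℝ) • s)) ∈ B + W'.wedge := by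
    refine Set.add_mem_add hw ?_
    rw [hW, hWw, causalCompl_act, causalCompl_standardWedge]
    refine ⟨_, ?_, rfl⟩
    change -((1 / 2 : ℝ) * s 1) < -|-((1 / 2 : ℝ) * s 0)|
    rw [abs_neg, abs_mul, abs_of_pos (by norm_num : (0 : ℝ) < 1 / 2)]
    linarith
  have h3 := interior_subset (h h1) _ h2
  have h4 : L⁻¹.act v - L⁻¹.act w + s = L⁻¹.act (v + L.act ((1 / 2 : ℝ) • s) -
      (w + L.act (-((1 / 2 : ℝ) • s)))) := by
    rw [CoverLorentz.act_sub, CoverLorentz.act_add, CoverLorentz.act_add,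
      CoverLorentz.act_inv_act, CoverLorentz.act_inv_act]
    ext i
    simp only [Pi.sub_apply, Pi.add_apply, Pi.smul_apply, Pi.neg_apply, smul_eq_mul]
    ring
  rw [h4, CoverLorentz.mdot_act]
  exact h3

theorem fPlus_act (L : CoverLorentz) (f : SchwartzTest) (p : V) :
    fPlus f (L.act p) = fPlus (poincareTest 0 L⁻¹ f) p := by
  rw [fPlus_poincareTest, scalarAction, mdot_zero_left, inv_inv]
  simp

/-- The contractions of particles and of antiparticles agree if the supports of the test functions
are separated by the wedge. -/
theorem integral_contraction_eq {W W' : PathOfWedges} (hW : W'.wedge = causalCompl W.wedge)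
    {f g : SchwartzTest} (h : tsupport f + W.wedge ⊆ causalCompl (tsupport g + W'.wedge))
    {ι : Type*} [Fintype ι] {x : ι → V} (hx : ∀ i, x i ∈ massShell P.mass) :
    ∫ p, (∏ i, P.R (mdot ((P.Q W).mulVec p) (x i) : ℝ) ^ 2) * (fPlus f (-p) * fPlus g p)
      ∂shellMeasure P.mass =
    ∫ p, conj (∏ i, P.R (mdot ((P.Q W).mulVec p) (x i) : ℝ) ^ 2) * (fPlus f p * fPlus g (-p))
      ∂shellMeasure P.mass := by
  obtain ⟨L, hL⟩ := exists_smul_standardPath W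
  have hmp := CoverLorentz.measurePreserving_act P.mass_pos L
  have hme : MeasurableEmbedding L.act :=
    (CoverLorentz.actEquiv L).toHomeomorph.measurableEmbedding
  have hR : ∀ p, ∏ i, P.R (mdot ((P.Q W).mulVec (L.act p)) (x i) : ℝ) ^ 2 =
      P.prodR (fun i => L⁻¹.act (x i)) p := fun p => by
    refine Finset.prod_congr rfl fun i _ => ?_
    rw [P.Q_eq hL, boostedMatrix_mulVec, CoverLorentz.mdot_act_left, CoverLorentz.act_inv_act]
  have hn : ∀ p, -L.act p = L.act (-p) := fun p => (L.act_neg p).symm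
  have key := P.integral_prodR_eq (f := poincareTest 0 L⁻¹ f) (g := poincareTest 0 L⁻¹ g)
    (x := fun i => L⁻¹.act (x i)) (fun v w hv hw => ?_)
    fun i => act_mem_massShell P.mass_pos L⁻¹ (hx i)
  · refine (hmp.integral_comp hme _).symm.trans
      (Eq.trans (Eq.trans ?_ (key.trans ?_)) (hmp.integral_comp hme _))
    · refine integral_congr_ae (Filter.Eventually.of_forall fun p => ?_)
      simp only [hR, hn, fPlus_act]
    · refine integral_congr_ae (Filter.Eventually.of_forall fun p => ?_)
      simp only [hR, hn, fPlus_act]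
  · rw [poincareTest_apply, inv_inv, sub_zero] at hv hw
    have := abs_le_of_subset_causalCompl hL hW h (subset_tsupport _ (Function.mem_support.2 hv))
      (subset_tsupport _ (Function.mem_support.2 hw))
    rwa [CoverLorentz.act_inv_act, CoverLorentz.act_inv_act] at this

theorem opposite_of_statisticsNumber {W W' : PathOfWedges} {k : ℤ}
    (h : IsStatisticsNumber W W' k) :
    P.Opposite W W' (Complex.exp (-(Complex.I * (P.spin * (k * Real.pi) : ℝ)))) where
  conj_mul := by
    rw [← Complex.exp_conj, ← Complex.exp_add]
    simp
  u_eq _ hp := P.u_of_statisticsNumber h hp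
  Q_eq := P.Q_of_statisticsNumber h

theorem field_fieldStar_of_subset {W W' : PathOfWedges} {c : ℂ} (hc : P.Opposite W W' c)
    (hW : W'.wedge = causalCompl W.wedge) {f g : SchwartzTest}
    (h : tsupport f + W.wedge ⊆ causalCompl (tsupport g + W'.wedge)) (Ψ : FiniteParticle P.mass) :
    P.field W f (P.fieldStar W' g Ψ) = conj c ^ 2 • P.fieldStar W' g (P.field W f Ψ) := by
  refine hc.field_fieldStar Ψ fun n k x hx => ?_
  rw [contraction_congr W' W (P.coeFn_plus g) (P.coeFn_plus (conjTest f)),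
    contraction_congr W W' (P.coeFn_plus f) (P.coeFn_plus (conjTest g)),
    hc.contraction_eq' _ _ hx, hc.contraction_eq _ _ hx]
  simp only [conj_fPlus_conjTest]
  congr 2
  have key := P.integral_contraction_eq hW h (x := Sum.elim x.1 x.2)
    (by rintro (i | i); exacts [hx.1 i, hx.2 i])
  simp only [Fintype.prod_sum_type, Sum.elim_inl, Sum.elim_inr, map_mul, map_prod, map_pow] at key
  refine Eq.trans ?_ (key.trans ?_)
  · congr 1
    ext p
    ring
  · congr 1
    ext p
    ring

end Model

end WedgeAnyons

end

open WedgeAnyons MeasureTheory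
open scoped Pointwise
theorem mainTheorem1 (P : Model) :
    -- every path of wedges is a Lorentz transform of the standard one, and the intertwiners and
    -- deformation matrices do not depend on the choice of the transformation
    (∀ W : PathOfWedges, ∃ L : CoverLorentz, L • standardPath = W) ∧
    (∀ (W : PathOfWedges) (L : CoverLorentz), L • standardPath = W →
      P.Q W = P.boostedMatrix L ∧
      ∀ q : ℝ × ℝ, P.u W (onShell P.mass q) = P.boostedIntertwiner L (onShell P.mass q)) ∧
    -- anyonic commutation relations
    (∀ W W' : PathOfWedges, W'.wedge = causalCompl W.wedge →
      (∃! k : ℤ, IsStatisticsNumber W W' k) ∧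
      ∀ k : ℤ, IsStatisticsNumber W W' k →
      ∀ f g : SchwartzTest,
        tsupport f + W.wedge ⊆ causalCompl (tsupport g + W'.wedge) →
        ∀ Ψ : FiniteParticle P.mass,
          P.field W f (P.field W' g Ψ) =
            Complex.exp (-(2 * Real.pi * Complex.I * P.spin * k)) •
              P.field W' g (P.field W f Ψ) ∧
          P.field W f (P.fieldStar W' g Ψ) =
            Complex.exp (2 * Real.pi * Complex.I * P.spin * k) •
              P.fieldStar W' g (P.field W f Ψ)) ∧
    -- covariance under the spin `λ` representation of the covering Poincaré group
    (∃ U : V → CoverLorentz → Fock P.mass ≃ₗᵢ[ℂ] Fock P.mass,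
      P.IsSpinRepresentation U ∧
      (∀ a L, ∀ Ψ ∈ FiniteParticle P.mass, U a L Ψ ∈ FiniteParticle P.mass) ∧
      ∀ (a : V) (L : CoverLorentz) (W : PathOfWedges) (f : SchwartzTest)
        (Ψ Ψ' : FiniteParticle P.mass), (Ψ' : Fock P.mass) = U a L Ψ →
          U a L (P.field W f Ψ) = P.field (L • W) (poincareTest a L f) Ψ' ∧
          U a L (P.fieldStar W f Ψ) = P.fieldStar (L • W) (poincareTest a L f) Ψ') := by
  refine ⟨exists_smul_standardPath, fun W L hL => ⟨P.Q_eq hL, fun q =>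
    P.u_eq hL (onShell_mem_massShell P.mass_pos q)⟩, fun W W' hW => ⟨?_, ?_⟩, P.spinFock,
    P.isSpinRepresentation_spinFock, fun a L Ψ hΨ => P.spinFock_mem_finiteParticle a L hΨ,
    fun a L W f Ψ Ψ' h => ⟨P.spinFock_field a L W f Ψ Ψ' h, P.spinFock_fieldStar a L W f Ψ Ψ' h⟩⟩
  · obtain ⟨k, hk⟩ := exists_statisticsNumber hW
    exact ⟨k, hk, fun k' hk' => statisticsNumber_unique hk hk'⟩
  · intro k hk f g hfg Ψ
    have hc := P.opposite_of_statisticsNumber hk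
    have h1 : Complex.exp (-(Complex.I * (P.spin * (k * Real.pi) : ℝ))) ^ 2 =
        Complex.exp (-(2 * Real.pi * Complex.I * P.spin * k)) := by
      rw [← Complex.exp_nat_mul]
      congr 1
      push_cast
      ring
    have h2 : starRingEnd ℂ (Complex.exp (-(Complex.I * (P.spin * (k * Real.pi) : ℝ)))) ^ 2 =
        Complex.exp (2 * Real.pi * Complex.I * P.spin * k) := by
      rw [← map_pow, h1, ← Complex.exp_conj]
      congr 1
      simp [map_ofNat]
    exact ⟨h1 ▸ hc.field_field Ψ f g, h2 ▸ P.field_fieldStar_of_subset hc hW hfg Ψ⟩
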